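/- Let $h,k>0$, let $\alpha=(\alpha_1,\alpha_2,0)\in\mathbb R^3$, and put $\Omega=(0,2\pi)^2\times(0,h)$, $\Gamma_0=(0,2\pi)^2\times\{0\}$, $\Gamma_h=(0,2\pi)^2\times\{h\}$, $e_3=(0,0,1)^\top$. Write $\partial_j^\alpha f=\partial f/\partial x_j+i\alpha_j f$, let $\nabla_\alpha$ be the corresponding gradient (componentwise for vector fields), and put $\operatorname{curl}_\alpha F=\operatorname{curl}F+i\alpha\times F$, $\operatorname{div}_\alpha F=\operatorname{div}F+i\alpha\cdot F$. Let $H^1_{\mathrm p}(\Omega)$ be the space of those $f\in H^1(\Omega)$ (complex valued) that are restrictions to $\Omega$ of functions in $H^1_{\mathrm{loc}}(\mathbb R^3)$ which are $2\pi$-periodic in $x_1$ and in $x_2$, and let $H^1_{\mathrm p,\mathrm T}(\Omega)^3=\{F\in H^1_{\mathrm p}(\Omega)^3 : F_3=0 \text{ on }\Gamma_0\}$, in the sense of traces. For $n=(n_1,n_2,0)$ with $n_1,n_2\in\mathbb Z$ let $\hat f_n=\frac1{4\pi^2}\int_{\Gamma_h}f\,e^{-in\cdot x}\,ds$, and let $\beta_n=\sqrt{k^2-|n+\alpha|^2}$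 if $k^2\ge|n+\alpha|^2$ and $\beta_n=i\sqrt{|n+\alpha|^2-k^2}$ otherwise. Let $T_\alpha f=\sum_n i\beta_n\hat f_n e^{in\cdot x}$ and $R_\alpha=(\partial_1^\alpha,\partial_2^\alpha,T_\alpha)$, acting on traces on $\Gamma_h$. For $a,b$ on $\Gamma_h$ the integral $\int_{\Gamma_h}a\cdot\overline b\,ds$ is understood as the $H^{-1/2}$-$H^{1/2}$ pairing $4\pi^2\sum_n\hat a_n\cdot\overline{\hat b_n}$. Let $\varepsilon_{\mathrm r}$ be a real function on $\Omega$ such that $\varepsilon_{\mathrm r}^{-1}\in L^\infty(\Omega)$ is positive and bounded away from zero, and such that, for some $h_0<h$, $\varepsilon_{\mathrm r}=1$ almost everywhere in $\Omega\cap\{x_3>h_0\}$. Let $\rho\in\mathbb C$ with $\operatorname{Re}\rho=\operatorname{ess\,inf}_\Omega\varepsilon_{\mathrm r}^{-1}$ and $\operatorname{Im}\rho<0$. For $H,F\in H^1_{\mathrm p,\mathrm T}(\Omega)^3$ put $$\mathcal B(H,F)=\int_\Omega\big(\varepsilon_{\mathrm r}^{-1}\operatorname{curl}_\alpha H\cdot\overline{\operatorname{curl}_\alpha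 F}-k^2H\cdot\overline F\big)\,dx+\rho\int_\Omega(\operatorname{div}_\alpha H)(\overline{\operatorname{div}_\alpha F})\,dx+\int_{\Gamma_h}e_3\times(R_\alpha\times H)\cdot\overline F\,ds-\int_{\Gamma_h}(R_\alpha\cdot H)(e_3\cdot\overline F)\,ds .$$ Then the series defining the two boundary pairings converge absolutely for all $H,F\in H^1_{\mathrm p,\mathrm T}(\Omega)^3$, and $\mathcal B$ satisfies a Gårding inequality: there exist constants $c_1,c_2>0$ such that $$\operatorname{Re}\mathcal B(H,H)\ \ge\ c_1\int_\Omega|\nabla_\alpha H|^2\,dx-c_2\int_\Omega|H|^2\,dx\qquad\text{for all }H\in H^1_{\mathrm p,\mathrm T}(\Omega)^3 .$$ -/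

import Mathlib

open MeasureTheory Set
open scoped ContDiff Matrix

noncomputable section

namespace Biperiodic

/-- Euclidean space `ℝ³`; the coordinates `x₁, x₂, x₃` are `x 0, x 1, x 2`. -/
abbrev E3 : Type := EuclideanSpace ℝ (Fin 3)

/-- The `j`-th unit vector of `ℝ³`. -/
def unitVec (j : Fin 3) : E3 := EuclideanSpace.single j 1

/-- The periodicity cell `(0, 2π)²`. -/
def cell : Set (ℝ × ℝ) := Ioo 0 (2 * Real.pi) ×ˢ Ioo 0 (2 * Real.pi)

/-- The domain `Ω = (0, 2π)² × (0, h)`. -/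
def Omega (h : ℝ) : Set E3 :=
  {x | x 0 ∈ Ioo 0 (2 * Real.pi) ∧ x 1 ∈ Ioo 0 (2 * Real.pi) ∧ x 2 ∈ Ioo 0 h}

/-- The point `(y₁, y₂, t)`. -/
def atHeight (t : ℝ) (y : ℝ × ℝ) : E3 := !₂[y.1, y.2, t]

/-! ### Weak derivatives and Sobolev spaces -/

/-- `g` is the weak (distributional) derivative `∂f/∂x_j` on the open set `U`. -/
def IsWeakDeriv (U : Set E3) (j : Fin 3) (f g : E3 → ℂ) : Prop :=
  LocallyIntegrableOn f U volume ∧ LocallyIntegrableOn g U volume ∧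
    ∀ φ : E3 → ℝ, ContDiff ℝ ∞ φ → HasCompactSupport φ → tsupport φ ⊆ U →
      ∫ x in U, fderiv ℝ φ x (unitVec j) • f x = -∫ x in U, φ x • g x

open Classical in
/-- The weak derivative `∂f/∂x_j` on `U` (unique up to null sets of `U`; zero if there is none). -/
def weakDeriv (U : Set E3) (j : Fin 3) (f : E3 → ℂ) : E3 → ℂ :=
  if hf : ∃ g, IsWeakDeriv U j f g then hf.choose else 0

/-- `f ∈ H¹(U)`. -/
def MemH1 (U : Set E3) (f : E3 → ℂ) : Prop :=
  MemLp f 2 (volume.restrict U) ∧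
    ∀ j, ∃ g, MemLp g 2 (volume.restrict U) ∧ IsWeakDeriv U j f g

/-- `f ∈ H¹_loc(ℝ³)`: the restriction of `f` to every ball is in `H¹`. -/
def MemH1Loc (f : E3 → ℂ) : Prop := ∀ (c : E3) (r : ℝ), MemH1 (Metric.ball c r) f

/-- `f` is `2π`-periodic in `x₁` and in `x₂`. -/
def IsBiperiodic (f : E3 → ℂ) : Prop :=
  ∀ x, f (x + (2 * Real.pi) • unitVec 0) = f x ∧ f (x + (2 * Real.pi) • unitVec 1) = f x

/-- `f ∈ H¹_p(Ω)`: `f ∈ H¹(Ω)` is the restriction to `Ω` of a biperiodic function in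
`H¹_loc(ℝ³)`. -/
def MemH1p (h : ℝ) (f : E3 → ℂ) : Prop :=
  MemH1 (Omega h) f ∧
    ∃ ft : E3 → ℂ, IsBiperiodic ft ∧ MemH1Loc ft ∧ ∀ᵐ x ∂volume.restrict (Omega h), f x = ft x

/-! ### Traces

The trace of `u ∈ H¹(Ω)` on a face of `Ω` is the `L²` function on that face for which Green's
formula holds against all smooth test functions that vanish near the other faces.
Faces are parametrized by `(x₁, x₂) ∈ (0, 2π)²`. -/

/-- `g` is the trace of `u` on `Γ_h = (0, 2π)² × {h}` (outward normal `e₃`). -/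
def IsTraceTop (h : ℝ) (u : E3 → ℂ) (g : ℝ × ℝ → ℂ) : Prop :=
  MemLp g 2 (volume.restrict cell) ∧
    ∀ φ : E3 → ℝ, ContDiff ℝ ∞ φ → HasCompactSupport φ →
      tsupport φ ⊆ {x | x 0 ∈ Ioo 0 (2 * Real.pi) ∧ x 1 ∈ Ioo 0 (2 * Real.pi) ∧ 0 < x 2} →
      (∫ x in Omega h, (fderiv ℝ φ x (unitVec 2) • u x + φ x • weakDeriv (Omega h) 2 u x))
        = ∫ y in cell, φ (atHeight h y) • g y

/-- `g` is the trace of `u` on `Γ_0 = (0, 2π)² × {0}` (outward normal `-e₃`). -/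
def IsTraceBottom (h : ℝ) (u : E3 → ℂ) (g : ℝ × ℝ → ℂ) : Prop :=
  MemLp g 2 (volume.restrict cell) ∧
    ∀ φ : E3 → ℝ, ContDiff ℝ ∞ φ → HasCompactSupport φ →
      tsupport φ ⊆ {x | x 0 ∈ Ioo 0 (2 * Real.pi) ∧ x 1 ∈ Ioo 0 (2 * Real.pi) ∧ x 2 < h} →
      (∫ x in Omega h, (fderiv ℝ φ x (unitVec 2) • u x + φ x • weakDeriv (Omega h) 2 u x))
        = -∫ y in cell, φ (atHeight 0 y) • g y

open Classical in
/-- The trace of `u` on `Γ_h` (unique up to null sets; zero if there is none). -/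
def traceTop (h : ℝ) (u : E3 → ℂ) : ℝ × ℝ → ℂ :=
  if hu : ∃ g, IsTraceTop h u g then hu.choose else 0

/-- `F ∈ H¹_{p,T}(Ω)³`: the components are in `H¹_p(Ω)`, and `F₃ = 0` on `Γ_0`. -/
def MemH1pT (h : ℝ) (F : E3 → Fin 3 → ℂ) : Prop :=
  (∀ i, MemH1p h (fun x => F x i)) ∧ IsTraceBottom h (fun x => F x 2) 0

/-! ### The operators `∇_α`, `curl_α`, `div_α` on `U` -/

/-- `∂^α f / ∂x_j = ∂f/∂x_j + i α_j f`. -/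
def dAlpha (U : Set E3) (α : E3) (j : Fin 3) (f : E3 → ℂ) (x : E3) : ℂ :=
  weakDeriv U j f x + Complex.I * (α j : ℂ) * f x

/-- `|∇_α F|²`, the sum of all `|∂^α F_i / ∂x_j|²`. -/
def gradAlphaSq (U : Set E3) (α : E3) (F : E3 → Fin 3 → ℂ) (x : E3) : ℝ :=
  ∑ i, ∑ j, ‖dAlpha U α j (fun z => F z i) x‖ ^ 2

/-- `curl_α F = curl F + i α × F`. -/
def curlAlpha (U : Set E3) (α : E3) (F : E3 → Fin 3 → ℂ) (x : E3) : Fin 3 → ℂ :=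
  ![dAlpha U α 1 (fun z => F z 2) x - dAlpha U α 2 (fun z => F z 1) x,
    dAlpha U α 2 (fun z => F z 0) x - dAlpha U α 0 (fun z => F z 2) x,
    dAlpha U α 0 (fun z => F z 1) x - dAlpha U α 1 (fun z => F z 0) x]

/-- `div_α F = div F + i α · F`. -/
def divAlpha (U : Set E3) (α : E3) (F : E3 → Fin 3 → ℂ) (x : E3) : ℂ :=
  ∑ j, dAlpha U α j (fun z => F z j) x

/-! ### Boundary operators through Fourier series on `Γ_h` -/

/-- The Fourier coefficient `(4π²)⁻¹ ∫_{(0,2π)²} g(y) exp(-i n·y) dy`. -/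
def fourierCoef (g : ℝ × ℝ → ℂ) (n : ℤ × ℤ) : ℂ :=
  (1 / (4 * (Real.pi : ℂ) ^ 2)) *
    ∫ y in cell, g y * Complex.exp (-(Complex.I * ((n.1 : ℂ) * (y.1 : ℂ) + (n.2 : ℂ) * (y.2 : ℂ))))

/-- The Fourier coefficients `Ĥ_n ∈ ℂ³` of the trace of `H` on `Γ_h`. -/
def traceCoef (h : ℝ) (H : E3 → Fin 3 → ℂ) (n : ℤ × ℤ) : Fin 3 → ℂ :=
  fun i => fourierCoef (traceTop h (fun x => H x i)) n

/-- `|n + α|²` for `n = (n₁, n₂, 0)`. -/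
def normSqShift (α : E3) (n : ℤ × ℤ) : ℝ :=
  ((n.1 : ℝ) + α 0) ^ 2 + ((n.2 : ℝ) + α 1) ^ 2 + α 2 ^ 2

/-- `β_n = √(k² - |n+α|²)` if `k² ≥ |n+α|²`, and `β_n = i √(|n+α|² - k²)` otherwise. -/
def beta (k : ℝ) (α : E3) (n : ℤ × ℤ) : ℂ :=
  if normSqShift α n ≤ k ^ 2 then (Real.sqrt (k ^ 2 - normSqShift α n) : ℂ)
  else Complex.I * (Real.sqrt (normSqShift α n - k ^ 2) : ℂ)

/-- The action of `R_α = (∂^α/∂x₁, ∂^α/∂x₂, T_α)` on the Fourier mode `exp(i n·x)`, that is,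
`(i(n₁+α₁), i(n₂+α₂), i β_n)`; here `T_α` multiplies the `n`-th Fourier coefficient by `i β_n`. -/
def symbolR (k : ℝ) (α : E3) (n : ℤ × ℤ) : Fin 3 → ℂ :=
  ![Complex.I * ((n.1 : ℂ) + (α 0 : ℂ)), Complex.I * ((n.2 : ℂ) + (α 1 : ℂ)),
    Complex.I * beta k α n]

/-- The unit vector `e₃` in `ℂ³`. -/
def e3 : Fin 3 → ℂ := ![0, 0, 1]

/-- The Fourier coefficients of `e₃ × (R_α × H)` on `Γ_h`. -/
def crossR (h k : ℝ) (α : E3) (H : E3 → Fin 3 → ℂ) (n : ℤ × ℤ) : Fin 3 → ℂ :=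
  e3 ⨯₃ (symbolR k α n ⨯₃ traceCoef h H n)

/-- The Fourier coefficients of `R_α · H` on `Γ_h`. -/
def dotR (h k : ℝ) (α : E3) (H : E3 → Fin 3 → ℂ) (n : ℤ × ℤ) : ℂ :=
  symbolR k α n ⬝ᵥ traceCoef h H n

/-- `∫_{Γ_h} a · conj b ds` as the pairing of `H^{-1/2}_p(Γ_h)^d` and `H^{1/2}_p(Γ_h)^d`,
in terms of the Fourier coefficients of `a` and `b`. -/
def pairing {d : ℕ} (a b : ℤ × ℤ → Fin d → ℂ) : ℂ :=
  4 * (Real.pi : ℂ) ^ 2 * ∑' n, a n ⬝ᵥ star (b n)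

/-! ### The sesquilinear form -/

/-- The sesquilinear form `B(H, F)` with wave number `k`, quasiperiodicity `α`, relative
permittivity `ε` and penalty parameter `ρ`. -/
def formB (h k : ℝ) (α : E3) (ε : E3 → ℝ) (ρ : ℂ) (H F : E3 → Fin 3 → ℂ) : ℂ :=
  (∫ x in Omega h,
      ((((ε x)⁻¹ : ℝ) : ℂ) *
          (curlAlpha (Omega h) α H x ⬝ᵥ star (curlAlpha (Omega h) α F x))
        - (k : ℂ) ^ 2 * (H x ⬝ᵥ star (F x))))
    + ρ * (∫ x in Omega h, divAlpha (Omega h) α H x * star (divAlpha (Omega h) α F x))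
    + pairing (crossR h k α H) (traceCoef h F)
    - pairing (d := 1) (fun n => ![dotR h k α H n]) (fun n => ![e3 ⬝ᵥ traceCoef h F n])

end Biperiodic

end

open Biperiodic

/-! Expanding in Fourier series in the horizontal variables diagonalises every term with constant
coefficients, so the inequality reduces to an estimate for one mode `n`, summed by Parseval's
identity (`hasSum_integral_norm_sq_coefAt`). Number components from 0 as in the code, let `a i` be
the coefficient of the component `H_i` as a function of the height, and put `x = n₁ + α₁`, `y = n₂ +
α₂`, `r = |n + α|`, `S = ∑ i, |a i h|²` and `m = 2 Re (i (x (a 0 h) + y (a 1 h)) conj (a 2 h))`.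

For one mode, `|curl|² + |div|²` and `|∇|²` differ by a total derivative in the height. Integrating
it, with `a 2 0 = 0` from the condition on the bottom face, leaves exactly `m`
(`MemH1pT.integral_curl_add_div`). The real part of the boundary form is `-m + (Im β_n) S`
(`re_boundary`). With `c = Re ρ`, the variable coefficient is bounded below by `c`, and `0 < c ≤ 1`
because the coefficient equals one near the top (`essInf_inv_facts`). If `G` is the gradient
integral of the mode, what has to be bounded below is therefore `c G - (1 - c) m + (Im β_n) S`. Now
`|m| ≤ r S` and `Im β_n ≥ r - k`, so the parts growing with `n` combine to something nonnegative and
only `-k S` remains. The trace inequality on an interval absorbs it into `c/2 · G` and a multiple of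
the `L²` norm (`MemH1pT.mode_garding`). The same trace inequality, with a parameter that grows with
`n`, puts traces in `H^{1/2}`; since the boundary symbols grow only like `r`, both pairings converge
absolutely.

The larger part of the work justifies the mode-wise calculus for `weakDeriv` and `traceTop`, which
are choices from almost-everywhere classes. Testing the periodic extension with localized characters
times a function of the height, and folding back onto the cell, shows that horizontal derivatives
act as multiplication and that each coefficient has an absolutely continuous representative
(`MemH1p.integral_triple`, `MemH1p.integral_mul_coefAt`). Green's formula then identifies the
coefficients of the trace with the endpoint values of these representatives
(`MemH1p.fourierCoef_traceTop`). -/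

noncomputable section

namespace Biperiodic

/-! ### Primitives on an interval -/

/-- On `[0, h]` the function `a` is an antiderivative of the integrable function `p`. -/
structure IsPrimitiveOn (h : ℝ) (p a : ℝ → ℂ) : Prop where
  intervalIntegrable : IntervalIntegrable p volume 0 h
  eq : ∀ t ∈ Icc 0 h, a t = a 0 + ∫ s in (0 : ℝ)..t, p s

/-- Real and imaginary parts are treated separately and recombined. Absolute continuity is what
allows a function to be recovered from a derivative known only almost everywhere. -/
lemma absolutelyContinuousOnInterval_integral_complex {p : ℝ → ℂ} {h : ℝ}
    (hp : IntervalIntegrable p volume 0 h) :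
    AbsolutelyContinuousOnInterval (fun t => ∫ s in (0 : ℝ)..t, p s) 0 h := by
  have hre : IntervalIntegrable (fun t => (p t).re) volume 0 h :=
    ⟨hp.1.re, hp.2.re⟩
  have him : IntervalIntegrable (fun t => (p t).im) volume 0 h :=
    ⟨hp.1.im, hp.2.im⟩
  have h1 := (hre.absolutelyContinuousOnInterval_intervalIntegral (c := 0) (by simp))
  have h2 := (him.absolutelyContinuousOnInterval_intervalIntegral (c := 0) (by simp))
  have key : ∀ f : ℝ → ℝ, AbsolutelyContinuousOnInterval f 0 h →
      AbsolutelyContinuousOnInterval (fun t => (f t : ℂ)) 0 h := by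
    intro f hf
    unfold AbsolutelyContinuousOnInterval at hf ⊢
    simpa [Complex.dist_eq, ← Complex.ofReal_sub, Real.dist_eq] using hf
  have h3 := (key _ h1).add ((key _ h2).const_smul Complex.I)
  have heq : ∀ t ∈ uIcc 0 h, (∫ s in (0 : ℝ)..t, p s) =
      ((fun t => ((∫ s in (0 : ℝ)..t, (p s).re : ℝ) : ℂ)) +
        fun t => Complex.I • ((∫ s in (0 : ℝ)..t, (p s).im : ℝ) : ℂ)) t := by
    intro t ht
    have hpt : IntervalIntegrable p volume 0 t := hp.mono_set (uIcc_subset_uIcc_left ht)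
    have hret : IntervalIntegrable (fun t => ((p t).re : ℂ)) volume 0 t :=
      ⟨hpt.1.re.ofReal, hpt.2.re.ofReal⟩
    have himt : IntervalIntegrable (fun t => ((p t).im : ℂ)) volume 0 t :=
      ⟨hpt.1.im.ofReal, hpt.2.im.ofReal⟩
    simp only [Pi.add_apply, ← intervalIntegral.integral_ofReal, smul_eq_mul,
      ← intervalIntegral.integral_const_mul]
    rw [← intervalIntegral.integral_add hret (himt.const_mul _)]
    congr 1
    ext s
    rw [mul_comm, Complex.re_add_im]
  rw [absolutelyContinuousOnInterval_iff] at h3 ⊢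
  intro ε hε
  obtain ⟨δ, hδ, H⟩ := h3 ε hε
  refine ⟨δ, hδ, fun E hE hE' => ?_⟩
  have := H E hE hE'
  refine lt_of_eq_of_lt (Finset.sum_congr rfl fun i hi => ?_) this
  rw [heq _ (hE.1 i hi).1, heq _ (hE.1 i hi).2]

namespace IsPrimitiveOn

variable {h : ℝ} {p q a b : ℝ → ℂ}

lemma continuousOn (ha : IsPrimitiveOn h p a) (hh : 0 ≤ h) : ContinuousOn a (Icc 0 h) := by
  have := (absolutelyContinuousOnInterval_integral_complex ha.intervalIntegrable).continuousOn
  rw [uIcc_of_le hh] at this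
  exact (continuousOn_const.add this).congr ha.eq

/-- The product rule. -/
lemma mul (ha : IsPrimitiveOn h p a) (hb : IsPrimitiveOn h q b) (hh : 0 ≤ h) :
    IsPrimitiveOn h (fun t => p t * b t + a t * q t) (fun t => a t * b t) := by
  have hac := ha.continuousOn hh
  have hbc := hb.continuousOn hh
  rw [← uIcc_of_le hh] at hac hbc
  have hint : IntervalIntegrable (fun t => p t * b t + a t * q t) volume 0 h :=
    (ha.intervalIntegrable.mul_continuousOn hbc).add
      (hb.intervalIntegrable.continuousOn_mul hac)
  refine ⟨hint, ?_⟩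
  have hA : AbsolutelyContinuousOnInterval (fun t => a 0 + ∫ s in (0 : ℝ)..t, p s) 0 h :=
    ((LipschitzWith.const (a 0)).lipschitzOnWith.absolutelyContinuousOnInterval).fun_add
      (absolutelyContinuousOnInterval_integral_complex ha.intervalIntegrable)
  have hB : AbsolutelyContinuousOnInterval (fun t => b 0 + ∫ s in (0 : ℝ)..t, q s) 0 h :=
    ((LipschitzWith.const (b 0)).lipschitzOnWith.absolutelyContinuousOnInterval).fun_add
      (absolutelyContinuousOnInterval_integral_complex hb.intervalIntegrable)
  -- The product minus the integral of its expected derivative is absolutely continuous with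
  -- derivative zero almost everywhere, hence constant. The integral formulas stand in for `a` and
  -- `b`, which are controlled only on `[0, h]`.
  have hG := (hA.fun_smul hB).fun_sub (absolutelyContinuousOnInterval_integral_complex hint)
  obtain ⟨C, hC⟩ := hG.const_of_ae_hasDerivAt_zero (by
    filter_upwards [ha.intervalIntegrable.ae_hasDerivAt_integral,
      hb.intervalIntegrable.ae_hasDerivAt_integral, hint.ae_hasDerivAt_integral]
      with x h1 h2 h3 hx
    have k1 := (h1 hx 0 (by simp)).const_add (a 0)
    have k2 := (h2 hx 0 (by simp)).const_add (b 0)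
    have k3 := h3 hx 0 (by simp)
    have := (k1.mul k2).sub k3
    rw [uIcc_of_le hh] at hx
    rw [← ha.eq x hx, ← hb.eq x hx, sub_self] at this
    exact this)
  intro t ht
  have h0 := hC 0 (by simp)
  have h1 := hC t (by rwa [uIcc_of_le hh])
  simp only [intervalIntegral.integral_same, add_zero, sub_zero, smul_eq_mul] at h0 h1
  rw [← ha.eq t ht, ← hb.eq t ht, ← h0] at h1
  linear_combination h1

lemma conj (ha : IsPrimitiveOn h p a) :
    IsPrimitiveOn h (fun t => star (p t)) (fun t => star (a t)) := by
  refine ⟨?_, fun t ht => ?_⟩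
  · exact ⟨(LinearIsometryEquiv.integrable_comp_iff Complex.conjLIE).2 ha.intervalIntegrable.1,
      (LinearIsometryEquiv.integrable_comp_iff Complex.conjLIE).2 ha.intervalIntegrable.2⟩
  · rw [ha.eq t ht, star_add]
    congr 1
    simp only [intervalIntegral.intervalIntegral_eq_integral_uIoc, if_pos ht.1, one_smul]
    exact (integral_conj (𝕜 := ℂ)).symm

lemma of_hasDerivAt (ha : ∀ t, HasDerivAt a (p t) t) (hp : Continuous p) :
    IsPrimitiveOn h p a :=
  ⟨hp.intervalIntegrable _ _, fun t _ => by
    rw [intervalIntegral.integral_eq_sub_of_hasDerivAt (fun x _ => ha x)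
      (hp.intervalIntegrable _ _)]
    ring⟩

/-- Integration by parts. -/
lemma integral_mul (ha : IsPrimitiveOn h p a) (hb : IsPrimitiveOn h q b) (hh : 0 ≤ h) :
    ∫ t in Ioo 0 h, (p t * b t + a t * q t) = a h * b h - a 0 * b 0 := by
  have := (ha.mul hb hh).eq h ⟨hh, le_rfl⟩
  rw [← integral_Ioc_eq_integral_Ioo, ← intervalIntegral.integral_of_le hh]
  linear_combination -this

/-- The trace inequality on an interval. -/
lemma norm_sq_le (ha : IsPrimitiveOn h p a) (hh : 0 < h)
    (hp : MemLp p 2 (volume.restrict (Ioo 0 h))) {l : ℝ} (hl : 0 < l) :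
    ‖a h‖ ^ 2 ≤ (1 / h + l) * (∫ t in Ioo 0 h, ‖a t‖ ^ 2)
      + (1 / l) * ∫ t in Ioo 0 h, ‖p t‖ ^ 2 := by
  -- The weight `t` vanishes at 0 and equals `h` at the upper end, so integrating the derivative of
  -- `t |a|²` isolates `h |a h|²`.
  have hid : IsPrimitiveOn h (fun _ => 1) (fun t => (t : ℂ)) :=
    of_hasDerivAt (fun t => Complex.ofRealCLM.hasDerivAt) continuous_const
  have hta := hid.mul ha hh.le
  have H := hta.integral_mul ha.conj hh.le
  have hac : MemLp a 2 (volume.restrict (Ioo 0 h)) := by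
    have h1 := ha.continuousOn hh.le
    have : MemLp a ⊤ (volume.restrict (Ioo 0 h)) := by
      obtain ⟨C, hC⟩ := isCompact_Icc.exists_bound_of_continuousOn h1
      refine memLp_top_of_bound ((h1.mono Ioo_subset_Icc_self).aestronglyMeasurable
        measurableSet_Ioo) C ?_
      filter_upwards [ae_restrict_mem measurableSet_Ioo] with t ht
      exact hC t (Ioo_subset_Icc_self ht)
    exact this.mono_exponent le_top
  have i1 : Integrable (fun t => ‖a t‖ ^ 2) (volume.restrict (Ioo 0 h)) :=
    hac.integrable_norm_pow (by norm_num)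
  have i2 : Integrable (fun t => ‖p t‖ ^ 2) (volume.restrict (Ioo 0 h)) :=
    hp.integrable_norm_pow (by norm_num)
  have hle : h * ‖a h‖ ^ 2 ≤ ∫ t in Ioo 0 h, ((1 + h * l) * ‖a t‖ ^ 2 + h / l * ‖p t‖ ^ 2) := by
    have e1 : h * ‖a h‖ ^ 2 = ‖(h * a h) * star (a h) - ((0 : ℝ) * a 0) * star (a 0)‖ := by
      simp [abs_of_pos hh]
      ring
    rw [e1, ← H]
    refine norm_integral_le_of_norm_le ((i1.const_mul _).add (i2.const_mul _)) ?_
    filter_upwards [ae_restrict_mem measurableSet_Ioo] with t ht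
    have ht' : ‖(t : ℂ)‖ ≤ h := by
      rw [Complex.norm_real, Real.norm_of_nonneg ht.1.le]; exact ht.2.le
    have n0 := norm_nonneg (a t)
    have n1 := norm_nonneg (p t)
    calc _ ≤ (‖a t‖ + ‖(t : ℂ)‖ * ‖p t‖) * ‖a t‖ + ‖(t : ℂ)‖ * ‖a t‖ * ‖p t‖ := by
            refine (norm_add_le _ _).trans ?_
            simp only [norm_mul, norm_star]
            gcongr
            refine (norm_add_le _ _).trans ?_
            simp
      _ ≤ (‖a t‖ + h * ‖p t‖) * ‖a t‖ + h * ‖a t‖ * ‖p t‖ := by gcongr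
      _ = ‖a t‖ ^ 2 + h * (2 * ‖a t‖ * ‖p t‖) := by ring
      _ ≤ ‖a t‖ ^ 2 + h * (l * ‖a t‖ ^ 2 + ‖p t‖ ^ 2 / l) := by
            gcongr
            have : l * ‖a t‖ ^ 2 + ‖p t‖ ^ 2 / l - 2 * ‖a t‖ * ‖p t‖
              = (l * ‖a t‖ - ‖p t‖) ^ 2 / l := by field_simp; ring
            have : 0 ≤ (l * ‖a t‖ - ‖p t‖) ^ 2 / l := by positivity
            linarith
      _ = _ := by ring
  rw [integral_add (i1.const_mul _) (i2.const_mul _), integral_const_mul, integral_const_mul] at hle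
  rw [← mul_le_mul_iff_right₀ hh]
  refine hle.trans (le_of_eq ?_)
  field_simp

end IsPrimitiveOn

/-- A function on `(0, h)` with vanishing weak derivative is constant. -/
lemma exists_ae_eq_const_of_integral_deriv_smul_eq_zero {h : ℝ} (hh : 0 < h) {d : ℝ → ℂ}
    (hd : IntegrableOn d (Ioo 0 h))
    (H : ∀ χ : ℝ → ℝ, ContDiff ℝ ∞ χ → HasCompactSupport χ → tsupport χ ⊆ Ioo 0 h →
      ∫ t in Ioo 0 h, deriv χ t • d t = 0) :
    ∃ C : ℂ, ∀ᵐ t ∂volume.restrict (Ioo 0 h), d t = C := by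
  -- A bump of integral one supported in `[h/4, 3h/4]`; the constant sought is the average of `d`
  -- against it.
  let b : ContDiffBump (h / 2) := ⟨h / 8, h / 4, by positivity, by linarith⟩
  set ψ : ℝ → ℝ := b.normed volume with hψ
  have hψs : tsupport ψ ⊆ Ioo 0 h := by
    rw [hψ, b.tsupport_normed_eq, Real.closedBall_eq_Icc]
    intro t ht
    have h1 : h / 2 - h / 4 ≤ t := ht.1
    have h2 : t ≤ h / 2 + h / 4 := ht.2
    constructor <;> linarith
  have hψc : HasCompactSupport ψ := b.hasCompactSupport_normed
  have hψi : ∫ t, ψ t = 1 := b.integral_normed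
  have hψd : ContDiff ℝ ∞ ψ := b.contDiff_normed
  have integ : ∀ χ : ℝ → ℝ, ContDiff ℝ ∞ χ → HasCompactSupport χ →
      IntegrableOn (fun t => χ t • d t) (Ioo 0 h) := by
    intro χ h1 h2
    obtain ⟨C, hC⟩ := h2.exists_bound_of_continuous h1.continuous
    exact hd.bdd_smul C h1.continuous.aestronglyMeasurable (Filter.Eventually.of_forall hC)
  have hioo : IsOpen (Ioo 0 h) := isOpen_Ioo
  refine ⟨∫ t in Ioo 0 h, ψ t • d t, ?_⟩
  set C := ∫ t in Ioo 0 h, ψ t • d t with hC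
  have := hioo.ae_eq_zero_of_integral_contDiff_smul_eq_zero (μ := volume.restrict (Ioo 0 h))
    (f := fun t => d t - C)
    ((hd.sub (integrable_const C)).integrableOn.locallyIntegrableOn) (by
      intro χ h1 h2 h3
      set c := ∫ t, χ t with hc
      -- Removing the mean of `χ` makes the test function the derivative of a compactly supported
      -- function, to which the hypothesis applies.
      set η : ℝ → ℝ := fun t => χ t - c * ψ t with hη
      have hηd : ContDiff ℝ ∞ η := h1.sub (contDiff_const.mul hψd)
      have hηi : ∫ t, η t = 0 := by
        rw [hη, integral_sub (h1.continuous.integrable_of_hasCompactSupport h2)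
          ((hψd.continuous.integrable_of_hasCompactSupport hψc).const_mul c), integral_const_mul,
          hψi, mul_one, sub_self]
      set K := tsupport χ ∪ tsupport ψ with hK
      have hKc : IsCompact K := IsCompact.union h2 hψc
      have hKs : K ⊆ Ioo 0 h := union_subset h3 hψs
      have hKn : K.Nonempty := by
        refine ⟨h / 2, Or.inr ?_⟩
        rw [hψ, b.tsupport_normed_eq]
        exact Metric.mem_closedBall_self (by positivity)
      have hl := hKs (hKc.sInf_mem hKn)
      have hr := hKs (hKc.sSup_mem hKn)
      have hηz : ∀ t, t ∉ K → η t = 0 := by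
        intro t ht
        rw [hK, mem_union, not_or] at ht
        simp [hη, image_eq_zero_of_notMem_tsupport ht.1, image_eq_zero_of_notMem_tsupport ht.2]
      have hηz1 : ∀ t, t < sInf K → η t = 0 := fun t ht =>
        hηz t fun h' => not_lt.2 (csInf_le hKc.bddBelow h') ht
      have hηz2 : ∀ t, sSup K < t → η t = 0 := fun t ht =>
        hηz t fun h' => not_lt.2 (le_csSup hKc.bddAbove h') ht
      set X : ℝ → ℝ := fun t => ∫ s in Iic t, η s with hX
      have hηint : Integrable η := (h1.continuous.integrable_of_hasCompactSupport h2).sub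
        ((hψd.continuous.integrable_of_hasCompactSupport hψc).const_mul c)
      have hXd : ∀ t, HasDerivAt X (η t) t := by
        intro t
        have e : X = fun t => (∫ s in Iic 0, η s) + ∫ s in (0 : ℝ)..t, η s := by
          ext t
          rw [intervalIntegral.integral_Iic_sub_Iic hηint.integrableOn hηint.integrableOn |>.symm]
          simp [hX]
        rw [e]
        exact (intervalIntegral.integral_hasDerivAt_right
          (hηd.continuous.intervalIntegrable _ _)
          (hηd.continuous.stronglyMeasurableAtFilter _ _) hηd.continuous.continuousAt).const_add _
      have hX' : deriv X = η := funext fun t => (hXd t).deriv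
      have hXs : ContDiff ℝ ∞ X := contDiff_infty_iff_deriv.2
        ⟨fun t => (hXd t).differentiableAt, hX' ▸ hηd⟩
      -- `X` vanishes to the left of `K` because `η` does, and to the right because the total
      -- integral of `η` is zero.
      have hXt : tsupport X ⊆ Icc (sInf K) (sSup K) := by
        refine closure_minimal (fun t ht => ?_) isClosed_Icc
        by_contra hcon
        refine ht ?_
        rw [mem_Icc, not_and_or, not_le, not_le] at hcon
        rcases hcon with hcon | hcon
        · refine setIntegral_eq_zero_of_forall_eq_zero fun s hs => hηz1 s (lt_of_le_of_lt hs hcon)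
        · change ∫ s in Iic t, η s = 0
          rw [← hηi]
          refine setIntegral_eq_integral_of_forall_compl_eq_zero fun s hs => hηz2 s ?_
          exact hcon.trans (not_le.1 hs)
      have := H X hXs (HasCompactSupport.of_support_subset_isCompact isCompact_Icc
        ((subset_tsupport X).trans hXt)) (hXt.trans (Icc_subset_Ioo hl.1 hr.2))
      rw [hX'] at this
      have e2 : ∫ t in Ioo 0 h, η t • d t =
          (∫ t in Ioo 0 h, χ t • d t) - c • C := by
        rw [hC, ← integral_smul, ← integral_sub (integ χ h1 h2) (g := fun t => c • ψ t • d t)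
          ((integ ψ hψd hψc).smul c)]
        congr 1
        ext t
        simp only [hη, sub_smul, smul_smul]
      rw [e2] at this
      have e3 : ∫ t in Ioo 0 h, χ t = c :=
        setIntegral_eq_integral_of_forall_compl_eq_zero fun s hs =>
          image_eq_zero_of_notMem_tsupport fun h' => hs (h3 h')
      simp only [smul_sub]
      rw [integral_sub (integ χ h1 h2)
        (((h1.continuous.integrable_of_hasCompactSupport h2).smul_const C).integrableOn),
        integral_smul_const, e3]
      exact this)
  filter_upwards [this, ae_restrict_mem measurableSet_Ioo] with t h1 h2
  exact sub_eq_zero.1 (h1 h2)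

/-- A function on `(0, h)` with integrable weak derivative `p` is a.e. a primitive of `p`. -/
lemma exists_isPrimitiveOn_of_weakDeriv {h : ℝ} (hh : 0 < h) {a p : ℝ → ℂ}
    (ha : IntegrableOn a (Ioo 0 h)) (hp : IntegrableOn p (Ioo 0 h))
    (H : ∀ χ : ℝ → ℝ, ContDiff ℝ ∞ χ → HasCompactSupport χ → tsupport χ ⊆ Ioo 0 h →
      ∫ t in Ioo 0 h, deriv χ t • a t = -∫ t in Ioo 0 h, χ t • p t) :
    ∃ b, IsPrimitiveOn h p b ∧ ∀ᵐ t ∂volume.restrict (Ioo 0 h), a t = b t := by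
  have hpi : IntervalIntegrable p volume 0 h := by
    rwa [intervalIntegrable_iff_integrableOn_Ioo_of_le hh.le]
  have hP : IsPrimitiveOn h p (fun t => ∫ s in (0 : ℝ)..t, p s) :=
    ⟨hpi, fun t _ => by simp⟩
  have hPint : IntegrableOn (fun t => ∫ s in (0 : ℝ)..t, p s) (Ioo 0 h) :=
    ((hP.continuousOn hh.le).integrableOn_compact isCompact_Icc).mono_set Ioo_subset_Icc_self
  obtain ⟨C, hC⟩ := exists_ae_eq_const_of_integral_deriv_smul_eq_zero hh
    (d := fun t => a t - ∫ s in (0 : ℝ)..t, p s) (ha.sub hPint) (by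
      intro χ h1 h2 h3
      have h1' : Continuous (deriv χ) := (contDiff_infty_iff_deriv.1 h1).2.continuous
      obtain ⟨M, hM⟩ := h2.deriv.exists_bound_of_continuous h1'
      obtain ⟨M', hM'⟩ := h2.exists_bound_of_continuous h1.continuous
      have hχ : IsPrimitiveOn h (fun t => ((deriv χ t : ℝ) : ℂ)) (fun t => (χ t : ℂ)) :=
        .of_hasDerivAt (fun t => ((h1.differentiable (by simp)) t).hasDerivAt.ofReal_comp)
          (Complex.continuous_ofReal.comp h1')
      have := hχ.integral_mul hP hh.le
      rw [image_eq_zero_of_notMem_tsupport fun h' => lt_irrefl _ (h3 h').1,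
        image_eq_zero_of_notMem_tsupport fun h' => lt_irrefl _ (h3 h').2] at this
      have j1 : IntegrableOn (fun t => deriv χ t • a t) (Ioo 0 h) :=
        ha.bdd_smul M h1'.aestronglyMeasurable (Filter.Eventually.of_forall hM)
      have j2 : IntegrableOn (fun t => deriv χ t • ∫ s in (0 : ℝ)..t, p s) (Ioo 0 h) :=
        hPint.bdd_smul M h1'.aestronglyMeasurable (Filter.Eventually.of_forall hM)
      have j3 : IntegrableOn (fun t => χ t • p t) (Ioo 0 h) :=
        hp.bdd_smul M' h1.continuous.aestronglyMeasurable (Filter.Eventually.of_forall hM')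
      simp only [smul_sub]
      rw [integral_sub j1 j2, H χ h1 h2 h3]
      have j4 := integral_add j2 j3
      simp only [Complex.real_smul] at j4 ⊢
      rw [j4] at this
      simp only [Complex.ofReal_zero, zero_mul, sub_zero] at this
      linear_combination -this)
  refine ⟨fun t => C + ∫ s in (0 : ℝ)..t, p s, ⟨hpi, fun t _ => by simp⟩, ?_⟩
  filter_upwards [hC] with t ht
  linear_combination ht

/-! ### Slices of `Ω` -/

/-- The decomposition of `ℝ³` into horizontal planes. -/
def slabEquiv : ℝ × ℝ × ℝ ≃ᵐ E3 :=
  ((MeasurableEquiv.piFinSuccAbove (fun _ : Fin 3 => ℝ) 2).trans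
    ((MeasurableEquiv.refl ℝ).prodCongr MeasurableEquiv.finTwoArrow)).symm.trans
    (MeasurableEquiv.toLp 2 (Fin 3 → ℝ))

lemma slabEquiv_apply (p : ℝ × ℝ × ℝ) : slabEquiv p = atHeight p.1 p.2 := by
  ext i
  fin_cases i <;> rfl

lemma measurePreserving_slabEquiv : MeasurePreserving slabEquiv := by
  refine (PiLp.volume_preserving_toLp (Fin 3)).comp (MeasurePreserving.symm _ ?_)
  exact ((MeasurePreserving.id volume).prod (volume_preserving_finTwoArrow ℝ)).comp
    (volume_preserving_piFinSuccAbove (fun _ : Fin 3 => ℝ) 2)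

lemma slabEquiv_preimage_Omega (h : ℝ) : slabEquiv ⁻¹' Omega h = Ioo 0 h ×ˢ cell := by
  ext p
  simp only [mem_preimage, slabEquiv_apply, Omega, atHeight, mem_ofPred_eq, mem_prod, cell]
  simp
  tauto

/-- Lebesgue measure on the periodicity cell. -/
abbrev cellMeasure : Measure (ℝ × ℝ) := volume.restrict cell

lemma measurePreserving_slabEquiv_Omega (h : ℝ) :
    MeasurePreserving slabEquiv ((volume.restrict (Ioo 0 h)).prod cellMeasure)
      (volume.restrict (Omega h)) := by
  have := measurePreserving_slabEquiv.restrict_preimage_emb slabEquiv.measurableEmbedding (Omega h)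
  rwa [slabEquiv_preimage_Omega, Measure.volume_eq_prod ℝ (ℝ × ℝ), ← Measure.prod_restrict] at this

lemma isOpen_Omega (h : ℝ) : IsOpen (Omega h) := by
  have : Omega h = (fun x : E3 => x 0) ⁻¹' Ioo 0 (2 * Real.pi) ∩
      ((fun x : E3 => x 1) ⁻¹' Ioo 0 (2 * Real.pi) ∩ (fun x : E3 => x 2) ⁻¹' Ioo 0 h) := rfl
  rw [this]
  exact (isOpen_Ioo.preimage (by fun_prop)).inter
    ((isOpen_Ioo.preimage (by fun_prop)).inter (isOpen_Ioo.preimage (by fun_prop)))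

instance : IsFiniteMeasure cellMeasure :=
  ⟨by
    rw [Measure.restrict_apply_univ, cell, Measure.volume_eq_prod, Measure.prod_prod]
    simp [ENNReal.mul_lt_top]⟩

instance (h : ℝ) : IsFiniteMeasure (volume.restrict (Omega h)) := by
  rw [← (measurePreserving_slabEquiv_Omega h).map_eq]
  infer_instance

section Slices

variable {E : Type*} [NormedAddCommGroup E] {h : ℝ}

lemma integrable_slab_iff {f : E3 → E} :
    Integrable (fun p : ℝ × ℝ × ℝ => f (atHeight p.1 p.2))
      ((volume.restrict (Ioo 0 h)).prod cellMeasure) ↔ IntegrableOn f (Omega h) := by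
  have := (measurePreserving_slabEquiv_Omega h).integrable_comp_emb
    slabEquiv.measurableEmbedding (g := f)
  rw [← IntegrableOn] at this
  rw [← this]
  simp only [Function.comp_def, slabEquiv_apply]

lemma aestronglyMeasurable_slab {f : E3 → E}
    (hf : AEStronglyMeasurable f (volume.restrict (Omega h))) :
    AEStronglyMeasurable (fun p : ℝ × ℝ × ℝ => f (atHeight p.1 p.2))
      ((volume.restrict (Ioo 0 h)).prod cellMeasure) := by
  have := hf.comp_measurePreserving (measurePreserving_slabEquiv_Omega h)
  simpa only [Function.comp_def, slabEquiv_apply] using this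

lemma integral_Omega_eq [NormedSpace ℝ E] (f : E3 → E) :
    ∫ x in Omega h, f x = ∫ p, f (atHeight p.1 p.2)
      ∂((volume.restrict (Ioo 0 h)).prod cellMeasure) := by
  rw [← (measurePreserving_slabEquiv_Omega h).integral_comp slabEquiv.measurableEmbedding]
  simp only [slabEquiv_apply]

lemma lintegral_Omega_eq {f : E3 → ENNReal} (hf : AEMeasurable f (volume.restrict (Omega h))) :
    ∫⁻ x in Omega h, f x = ∫⁻ t in Ioo 0 h, ∫⁻ y in cell, f (atHeight t y) := by
  rw [← (measurePreserving_slabEquiv_Omega h).lintegral_comp_emb slabEquiv.measurableEmbedding]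
  rw [lintegral_prod]
  · simp only [slabEquiv_apply]
  · exact hf.comp_quasiMeasurePreserving (measurePreserving_slabEquiv_Omega h).quasiMeasurePreserving

end Slices

/-! ### Parseval's identity -/

/-- The Fourier coefficients of a function on `(0, 2π)`. -/
def fourierCoefOne (f : ℝ → ℂ) (n : ℤ) : ℂ :=
  (1 / (2 * (Real.pi : ℂ))) *
    ∫ s in Ioo 0 (2 * Real.pi), f s * Complex.exp (-(Complex.I * ((n : ℂ) * (s : ℂ))))

lemma fourierCoefOne_eq (f : ℝ → ℂ) (n : ℤ) :
    fourierCoefOne f n = fourierCoeffOn Real.two_pi_pos f n := by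
  rw [fourierCoeffOn_eq_integral, intervalIntegral.integral_of_le Real.two_pi_pos.le,
    integral_Ioc_eq_integral_Ioo, fourierCoefOne, Complex.real_smul]
  congr 1
  · push_cast; ring
  · refine integral_congr_ae (Filter.Eventually.of_forall fun s => ?_)
    simp only [fourier_coe_apply, smul_eq_mul]
    rw [mul_comm]
    congr 2
    have : (Real.pi : ℂ) ≠ 0 := by exact_mod_cast Real.pi_ne_zero
    push_cast
    field_simp
    ring

/-- Stated with extended nonnegative values, so that sums and integrals can later be exchanged by
Tonelli before any summability is known. -/
lemma tsum_enorm_sq_fourierCoefOne {f : ℝ → ℂ}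
    (hf : MemLp f 2 (volume.restrict (Ioo 0 (2 * Real.pi)))) :
    ∑' n, ‖fourierCoefOne f n‖ₑ ^ 2 =
      ENNReal.ofReal (1 / (2 * Real.pi)) * ∫⁻ s in Ioo 0 (2 * Real.pi), ‖f s‖ₑ ^ 2 := by
  have hf' : MemLp f 2 (volume.restrict (Ioc 0 (2 * Real.pi))) := by
    rwa [← restrict_Ioo_eq_restrict_Ioc]
  have H := hasSum_sq_fourierCoeffOn Real.two_pi_pos hf'
  have hi : Integrable (fun s => ‖f s‖ ^ 2) (volume.restrict (Ioo 0 (2 * Real.pi))) :=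
    hf.integrable_norm_pow (by norm_num)
  have e : ∀ z : ℂ, ‖z‖ₑ ^ 2 = ENNReal.ofReal (‖z‖ ^ 2) := fun z => by
    rw [ENNReal.ofReal_pow (norm_nonneg _), ofReal_norm]
  simp only [e]
  rw [← ofReal_integral_eq_lintegral_ofReal hi (Filter.Eventually.of_forall fun _ => by positivity),
    ← ENNReal.ofReal_mul (by positivity),
    ← ENNReal.ofReal_tsum_of_nonneg (fun _ => by positivity)]
  · simp only [fourierCoefOne_eq]
    rw [H.tsum_eq, intervalIntegral.integral_of_le Real.two_pi_pos.le,
      integral_Ioc_eq_integral_Ioo]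
    simp
  · simpa only [fourierCoefOne_eq] using H.summable

lemma cellMeasure_eq_prod : cellMeasure =
    (volume.restrict (Ioo 0 (2 * Real.pi))).prod (volume.restrict (Ioo 0 (2 * Real.pi))) := by
  rw [cellMeasure, cell, Measure.volume_eq_prod, Measure.prod_restrict]

lemma memLp_two_of_lintegral {X : Type*} [MeasurableSpace X] {μ : Measure X} {f : X → ℂ}
    (hf : AEStronglyMeasurable f μ) (h2 : ∫⁻ x, ‖f x‖ₑ ^ 2 ∂μ < ⊤) : MemLp f 2 μ := by
  refine ⟨hf, ?_⟩
  rw [eLpNorm_lt_top_iff_lintegral_rpow_enorm_lt_top (by norm_num) (by norm_num)]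
  simpa using h2

lemma lintegral_enorm_sq_lt_top {X : Type*} [MeasurableSpace X] {μ : Measure X} {f : X → ℂ}
    (hf : MemLp f 2 μ) : ∫⁻ x, ‖f x‖ₑ ^ 2 ∂μ < ⊤ := by
  have := (eLpNorm_lt_top_iff_lintegral_rpow_enorm_lt_top (by norm_num) (by norm_num)).1 hf.2
  simpa using this

/-- The character `exp(-i n·y)`. -/
def character (n : ℤ × ℤ) (y : ℝ × ℝ) : ℂ :=
  Complex.exp (-(Complex.I * ((n.1 : ℂ) * (y.1 : ℂ) + (n.2 : ℂ) * (y.2 : ℂ))))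

lemma continuous_character (n : ℤ × ℤ) : Continuous (character n) := by
  unfold character; fun_prop

lemma norm_character (n : ℤ × ℤ) (y : ℝ × ℝ) : ‖character n y‖ = 1 := by
  rw [character, Complex.norm_exp]
  simp

lemma fourierCoef_eq (g : ℝ × ℝ → ℂ) (n : ℤ × ℤ) :
    fourierCoef g n = (1 / (4 * (Real.pi : ℂ) ^ 2)) * ∫ y in cell, g y * character n y := rfl

/-- **Parseval's identity** on the periodicity cell. -/
lemma tsum_enorm_sq_fourierCoef {g : ℝ × ℝ → ℂ} (hg : MemLp g 2 cellMeasure) :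
    ∑' n, ‖fourierCoef g n‖ₑ ^ 2 =
      ENNReal.ofReal (1 / (4 * Real.pi ^ 2)) * ∫⁻ y in cell, ‖g y‖ₑ ^ 2 := by
  set I := volume.restrict (Ioo 0 (2 * Real.pi)) with hI
  -- The one-dimensional identity is applied twice: in the first variable for almost every fixed
  -- `s`, then in `s` to each partial coefficient `c m`, whose own coefficients are the
  -- two-dimensional ones.
  set c : ℤ → ℝ → ℂ := fun m s => fourierCoefOne (fun r => g (r, s)) m with hc
  have hg1 : Integrable g cellMeasure := hg.integrable (by norm_num)
  rw [cellMeasure_eq_prod] at hg hg1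
  have hfin := lintegral_enorm_sq_lt_top hg
  have hmeas : AEMeasurable (fun y => ‖g y‖ₑ ^ 2) (I.prod I) := hg.1.enorm.pow_const 2
  have hlin : ∫⁻ y, ‖g y‖ₑ ^ 2 ∂(I.prod I) = ∫⁻ s, ∫⁻ r, ‖g (r, s)‖ₑ ^ 2 ∂I ∂I :=
    lintegral_prod_symm _ hmeas
  have hslice : ∀ᵐ s ∂I, MemLp (fun r => g (r, s)) 2 I := by
    have h1 : ∀ᵐ s ∂I, AEStronglyMeasurable (fun r => g (r, s)) I :=
      hg.1.prod_swap.prodMk_left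
    have h2 : ∀ᵐ s ∂I, ∫⁻ r, ‖g (r, s)‖ₑ ^ 2 ∂I < ⊤ := by
      rw [hlin] at hfin
      exact ae_lt_top' hmeas.lintegral_prod_left' hfin.ne
    filter_upwards [h1, h2] with s h1 h2 using memLp_two_of_lintegral h1 h2
  have hpars : ∀ᵐ s ∂I, ∑' m, ‖c m s‖ₑ ^ 2 =
      ENNReal.ofReal (1 / (2 * Real.pi)) * ∫⁻ r, ‖g (r, s)‖ₑ ^ 2 ∂I := by
    filter_upwards [hslice] with s hs using tsum_enorm_sq_fourierCoefOne hs
  have hint : ∀ n : ℤ × ℤ, Integrable (fun y => g y * character n y) (I.prod I) := fun n =>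
    hg1.mul_bdd (c := 1) (continuous_character n).aestronglyMeasurable
      (Filter.Eventually.of_forall fun y => (norm_character n y).le)
  have hcm : ∀ m, AEStronglyMeasurable (c m) I := by
    intro m
    refine AEStronglyMeasurable.const_mul ?_ _
    have := (hint (m, 0)).1.prod_swap.integral_prod_right'
    simpa [character] using this
  have hsum : ∑' m, ∫⁻ s, ‖c m s‖ₑ ^ 2 ∂I =
      ENNReal.ofReal (1 / (2 * Real.pi)) * ∫⁻ y, ‖g y‖ₑ ^ 2 ∂(I.prod I) := by
    rw [← lintegral_tsum fun m => (hcm m).enorm.pow_const 2, lintegral_congr_ae hpars,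
      lintegral_const_mul' _ _ ENNReal.ofReal_ne_top, hlin]
  have hcL : ∀ m, MemLp (c m) 2 I := by
    intro m
    refine memLp_two_of_lintegral (hcm m) (lt_of_le_of_lt
      (ENNReal.le_tsum (f := fun m => ∫⁻ s, ‖c m s‖ₑ ^ 2 ∂I) m) ?_)
    rw [hsum]
    exact ENNReal.mul_lt_top ENNReal.ofReal_lt_top hfin
  have hcoef : ∀ m n, fourierCoef g (m, n) = fourierCoefOne (c m) n := by
    intro m n
    rw [fourierCoef_eq, ← cellMeasure, cellMeasure_eq_prod, ← hI, integral_prod_symm _ (hint _)]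
    simp only [fourierCoefOne, hc, ← hI]
    rw [← integral_const_mul, ← integral_const_mul]
    refine integral_congr_ae (Filter.Eventually.of_forall fun s => ?_)
    simp only
    rw [mul_comm _ (Complex.exp _), ← mul_assoc, ← mul_assoc, ← integral_const_mul,
      ← integral_const_mul]
    refine integral_congr_ae (Filter.Eventually.of_forall fun r => ?_)
    simp only [character, mul_add, neg_add, Complex.exp_add]
    ring
  rw [ENNReal.tsum_prod']
  simp only [hcoef]
  simp only [fun m => tsum_enorm_sq_fourierCoefOne (hcL m)]
  rw [ENNReal.tsum_mul_left, ← hI, hsum, ← mul_assoc, ← ENNReal.ofReal_mul (by positivity),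
    ← cellMeasure, cellMeasure_eq_prod]
  congr 2
  ring

/-! ### Fourier coefficients on horizontal planes -/

/-- The `n`-th Fourier coefficient of `f` on the plane at height `t`. -/
def coefAt (f : E3 → ℂ) (n : ℤ × ℤ) (t : ℝ) : ℂ := fourierCoef (fun y => f (atHeight t y)) n

section CoefAt

variable {h : ℝ} {f g : E3 → ℂ}

lemma integrable_slab_mul_character (hf : IntegrableOn f (Omega h)) (n : ℤ × ℤ) :
    Integrable (fun p : ℝ × ℝ × ℝ => f (atHeight p.1 p.2) * character n p.2)
      ((volume.restrict (Ioo 0 h)).prod cellMeasure) :=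
  (integrable_slab_iff.2 hf).mul_bdd (c := 1)
    ((continuous_character n).comp continuous_snd).aestronglyMeasurable
    (Filter.Eventually.of_forall fun p => (norm_character n p.2).le)

lemma integrableOn_coefAt (hf : IntegrableOn f (Omega h)) (n : ℤ × ℤ) :
    IntegrableOn (coefAt f n) (Ioo 0 h) :=
  ((integrable_slab_mul_character hf n).integral_prod_left).const_mul _

/-- Additivity holds only for almost every height, since an integrable function on `Ω` may have
non-integrable slices on a null set of heights, where the Bochner integral is zero by convention. -/
lemma coefAt_add_ae (hf : IntegrableOn f (Omega h)) (hg : IntegrableOn g (Omega h)) (n : ℤ × ℤ) :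
    ∀ᵐ t ∂volume.restrict (Ioo 0 h),
      coefAt (fun x => f x + g x) n t = coefAt f n t + coefAt g n t := by
  filter_upwards [(integrable_slab_mul_character hf n).prod_right_ae,
    (integrable_slab_mul_character hg n).prod_right_ae] with t h1 h2
  simp only [coefAt, fourierCoef_eq, add_mul]
  rw [integral_add h1 h2, mul_add]

lemma coefAt_const_mul (c : ℂ) (f : E3 → ℂ) (n : ℤ × ℤ) (t : ℝ) :
    coefAt (fun x => c * f x) n t = c * coefAt f n t := by
  simp only [coefAt, fourierCoef_eq, mul_assoc]
  rw [integral_const_mul]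
  ring

lemma coefAt_sub_ae (hf : IntegrableOn f (Omega h)) (hg : IntegrableOn g (Omega h)) (n : ℤ × ℤ) :
    ∀ᵐ t ∂volume.restrict (Ioo 0 h),
      coefAt (fun x => f x - g x) n t = coefAt f n t - coefAt g n t := by
  filter_upwards [coefAt_add_ae hf (hg.const_mul (-1)) n] with t ht
  rw [coefAt_const_mul] at ht
  simpa [sub_eq_add_neg] using ht

/-- Fubini's theorem for the Fourier coefficients on horizontal planes. -/
lemma integral_mul_character (hf : IntegrableOn f (Omega h)) (n : ℤ × ℤ) {χ : ℝ → ℂ}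
    (hχ : Continuous χ) {M : ℝ} (hM : ∀ t, ‖χ t‖ ≤ M) :
    ∫ t in Ioo 0 h, χ t * coefAt f n t = (1 / (4 * (Real.pi : ℂ) ^ 2)) *
      ∫ x in Omega h, χ (x 2) * (f x * character n (x 0, x 1)) := by
  rw [integral_Omega_eq, ← integral_const_mul]
  have h1 : Integrable (fun p : ℝ × ℝ × ℝ => χ p.1 * (f (atHeight p.1 p.2) * character n p.2))
      ((volume.restrict (Ioo 0 h)).prod cellMeasure) :=
    (integrable_slab_mul_character hf n).bdd_mul (c := M)
      (hχ.comp continuous_fst).aestronglyMeasurable (Filter.Eventually.of_forall fun p => hM _)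
  rw [integral_prod _ (by simpa [atHeight] using h1.const_mul _)]
  refine integral_congr_ae (Filter.Eventually.of_forall fun t => ?_)
  simp only [coefAt, fourierCoef_eq]
  rw [← mul_assoc, mul_comm (χ t), mul_assoc, ← integral_const_mul, ← integral_const_mul]
  simp [atHeight]

/-- Parseval's identity holds on almost every horizontal plane; Tonelli integrates it over the
height. -/
lemma tsum_lintegral_enorm_sq_coefAt (hf : MemLp f 2 (volume.restrict (Omega h))) :
    ∑' n, ∫⁻ t in Ioo 0 h, ‖coefAt f n t‖ₑ ^ 2 =
      ENNReal.ofReal (1 / (4 * Real.pi ^ 2)) * ∫⁻ x in Omega h, ‖f x‖ₑ ^ 2 := by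
  have hi : IntegrableOn f (Omega h) := hf.integrable (by norm_num)
  have hm : AEMeasurable (fun x => ‖f x‖ₑ ^ 2) (volume.restrict (Omega h)) :=
    hf.1.enorm.pow_const 2
  have hfin := lintegral_enorm_sq_lt_top hf
  rw [← lintegral_tsum fun n => (integrableOn_coefAt hi n).1.enorm.pow_const 2]
  rw [lintegral_Omega_eq hm] at hfin ⊢
  rw [← lintegral_const_mul' _ _ ENNReal.ofReal_ne_top]
  refine lintegral_congr_ae ?_
  have h2 : ∀ᵐ t ∂volume.restrict (Ioo 0 h), ∫⁻ y in cell, ‖f (atHeight t y)‖ₑ ^ 2 < ⊤ :=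
    ae_lt_top' ((aestronglyMeasurable_slab hf.1).enorm.pow_const 2).lintegral_prod_right' hfin.ne
  filter_upwards [h2, (aestronglyMeasurable_slab hf.1).prodMk_left] with t h1 h2
  exact tsum_enorm_sq_fourierCoef (memLp_two_of_lintegral h2 h1)

lemma memLp_coefAt (hf : MemLp f 2 (volume.restrict (Omega h))) (n : ℤ × ℤ) :
    MemLp (coefAt f n) 2 (volume.restrict (Ioo 0 h)) := by
  refine memLp_two_of_lintegral (integrableOn_coefAt (hf.integrable (by norm_num)) n).1
    (lt_of_le_of_lt
      (ENNReal.le_tsum (f := fun n => ∫⁻ t in Ioo 0 h, ‖coefAt f n t‖ₑ ^ 2) n) ?_)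
  rw [tsum_lintegral_enorm_sq_coefAt hf]
  exact ENNReal.mul_lt_top ENNReal.ofReal_lt_top (lintegral_enorm_sq_lt_top hf)

/-- **Parseval's identity** on `Ω` with respect to the horizontal variables. -/
lemma hasSum_integral_norm_sq_coefAt (hf : MemLp f 2 (volume.restrict (Omega h))) :
    HasSum (fun n => 4 * Real.pi ^ 2 * ∫ t in Ioo 0 h, ‖coefAt f n t‖ ^ 2)
      (∫ x in Omega h, ‖f x‖ ^ 2) := by
  have e : ∀ {X : Type} [MeasurableSpace X] (μ : Measure X) (u : X → ℂ), MemLp u 2 μ →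
      ∫⁻ x, ‖u x‖ₑ ^ 2 ∂μ = ENNReal.ofReal (∫ x, ‖u x‖ ^ 2 ∂μ) := by
    intro X _ μ u hu
    rw [ofReal_integral_eq_lintegral_ofReal (hu.integrable_norm_pow (by norm_num))
      (Filter.Eventually.of_forall fun _ => by positivity)]
    refine lintegral_congr fun x => ?_
    rw [ENNReal.ofReal_pow (norm_nonneg _), ofReal_norm]
  have H := tsum_lintegral_enorm_sq_coefAt hf
  simp only [fun n => e _ _ (memLp_coefAt hf n)] at H
  rw [e _ _ hf, ← ENNReal.ofReal_mul (by positivity)] at H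
  have hs : HasSum (fun n => ∫ t in Ioo 0 h, ‖coefAt f n t‖ ^ 2)
      (1 / (4 * Real.pi ^ 2) * ∫ x in Omega h, ‖f x‖ ^ 2) := by
    have h0 : ∀ n, 0 ≤ ∫ t in Ioo 0 h, ‖coefAt f n t‖ ^ 2 := fun n =>
      integral_nonneg fun _ => by positivity
    have := ENNReal.hasSum_toReal (f := fun n => ENNReal.ofReal (∫ t in Ioo 0 h, ‖coefAt f n t‖ ^ 2))
      (by rw [H]; exact ENNReal.ofReal_ne_top)
    rw [← ENNReal.tsum_toReal_eq (fun n => ENNReal.ofReal_ne_top), H, ENNReal.toReal_ofReal (by positivity)] at this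
    simpa only [ENNReal.toReal_ofReal (h0 _)] using this
  have H := hs.mul_left (4 * Real.pi ^ 2)
  rwa [← mul_assoc, mul_one_div_cancel (by positivity), one_mul] at H

end CoefAt

/-! ### Uniqueness of weak derivatives and complex test functions -/

lemma integrable_smul_of_tsupport_subset {U : Set E3} (hU : MeasurableSet U) {f : E3 → ℂ}
    (hf : LocallyIntegrableOn f U) {φ : E3 → ℝ} (h1 : Continuous φ) (h2 : HasCompactSupport φ)
    (h3 : tsupport φ ⊆ U) : IntegrableOn (fun x => φ x • f x) U := by
  obtain ⟨C, hC⟩ := h2.exists_bound_of_continuous h1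
  have hK : IntegrableOn f (tsupport φ) := hf.integrableOn_compact_subset h3 h2
  have : IntegrableOn (fun x => φ x • f x) (tsupport φ) :=
    hK.bdd_smul C h1.aestronglyMeasurable (Filter.Eventually.of_forall hC)
  refine this.of_forall_sdiff_eq_zero hU fun x hx => ?_
  rw [image_eq_zero_of_notMem_tsupport hx.2, zero_smul]

/-- The fundamental lemma of the calculus of variations, applied to the difference. The two
functions need only agree almost everywhere because a periodic extension represents `f` only up to a
null set. -/
lemma IsWeakDeriv.ae_eq {U : Set E3} (hU : IsOpen U) {j : Fin 3} {f f' g g' : E3 → ℂ}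
    (hg : IsWeakDeriv U j f g) (hg' : IsWeakDeriv U j f' g')
    (hff' : ∀ᵐ x ∂volume.restrict U, f x = f' x) : ∀ᵐ x ∂volume.restrict U, g x = g' x := by
  have := hU.ae_eq_zero_of_integral_contDiff_smul_eq_zero (μ := volume)
    (f := fun x => U.indicator (fun x => g x - g' x) x) ?_ ?_
  · rw [ae_restrict_iff' hU.measurableSet]
    filter_upwards [this] with x hx hxU
    have := hx hxU
    rw [indicator_of_mem hxU] at this
    exact sub_eq_zero.1 this
  · have h1 : LocallyIntegrableOn (fun x => g x - g' x) U := hg.2.1.sub hg'.2.1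
    intro x hx
    obtain ⟨s, hs, h2⟩ := h1 x hx
    refine ⟨s, hs, ?_⟩
    exact h2.indicator hU.measurableSet
  · intro φ h1 h2 h3
    have e1 : ∫ x, φ x • U.indicator (fun x => g x - g' x) x =
        ∫ x in U, (φ x • g x - φ x • g' x) := by
      rw [← integral_indicator hU.measurableSet]
      congr 1
      ext x
      by_cases hx : x ∈ U <;> simp [hx, smul_sub]
    rw [e1, integral_sub (integrable_smul_of_tsupport_subset hU.measurableSet hg.2.1
        h1.continuous h2 h3) (integrable_smul_of_tsupport_subset hU.measurableSet hg'.2.1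
        h1.continuous h2 h3)]
    have a1 := hg.2.2 φ h1 h2 h3
    have a2 := hg'.2.2 φ h1 h2 h3
    have : ∫ x in U, fderiv ℝ φ x (unitVec j) • f x = ∫ x in U, fderiv ℝ φ x (unitVec j) • f' x := by
      refine integral_congr_ae ?_
      filter_upwards [hff'] with x hx
      rw [hx]
    rw [a1, a2] at this
    linear_combination -this

lemma MemH1.isWeakDeriv {U : Set E3} {f : E3 → ℂ} (hf : MemH1 U f) (j : Fin 3) :
    IsWeakDeriv U j f (weakDeriv U j f) := by
  obtain ⟨g, -, hg⟩ := hf.2 j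
  have h : ∃ g, IsWeakDeriv U j f g := ⟨g, hg⟩
  rw [weakDeriv, dif_pos h]
  exact h.choose_spec

/-- The derivative picked by `weakDeriv` need not be the square-integrable witness from `MemH1`;
uniqueness transfers the bound. -/
lemma MemH1.memLp_weakDeriv {U : Set E3} (hU : IsOpen U) {f : E3 → ℂ} (hf : MemH1 U f)
    (j : Fin 3) : MemLp (weakDeriv U j f) 2 (volume.restrict U) := by
  obtain ⟨g, hg1, hg⟩ := hf.2 j
  exact hg1.ae_eq (hg.ae_eq hU (hf.isWeakDeriv j) (Filter.Eventually.of_forall fun _ => rfl))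

/-- The defining identity of the weak derivative holds for complex test functions. -/
lemma IsWeakDeriv.integral_complex {U : Set E3} (hU : MeasurableSet U) {j : Fin 3} {f g : E3 → ℂ}
    (hg : IsWeakDeriv U j f g) {Φ : E3 → ℂ} (h1 : ContDiff ℝ ∞ Φ) (h2 : HasCompactSupport Φ)
    (h3 : tsupport Φ ⊆ U) :
    ∫ x in U, fderiv ℝ Φ x (unitVec j) * f x = -∫ x in U, Φ x * g x := by
  have hre : ContDiff ℝ ∞ (fun x => (Φ x).re) := Complex.reCLM.contDiff.comp h1
  have him : ContDiff ℝ ∞ (fun x => (Φ x).im) := Complex.imCLM.contDiff.comp h1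
  have hcre : HasCompactSupport (fun x => (Φ x).re) := h2.comp_left (g := Complex.re) rfl
  have hcim : HasCompactSupport (fun x => (Φ x).im) := h2.comp_left (g := Complex.im) rfl
  have hsre : tsupport (fun x => (Φ x).re) ⊆ U :=
    (closure_mono (Function.support_comp_subset (g := Complex.re) rfl Φ)).trans h3
  have hsim : tsupport (fun x => (Φ x).im) ⊆ U :=
    (closure_mono (Function.support_comp_subset (g := Complex.im) rfl Φ)).trans h3
  have dre : ∀ x, fderiv ℝ (fun x => (Φ x).re) x (unitVec j) = (fderiv ℝ Φ x (unitVec j)).re :=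
    fun x => by
      have := (Complex.reCLM.hasFDerivAt.comp x (h1.differentiable (by simp) x).hasFDerivAt).fderiv
      exact congrArg (fun L : E3 →L[ℝ] ℝ => L (unitVec j)) this
  have dim : ∀ x, fderiv ℝ (fun x => (Φ x).im) x (unitVec j) = (fderiv ℝ Φ x (unitVec j)).im :=
    fun x => by
      have := (Complex.imCLM.hasFDerivAt.comp x (h1.differentiable (by simp) x).hasFDerivAt).fderiv
      exact congrArg (fun L : E3 →L[ℝ] ℝ => L (unitVec j)) this
  have a1 := hg.2.2 _ hre hcre hsre
  have a2 := hg.2.2 _ him hcim hsim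
  have cd : ∀ φ : E3 → ℝ, ContDiff ℝ ∞ φ → Continuous (fun x => fderiv ℝ φ x (unitVec j)) :=
    fun φ hφ => (hφ.continuous_fderiv (by simp)).clm_apply continuous_const
  have cc : ∀ φ : E3 → ℝ, HasCompactSupport φ →
      HasCompactSupport (fun x => fderiv ℝ φ x (unitVec j)) :=
    fun φ hφ => hφ.fderiv_apply ℝ _
  have cs : ∀ φ : E3 → ℝ, tsupport φ ⊆ U → tsupport (fun x => fderiv ℝ φ x (unitVec j)) ⊆ U :=
    fun φ hφ => (tsupport_fderiv_apply_subset ℝ _).trans hφ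
  have i1 := integrable_smul_of_tsupport_subset hU hg.1 (cd _ hre) (cc _ hcre) (cs _ hsre)
  have i2 := integrable_smul_of_tsupport_subset hU hg.1 (cd _ him) (cc _ hcim) (cs _ hsim)
  have i3 := integrable_smul_of_tsupport_subset hU hg.2.1 hre.continuous hcre hsre
  have i4 := integrable_smul_of_tsupport_subset hU hg.2.1 him.continuous hcim hsim
  have key : ∀ (z w : ℂ), z * w = z.re • w + Complex.I * (z.im • w) := fun z w => by
    nth_rewrite 1 [← Complex.re_add_im z]
    simp only [Complex.real_smul]
    ring
  simp only [dre, dim] at a1 a2 i1 i2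
  have e1 : ∀ Ψ u : E3 → ℂ, ∫ x in U, Ψ x * u x =
      ∫ x in U, ((Ψ x).re • u x + Complex.I * ((Ψ x).im • u x)) := fun Ψ u =>
    integral_congr_ae (Filter.Eventually.of_forall fun x => key _ _)
  rw [e1, e1, integral_add i1 (i2.const_mul _), integral_add i3 (i4.const_mul _), integral_const_mul,
    integral_const_mul, a1, a2]
  ring

/-! ### Translations -/

lemma IsWeakDeriv.translate {U V : Set E3} {j : Fin 3} {f g : E3 → ℂ}
    (hg : IsWeakDeriv U j f g) (hfi : IntegrableOn f U) (hgi : IntegrableOn g U) (v : E3)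
    (hv : ∀ x ∈ V, x - v ∈ U) :
    IsWeakDeriv V j (fun x => f (x - v)) (fun x => g (x - v)) := by
  have mp : MeasurePreserving (fun x : E3 => x - v) := measurePreserving_sub_right volume v
  have me : MeasurableEmbedding (fun x : E3 => x - v) := measurableEmbedding_subRight v
  have int : ∀ u : E3 → ℂ, IntegrableOn u U → IntegrableOn (fun x => u (x - v)) V := fun u hu =>
    ((mp.integrableOn_comp_preimage me).2 hu).mono_set hv
  refine ⟨(int f hfi).locallyIntegrableOn, (int g hgi).locallyIntegrableOn,
    fun φ h1 h2 h3 => ?_⟩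
  set ψ : E3 → ℝ := fun x => φ (x + v) with hψ
  have hadd : ContDiff ℝ ∞ (fun x : E3 => x + v) := contDiff_id.add contDiff_const
  have hts : tsupport ψ = (fun x => x + v) ⁻¹' tsupport φ :=
    tsupport_comp_eq_preimage φ (Homeomorph.addRight v)
  have hψU : tsupport ψ ⊆ U := by
    rw [hts]
    intro x hx
    simpa using hv _ (h3 hx)
  have hd : ∀ x, fderiv ℝ ψ x = fderiv ℝ φ (x + v) := fun x => by
    rw [hψ, fderiv_comp_add_right]
  have := hg.2.2 ψ (h1.comp hadd) (h2.comp_homeomorph (Homeomorph.addRight v)) hψU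
  have move : ∀ w : E3 → ℝ, (∀ x, x ∉ tsupport φ → w x = 0) → ∀ u : E3 → ℂ,
      ∫ x in V, w x • u (x - v) = ∫ x in U, w (x + v) • u x := by
    intro w hw u
    rw [setIntegral_eq_integral_of_forall_compl_eq_zero (s := V) (fun x hx => by
      rw [hw x fun h' => hx (h3 h'), zero_smul]),
      setIntegral_eq_integral_of_forall_compl_eq_zero (s := U) (fun x hx => by
      rw [hw (x + v) fun h' => hx (hψU (by rw [hts]; exact h')), zero_smul]),
      ← mp.integral_comp me (fun x => w (x + v) • u x)]
    simp
  have m1 := move (fun x => fderiv ℝ φ x (unitVec j)) (fun x hx => by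
    have : x ∉ tsupport (fderiv ℝ φ) := fun h' => hx (tsupport_fderiv_subset ℝ h')
    simp [image_eq_zero_of_notMem_tsupport this]) f
  rw [m1, move φ (fun x hx => image_eq_zero_of_notMem_tsupport hx) g]
  simpa only [hd] using this

/-- Splitting an integral into a piece and a translate of that piece. -/
lemma setIntegral_eq_add_translate {S T : Set E3} (hT : MeasurableSet T) (v : E3)
    (hS : S =ᵐ[volume] (T ∪ (fun x => x + v) ⁻¹' T : Set E3))
    (hd : Disjoint T ((fun x => x + v) ⁻¹' T)) {F : E3 → ℂ} (hF : IntegrableOn F S) :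
    ∫ x in S, F x = (∫ x in T, F x) + ∫ x in T, F (x - v) := by
  have hF' := hF.congr_set_ae hS.symm
  rw [setIntegral_congr_set hS, setIntegral_union hd (hT.preimage (measurable_add_const v))
    (hF'.mono_set subset_union_left) (hF'.mono_set subset_union_right)]
  congr 1
  rw [← (measurePreserving_add_right volume v).setIntegral_preimage_emb
    (measurableEmbedding_addRight v) (fun x => F (x - v)) T]
  simp

/-- An open box in `ℝ³`. -/
def box (I J K : Set ℝ) : Set E3 := {x | x 0 ∈ I ∧ x 1 ∈ J ∧ x 2 ∈ K}

lemma measurableSet_box {I J K : Set ℝ} (hI : MeasurableSet I) (hJ : MeasurableSet J)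
    (hK : MeasurableSet K) : MeasurableSet (box I J K) := by
  have : ∀ i : Fin 3, Measurable fun x : E3 => x i := fun i =>
    (continuous_apply i |>.comp (PiLp.continuous_ofLp 2 _)).measurable
  exact (this 0 hI).inter ((this 1 hJ).inter (this 2 hK))

lemma ae_coord_ne (i : Fin 3) (c : ℝ) : ∀ᵐ x : E3, x i ≠ c := by
  have h0 : ∀ᵐ x : Fin 3 → ℝ, x i ≠ c := by
    rw [ae_iff]
    simp only [not_not]
    exact Measure.pi_hyperplane (fun _ : Fin 3 => (volume : Measure ℝ)) i c
  exact (PiLp.volume_preserving_ofLp (Fin 3)).quasiMeasurePreserving.ae h0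

lemma unitVec_apply (i j : Fin 3) : unitVec i j = if j = i then 1 else 0 := by
  simp [unitVec]

lemma integral_box_fold_zero {L : ℝ} {J K : Set ℝ} (hJ : MeasurableSet J)
    (hK : MeasurableSet K) {F : E3 → ℂ} (hF : IntegrableOn F (box (Ioo (-L) L) J K)) :
    ∫ x in box (Ioo (-L) L) J K, F x = (∫ x in box (Ioo 0 L) J K, F x) +
      ∫ x in box (Ioo 0 L) J K, F (x - L • unitVec 0) := by
  refine setIntegral_eq_add_translate (measurableSet_box measurableSet_Ioo hJ hK) _ ?_ ?_ hF
  -- The two halves cover the box except for the null plane on which the first coordinate is zero.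
  · filter_upwards [ae_coord_ne 0 0] with x hx
    apply propext
    change x ∈ box _ _ _ ↔ x ∈ box _ _ _ ∪ _
    simp only [box, mem_union, mem_preimage, mem_ofPred_eq, PiLp.add_apply, PiLp.smul_apply,
      unitVec_apply, mem_Ioo, smul_eq_mul, if_true, mul_one, mul_zero, add_zero,
      if_neg (by decide : ¬(1 : Fin 3) = 0), if_neg (by decide : ¬(2 : Fin 3) = 0)]
    rcases lt_or_gt_of_ne hx with h | h
    · constructor
      · rintro ⟨⟨a, b⟩, c, d⟩
        exact Or.inr ⟨⟨by linarith, by linarith⟩, c, d⟩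
      · rintro (⟨⟨a, b⟩, c, d⟩ | ⟨⟨a, b⟩, c, d⟩)
        · linarith
        · exact ⟨⟨by linarith, by linarith⟩, c, d⟩
    · constructor
      · rintro ⟨⟨a, b⟩, c, d⟩
        exact Or.inl ⟨⟨by linarith, by linarith⟩, c, d⟩
      · rintro (⟨⟨a, b⟩, c, d⟩ | ⟨⟨a, b⟩, c, d⟩)
        · exact ⟨⟨by linarith, by linarith⟩, c, d⟩
        · linarith
  · rw [Set.disjoint_left]
    rintro x ⟨h1, -⟩ ⟨h2, -⟩
    simp [unitVec_apply] at h1 h2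
    linarith

lemma integral_box_fold_one {L : ℝ} {I K : Set ℝ} (hI : MeasurableSet I)
    (hK : MeasurableSet K) {F : E3 → ℂ} (hF : IntegrableOn F (box I (Ioo (-L) L) K)) :
    ∫ x in box I (Ioo (-L) L) K, F x = (∫ x in box I (Ioo 0 L) K, F x) +
      ∫ x in box I (Ioo 0 L) K, F (x - L • unitVec 1) := by
  refine setIntegral_eq_add_translate (measurableSet_box hI measurableSet_Ioo hK) _ ?_ ?_ hF
  · filter_upwards [ae_coord_ne 1 0] with x hx
    apply propext
    change x ∈ box _ _ _ ↔ x ∈ box _ _ _ ∪ _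
    simp only [box, mem_union, mem_preimage, mem_ofPred_eq, PiLp.add_apply, PiLp.smul_apply,
      unitVec_apply, mem_Ioo, smul_eq_mul, if_true, mul_one, mul_zero, add_zero,
      if_neg (by decide : ¬(0 : Fin 3) = 1), if_neg (by decide : ¬(2 : Fin 3) = 1)]
    rcases lt_or_gt_of_ne hx with h | h
    · constructor
      · rintro ⟨c, ⟨a, b⟩, d⟩
        exact Or.inr ⟨c, ⟨by linarith, by linarith⟩, d⟩
      · rintro (⟨c, ⟨a, b⟩, d⟩ | ⟨c, ⟨a, b⟩, d⟩)
        · linarith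
        · exact ⟨c, ⟨by linarith, by linarith⟩, d⟩
    · constructor
      · rintro ⟨c, ⟨a, b⟩, d⟩
        exact Or.inl ⟨c, ⟨by linarith, by linarith⟩, d⟩
      · rintro (⟨c, ⟨a, b⟩, d⟩ | ⟨c, ⟨a, b⟩, d⟩)
        · exact ⟨c, ⟨by linarith, by linarith⟩, d⟩
        · linarith
  · rw [Set.disjoint_left]
    rintro x ⟨-, h1, -⟩ ⟨-, h2, -⟩
    simp [unitVec_apply] at h1 h2
    linarith

/-! ### Products of functions of one variable -/

/-- The function `u₀(x₁) u₁(x₂) u₂(x₃)`. -/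
def triple (u : Fin 3 → ℝ → ℂ) (x : E3) : ℂ := u 0 (x 0) * u 1 (x 1) * u 2 (x 2)

lemma contDiff_coord (i : Fin 3) : ContDiff ℝ ∞ (fun x : E3 => x i) :=
  contDiff_piLp_apply 2

lemma contDiff_triple {u : Fin 3 → ℝ → ℂ} (hu : ∀ i, ContDiff ℝ ∞ (u i)) :
    ContDiff ℝ ∞ (triple u) :=
  (((hu 0).comp (contDiff_coord 0)).mul ((hu 1).comp (contDiff_coord 1))).mul
    ((hu 2).comp (contDiff_coord 2))

lemma fderiv_triple {u : Fin 3 → ℝ → ℂ} (hu : ∀ i, ContDiff ℝ ∞ (u i)) (j : Fin 3) (x : E3) :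
    fderiv ℝ (triple u) x (unitVec j) = triple (Function.update u j (deriv (u j))) x := by
  have hline : HasDerivAt (fun s : ℝ => triple u (x + s • unitVec j))
      (fderiv ℝ (triple u) x (unitVec j)) 0 :=
    ((contDiff_triple hu).differentiable (by simp) x).hasFDerivAt.hasLineDerivAt (unitVec j)
  have hd : ∀ i s, HasDerivAt (u i) (deriv (u i) s) s := fun i s =>
    ((hu i).differentiable (by simp) s).hasDerivAt
  refine hline.unique ?_
  have hs : ∀ i, HasDerivAt (fun s : ℝ => u i (x i + s * unitVec j i))
      ((unitVec j i : ℝ) • deriv (u i) (x i)) 0 := by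
    intro i
    have h1 : HasDerivAt (fun s : ℝ => x i + s * unitVec j i) (unitVec j i) 0 := by
      simpa using ((hasDerivAt_id (0 : ℝ)).mul_const (unitVec j i)).const_add (x i)
    have h2 := (hd i (x i + 0 * unitVec j i)).scomp (0 : ℝ) h1
    rw [zero_mul, add_zero] at h2
    exact h2
  have := ((hs 0).mul (hs 1)).mul (hs 2)
  refine HasDerivAt.congr_deriv (f := fun s : ℝ => triple u (x + s • unitVec j)) this ?_
  fin_cases j <;> simp [triple, unitVec_apply, Function.update]

lemma norm_le_sum_coord (x : E3) : ‖x‖ ≤ |x 0| + |x 1| + |x 2| := by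
  rw [EuclideanSpace.norm_eq, Real.sqrt_le_left (by positivity)]
  simp only [Fin.sum_univ_three, Real.norm_eq_abs]
  have := abs_nonneg (x 0)
  have := abs_nonneg (x 1)
  have := abs_nonneg (x 2)
  nlinarith [mul_nonneg (abs_nonneg (x 0)) (abs_nonneg (x 1)),
    mul_nonneg (abs_nonneg (x 0)) (abs_nonneg (x 2)),
    mul_nonneg (abs_nonneg (x 1)) (abs_nonneg (x 2))]

lemma tsupport_triple_subset (u : Fin 3 → ℝ → ℂ) :
    tsupport (triple u) ⊆ box (tsupport (u 0)) (tsupport (u 1)) (tsupport (u 2)) := by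
  have hc : ∀ i : Fin 3, Continuous fun x : E3 => x i := fun i => (contDiff_coord i).continuous
  have hcl : IsClosed (box (tsupport (u 0)) (tsupport (u 1)) (tsupport (u 2))) :=
    ((isClosed_tsupport _).preimage (hc 0)).inter
      (((isClosed_tsupport _).preimage (hc 1)).inter ((isClosed_tsupport _).preimage (hc 2)))
  refine closure_minimal (fun x hx => ?_) hcl
  simp only [triple, Function.mem_support, mul_ne_zero_iff] at hx
  exact ⟨subset_tsupport _ hx.1.1, subset_tsupport _ hx.1.2, subset_tsupport _ hx.2⟩

/-! ### Periodic test functions -/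

/-- The periodization on `(0, 2π)` of a function supported in `(-2π, 2π)`. -/
def fold (w : ℝ → ℂ) (s : ℝ) : ℂ := w s + w (s - 2 * Real.pi)

/-- The periodization of the first two factors of `triple w`. -/
def foldTriple (w : Fin 3 → ℝ → ℂ) : Fin 3 → ℝ → ℂ := ![fold (w 0), fold (w 1), w 2]

lemma exists_bound_triple {w : Fin 3 → ℝ → ℂ} (hw : ∀ i, Continuous (w i))
    (hc : ∀ i, HasCompactSupport (w i)) : ∃ C, ∀ x, ‖triple w x‖ ≤ C := by
  choose C hC using fun i => (hc i).exists_bound_of_continuous (hw i)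
  refine ⟨C 0 * C 1 * C 2, fun x => ?_⟩
  have h0 := (norm_nonneg _).trans (hC 0 0)
  have h1 := (norm_nonneg _).trans (hC 1 0)
  rw [triple, norm_mul, norm_mul]
  exact mul_le_mul (mul_le_mul (hC 0 _) (hC 1 _) (norm_nonneg _) h0) (hC 2 _) (norm_nonneg _)
    (mul_nonneg h0 h1)

lemma continuous_triple {w : Fin 3 → ℝ → ℂ} (hw : ∀ i, Continuous (w i)) :
    Continuous (triple w) :=
  (((hw 0).comp (contDiff_coord 0).continuous).mul ((hw 1).comp (contDiff_coord 1).continuous)).mul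
    ((hw 2).comp (contDiff_coord 2).continuous)

/-- The horizontal square of side `4π` splits into four translates of the cell. Translating each
back leaves `D` unchanged by periodicity and collects the test factors into their foldings. `G`
plays the role of the extension or of its derivative, and `hGD` expresses periodicity only almost
everywhere. -/
lemma integral_triple_fold {h : ℝ} {B : Set E3} {w : Fin 3 → ℝ → ℂ} (hw : ∀ i, Continuous (w i))
    (hc : ∀ i, HasCompactSupport (w i))
    (hw0 : ∀ s ∉ Ioo (-(2 * Real.pi)) (2 * Real.pi), w 0 s = 0)
    (hw1 : ∀ s ∉ Ioo (-(2 * Real.pi)) (2 * Real.pi), w 1 s = 0)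
    (hw2 : ∀ s ∉ Ioo 0 h, w 2 s = 0) {G D : E3 → ℂ} (hG : IntegrableOn G B)
    (hD : IntegrableOn D (Omega h)) (hBm : MeasurableSet B)
    (hB : box (Ioo (-(2 * Real.pi)) (2 * Real.pi)) (Ioo (-(2 * Real.pi)) (2 * Real.pi))
      (Ioo 0 h) ⊆ B)
    (hGD : ∀ a ∈ ({0, 2 * Real.pi} : Set ℝ), ∀ b ∈ ({0, 2 * Real.pi} : Set ℝ),
      ∀ᵐ x ∂volume.restrict (Omega h), G (x - b • unitVec 1 - a • unitVec 0) = D x) :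
    ∫ x in B, triple w x * G x = ∫ x in Omega h, triple (foldTriple w) x * D x := by
  obtain ⟨C, hC⟩ := exists_bound_triple hw hc
  set L := 2 * Real.pi with hL
  set S := box (Ioo (-L) L) (Ioo (-L) L) (Ioo 0 h) with hS
  have hFB : IntegrableOn (fun x => triple w x * G x) B :=
    Integrable.bdd_mul (c := C) hG (continuous_triple hw).aestronglyMeasurable
      (Filter.Eventually.of_forall hC)
  have hBS : ∫ x in B, triple w x * G x = ∫ x in S, triple w x * G x := by
    refine setIntegral_eq_of_subset_of_forall_sdiff_eq_zero hBm hB fun x hx => ?_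
    have : triple w x = 0 := by
      by_contra hne
      simp only [triple, mul_ne_zero_iff] at hne
      refine hx.2 ⟨?_, ?_, ?_⟩
      · by_contra h'; exact hne.1.1 (hw0 _ h')
      · by_contra h'; exact hne.1.2 (hw1 _ h')
      · by_contra h'; exact hne.2 (hw2 _ h')
    rw [this, zero_mul]
  set F : E3 → ℂ := fun x => triple w x * G x with hF
  have hFS : IntegrableOn F S := hFB.mono_set hB
  have hpi : 0 < L := Real.two_pi_pos
  have hFS' : IntegrableOn (fun x => F (x - L • unitVec 0))
      (box (Ioo 0 L) (Ioo (-L) L) (Ioo 0 h)) := by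
    refine (((measurePreserving_sub_right volume (L • unitVec 0)).integrableOn_comp_preimage
      (measurableEmbedding_subRight _)).2 hFS).mono_set fun x hx => ?_
    refine ⟨?_, ?_, ?_⟩
    · have := hx.1
      simp only [PiLp.sub_apply, PiLp.smul_apply, unitVec_apply, if_true, smul_eq_mul, mul_one]
      exact ⟨by linarith [this.1], by linarith [this.2]⟩
    · simpa [unitVec_apply] using hx.2.1
    · simpa [unitVec_apply] using hx.2.2
  have hsub : box (Ioo 0 L) (Ioo (-L) L) (Ioo 0 h) ⊆ S := fun x hx =>
    ⟨⟨by linarith [hx.1.1], hx.1.2⟩, hx.2⟩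
  have hΩ : Omega h = box (Ioo 0 L) (Ioo 0 L) (Ioo 0 h) := rfl
  rw [hBS, integral_box_fold_zero measurableSet_Ioo measurableSet_Ioo hFS,
    integral_box_fold_one measurableSet_Ioo measurableSet_Ioo (hFS.mono_set hsub),
    integral_box_fold_one measurableSet_Ioo measurableSet_Ioo hFS', ← hΩ]
  have piece : ∀ a ∈ ({0, L} : Set ℝ), ∀ b ∈ ({0, L} : Set ℝ),
      IntegrableOn (fun x : E3 => w 0 (x 0 - a) * w 1 (x 1 - b) * w 2 (x 2) * D x) (Omega h) ∧
      ∫ x in Omega h, F (x - b • unitVec 1 - a • unitVec 0) =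
        ∫ x in Omega h, w 0 (x 0 - a) * w 1 (x 1 - b) * w 2 (x 2) * D x := by
    intro a ha b hb
    have e : ∀ x : E3, triple w (x - b • unitVec 1 - a • unitVec 0) =
        w 0 (x 0 - a) * w 1 (x 1 - b) * w 2 (x 2) := fun x => by
      simp [triple, unitVec_apply]
    constructor
    · refine Integrable.bdd_mul (c := C) hD ?_ (Filter.Eventually.of_forall fun x => ?_)
      · simp only [← e]
        exact ((continuous_triple hw).comp
          (g := triple w) (f := fun x : E3 => x - b • unitVec 1 - a • unitVec 0)
          (by fun_prop)).aestronglyMeasurable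
      · rw [← e]; exact hC _
    · refine integral_congr_ae ?_
      filter_upwards [hGD a ha b hb] with x hx
      simp only [hF, hx, e]
  have p00 := piece 0 (by simp) 0 (by simp)
  have p01 := piece 0 (by simp) L (by simp)
  have p10 := piece L (by simp) 0 (by simp)
  have p11 := piece L (by simp) L (by simp)
  simp only [zero_smul, sub_zero] at p00 p01 p10 p11
  rw [p00.2, p01.2, p10.2, p11.2, ← integral_add p00.1 p01.1, ← integral_add p10.1 p11.1]
  refine (integral_add (p00.1.add p01.1) (p10.1.add p11.1)).symm.trans ?_
  refine integral_congr_ae (Filter.Eventually.of_forall fun x => ?_)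
  simp only [Pi.add_apply, triple, foldTriple, fold, Matrix.cons_val_zero, Matrix.cons_val_one,
    Matrix.cons_val, ← hL]
  ring

/-- Integration by parts on the cell without lateral boundary terms. The test functions may cross
the lateral faces: the weak derivative is tested on a ball for the periodic extension, and both
sides are folded back onto `Ω`. -/
lemma MemH1p.integral_triple {h : ℝ} {f : E3 → ℂ} (hf : MemH1p h f) {u : Fin 3 → ℝ → ℂ}
    (hu : ∀ i, ContDiff ℝ ∞ (u i)) (hc : ∀ i, HasCompactSupport (u i))
    (hu0 : tsupport (u 0) ⊆ Ioo (-(2 * Real.pi)) (2 * Real.pi))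
    (hu1 : tsupport (u 1) ⊆ Ioo (-(2 * Real.pi)) (2 * Real.pi))
    (hu2 : tsupport (u 2) ⊆ Ioo 0 h) (j : Fin 3) :
    ∫ x in Omega h, triple (foldTriple (Function.update u j (deriv (u j)))) x * f x =
      -∫ x in Omega h, triple (foldTriple u) x * weakDeriv (Omega h) j f x := by
  obtain ⟨hf1, ft, hper, hloc, hft⟩ := hf
  set L := 2 * Real.pi with hL
  have hpi : 0 < L := Real.two_pi_pos
  -- The radius bounds the sum of the absolute coordinates on the box of horizontal half-width `L`
  -- and height `h`.
  set B := Metric.ball (0 : E3) (2 * L + h) with hB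
  have hBm : MeasurableSet B := measurableSet_ball
  have hftB := hloc 0 (2 * L + h)
  have hfin : IsFiniteMeasure (volume.restrict B) := 
    ⟨by rw [Measure.restrict_apply_univ]; exact Metric.isBounded_ball.measure_lt_top⟩
  set g := weakDeriv B j ft with hg
  have hgw : IsWeakDeriv B j ft g := hftB.isWeakDeriv j
  have hgi : IntegrableOn g B := (hftB.memLp_weakDeriv Metric.isOpen_ball j).integrable (by norm_num)
  have hfti : IntegrableOn ft B := hftB.1.integrable (by norm_num)
  have hΩi : IntegrableOn f (Omega h) := hf1.1.integrable (by norm_num)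
  have hDi : IntegrableOn (weakDeriv (Omega h) j f) (Omega h) :=
    (hf1.memLp_weakDeriv (isOpen_Omega h) j).integrable (by norm_num)
  have hSB : box (Ioo (-L) L) (Ioo (-L) L) (Ioo 0 h) ⊆ B := by
    intro x hx
    rw [hB, mem_ball_zero_iff]
    refine (norm_le_sum_coord x).trans_lt ?_
    have h0 := abs_lt.2 hx.1
    have h1 := abs_lt.2 hx.2.1
    have h2 : |x 2| < h := by rw [abs_of_pos hx.2.2.1]; exact hx.2.2.2
    linarith
  have hshift : ∀ a ∈ ({0, L} : Set ℝ), ∀ b ∈ ({0, L} : Set ℝ), ∀ x : E3,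
      ft (x - b • unitVec 1 - a • unitVec 0) = ft x := by
    have k0 : ∀ x, ft (x - L • unitVec 0) = ft x := fun x => by
      have := (hper (x - L • unitVec 0)).1
      rwa [← hL, sub_add_cancel, eq_comm] at this
    have k1 : ∀ x, ft (x - L • unitVec 1) = ft x := fun x => by
      have := (hper (x - L • unitVec 1)).2
      rwa [← hL, sub_add_cancel, eq_comm] at this
    rintro a (rfl | rfl) b (rfl | rfl) x <;> simp only [zero_smul, sub_zero, k0, k1]
  have hshiftg : ∀ a ∈ ({0, L} : Set ℝ), ∀ b ∈ ({0, L} : Set ℝ),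
      ∀ᵐ x ∂volume.restrict (Omega h), g (x - b • unitVec 1 - a • unitVec 0) =
        weakDeriv (Omega h) j f x := by
    intro a ha b hb
    -- A translate of `g` is a weak derivative on `Ω` of the translated extension. By periodicity
    -- that function agrees with `f` almost everywhere, so uniqueness identifies its derivative.
    have ht := hgw.translate (V := Omega h) hfti hgi (b • unitVec 1 + a • unitVec 0) (by
      intro x hx
      apply hSB
      have ha' : 0 ≤ a ∧ a ≤ L := by
        rcases ha with rfl | rfl
        · exact ⟨le_rfl, hpi.le⟩
        · exact ⟨hpi.le, le_rfl⟩
      have hb' : 0 ≤ b ∧ b ≤ L := by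
        rcases hb with rfl | rfl
        · exact ⟨le_rfl, hpi.le⟩
        · exact ⟨hpi.le, le_rfl⟩
      obtain ⟨⟨x1, x2⟩, ⟨x3, x4⟩, x5⟩ := hx
      refine ⟨?_, ?_, ?_⟩
      · simp [unitVec_apply]; constructor <;> linarith
      · simp [unitVec_apply]; constructor <;> linarith
      · simpa [unitVec_apply] using x5)
    simp only [← sub_sub] at ht
    refine ht.ae_eq (isOpen_Omega h) (hf1.isWeakDeriv j) ?_
    filter_upwards [hft] with x hx
    rw [hshift a ha b hb, hx]
  have hdc : Continuous (deriv (u j)) := (contDiff_infty_iff_deriv.1 (hu j)).2.continuous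
  have hts : ∀ i, tsupport (Function.update u j (deriv (u j)) i) ⊆ tsupport (u i) := by
    intro i
    by_cases hij : i = j
    · subst hij
      rw [Function.update_self]
      exact closure_minimal support_deriv_subset (isClosed_tsupport (u i))
    · rw [Function.update_of_ne hij]
  have hsupp : tsupport (triple u) ⊆ B := (tsupport_triple_subset u).trans
    fun x hx => hSB ⟨hu0 hx.1, hu1 hx.2.1, hu2 hx.2.2⟩
  have hcs : HasCompactSupport (triple u) :=
    Metric.isCompact_of_isClosed_isBounded (isClosed_tsupport _)
      (Metric.isBounded_ball.subset hsupp)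
  have main := hgw.integral_complex hBm (contDiff_triple hu) hcs hsupp
  simp only [fderiv_triple hu] at main
  have hz : ∀ (v : ℝ → ℂ) (I : Set ℝ), tsupport v ⊆ I → ∀ s ∉ I, v s = 0 := fun v I hv s hs =>
    image_eq_zero_of_notMem_tsupport fun h' => hs (hv h')
  rw [integral_triple_fold (h := h) (D := f) ?_ ?_ (hz _ _ ((hts 0).trans hu0))
      (hz _ _ ((hts 1).trans hu1)) (hz _ _ ((hts 2).trans hu2)) hfti hΩi hBm hSB ?_,
    integral_triple_fold (fun i => (hu i).continuous) hc (hz _ _ hu0) (hz _ _ hu1) (hz _ _ hu2)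
      hgi hDi hBm hSB hshiftg] at main
  · exact main
  · intro i
    by_cases hij : i = j
    · subst hij
      simpa using hdc
    · rw [Function.update_of_ne hij]
      exact (hu i).continuous
  · intro i
    exact (hc i).mono' ((subset_tsupport _).trans (hts i))
  · intro a ha b hb
    filter_upwards [hft] with x hx
    rw [hshift a ha b hb, hx]

/-- A smooth function supported in `(-2π, 2π)` whose `2π`-translates sum up to one. -/
def periodicCutoff (s : ℝ) : ℝ :=
  Real.smoothTransition ((s + 2 * Real.pi) / Real.pi - 1 / 2) -
    Real.smoothTransition (s / Real.pi - 1 / 2)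

lemma contDiff_periodicCutoff : ContDiff ℝ ∞ periodicCutoff := by
  unfold periodicCutoff
  exact (Real.smoothTransition.contDiff.comp (by fun_prop)).sub
    (Real.smoothTransition.contDiff.comp (by fun_prop))

lemma tsupport_periodicCutoff : tsupport periodicCutoff ⊆ Ioo (-(2 * Real.pi)) (2 * Real.pi) := by
  have hp := Real.pi_pos
  -- The first transition runs over `[-3π/2, -π/2]` and the second over `[π/2, 3π/2]`; outside both,
  -- on either side, the two terms cancel.
  have : tsupport periodicCutoff ⊆ Icc (-(3 / 2 * Real.pi)) (3 / 2 * Real.pi) := by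
    refine closure_minimal (fun s hs => ?_) isClosed_Icc
    by_contra hcon
    refine hs ?_
    rw [mem_Icc, not_and_or, not_le, not_le] at hcon
    rcases hcon with hcon | hcon
    · rw [periodicCutoff, Real.smoothTransition.zero_of_nonpos, Real.smoothTransition.zero_of_nonpos,
        sub_zero]
      · have : s / Real.pi < 0 := div_neg_of_neg_of_pos (by linarith) hp
        linarith
      · have : (s + 2 * Real.pi) / Real.pi < 1 / 2 := by
          rw [div_lt_iff₀ hp]; linarith
        linarith
    · rw [periodicCutoff, Real.smoothTransition.one_of_one_le, Real.smoothTransition.one_of_one_le,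
        sub_self]
      · have : 3 / 2 < s / Real.pi := by
          rw [lt_div_iff₀ hp]; linarith
        linarith
      · have : 3 / 2 < (s + 2 * Real.pi) / Real.pi := by
          rw [lt_div_iff₀ hp]; linarith
        linarith
  exact this.trans (Icc_subset_Ioo (by linarith) (by linarith))

/-- The sum telescopes: the two middle terms cancel, the transition at `s + 2π` is already complete,
and the one at `s - 2π` has not begun. -/
lemma periodicCutoff_add {s : ℝ} (hs : s ∈ Ioo 0 (2 * Real.pi)) :
    periodicCutoff s + periodicCutoff (s - 2 * Real.pi) = 1 := by
  have hp := Real.pi_pos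
  rw [periodicCutoff, periodicCutoff, sub_add_cancel,
    Real.smoothTransition.one_of_one_le (x := (s + 2 * Real.pi) / Real.pi - 1 / 2),
    Real.smoothTransition.zero_of_nonpos (x := (s - 2 * Real.pi) / Real.pi - 1 / 2)]
  · ring
  · have : (s - 2 * Real.pi) / Real.pi < 0 := div_neg_of_neg_of_pos (by linarith [hs.2]) hp
    linarith
  · have : 2 < (s + 2 * Real.pi) / Real.pi := by
      rw [lt_div_iff₀ hp]; linarith [hs.1]
    linarith

/-- The localized character `η(s) exp(-i m s)`. -/
def localChar (m : ℤ) (s : ℝ) : ℂ :=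
  (periodicCutoff s : ℂ) * Complex.exp (-(Complex.I * ((m : ℂ) * (s : ℂ))))

lemma contDiff_localChar (m : ℤ) : ContDiff ℝ ∞ (localChar m) := by
  unfold localChar
  refine (Complex.ofRealCLM.contDiff.comp contDiff_periodicCutoff).mul ?_
  have h1 : ContDiff ℝ ∞ (fun s : ℝ => -(Complex.I * ((m : ℂ) * (s : ℂ)))) :=
    (contDiff_const.mul (contDiff_const.mul Complex.ofRealCLM.contDiff)).neg
  exact h1.cexp

lemma tsupport_localChar (m : ℤ) : tsupport (localChar m) ⊆ Ioo (-(2 * Real.pi)) (2 * Real.pi) := by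
  refine Subset.trans (closure_mono fun s hs => ?_) tsupport_periodicCutoff
  simp only [localChar, Function.mem_support, mul_ne_zero_iff] at hs
  exact_mod_cast hs.1

lemma hasCompactSupport_localChar (m : ℤ) : HasCompactSupport (localChar m) :=
  Metric.isCompact_of_isClosed_isBounded (isClosed_tsupport _)
    (Metric.isBounded_Ioo _ _ |>.subset (tsupport_localChar m))

lemma fold_localChar (m : ℤ) {s : ℝ} (hs : s ∈ Ioo 0 (2 * Real.pi)) :
    fold (localChar m) s = Complex.exp (-(Complex.I * ((m : ℂ) * (s : ℂ)))) := by
  have e : Complex.exp (-(Complex.I * ((m : ℂ) * ((s - 2 * Real.pi : ℝ) : ℂ)))) =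
      Complex.exp (-(Complex.I * ((m : ℂ) * (s : ℂ)))) := by
    rw [Complex.exp_eq_exp_iff_exists_int]
    exact ⟨m, by push_cast; ring⟩
  rw [fold, localChar, localChar, e, ← add_mul]
  have := periodicCutoff_add hs
  rw [show (periodicCutoff s : ℂ) + (periodicCutoff (s - 2 * Real.pi) : ℂ) = 1 by
    exact_mod_cast this, one_mul]

/-- Folding commutes with differentiation, and the folded function coincides with the character on
the open cell; derivatives of the cutoff therefore cancel. -/
lemma fold_deriv_localChar (m : ℤ) {s : ℝ} (hs : s ∈ Ioo 0 (2 * Real.pi)) :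
    fold (deriv (localChar m)) s =
      -(Complex.I * m) * Complex.exp (-(Complex.I * ((m : ℂ) * (s : ℂ)))) := by
  have hd : ∀ s, HasDerivAt (localChar m) (deriv (localChar m) s) s := fun s =>
    ((contDiff_localChar m).differentiable (by simp) s).hasDerivAt
  have h1 : HasDerivAt (fold (localChar m)) (fold (deriv (localChar m)) s) s :=
    (hd s).add ((hd (s - 2 * Real.pi)).comp_sub_const s (2 * Real.pi))
  have h2 : HasDerivAt (fun s : ℝ => Complex.exp (-(Complex.I * ((m : ℂ) * (s : ℂ)))))
      (-(Complex.I * m) * Complex.exp (-(Complex.I * ((m : ℂ) * (s : ℂ))))) s := by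
    have h3 : HasDerivAt (fun s : ℝ => -(Complex.I * ((m : ℂ) * (s : ℂ)))) (-(Complex.I * m)) s := by
      have := ((Complex.ofRealCLM.hasDerivAt (x := s)).const_mul (m : ℂ)).const_mul Complex.I
      simpa using this.fun_neg
    simpa [mul_comm] using h3.cexp
  refine h1.unique (h2.congr_of_eventuallyEq ?_)
  filter_upwards [isOpen_Ioo.mem_nhds hs] with r hr using fold_localChar m hr

/-! ### Fourier coefficients of weak derivatives -/

section CoefDeriv

variable {h : ℝ} {f : E3 → ℂ}

lemma MemH1p.integrableOn (hf : MemH1p h f) : IntegrableOn f (Omega h) :=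
  hf.1.1.integrable (by norm_num)

lemma MemH1p.memLp_weakDeriv (hf : MemH1p h f) (j : Fin 3) :
    MemLp (weakDeriv (Omega h) j f) 2 (volume.restrict (Omega h)) :=
  hf.1.memLp_weakDeriv (isOpen_Omega h) j

lemma MemH1p.integrableOn_weakDeriv (hf : MemH1p h f) (j : Fin 3) :
    IntegrableOn (weakDeriv (Omega h) j f) (Omega h) :=
  (hf.memLp_weakDeriv j).integrable (by norm_num)

/-- The test function is a localized character times `χ(x₃)`. For the horizontal directions the
derivative falls on the character and yields the factor `-i n_j`; for the vertical one it falls on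
`χ`. The vector indexed by `j` gathers the three cases. -/
lemma MemH1p.integral_mul_coefAt (hf : MemH1p h f) (n : ℤ × ℤ) (j : Fin 3) {χ : ℝ → ℝ}
    (h1 : ContDiff ℝ ∞ χ) (h2 : HasCompactSupport χ) (h3 : tsupport χ ⊆ Ioo 0 h) :
    ∫ t in Ioo 0 h, (![fun t => -(Complex.I * n.1) * (χ t : ℂ), fun t => -(Complex.I * n.2) * (χ t : ℂ),
        fun t => ((deriv χ t : ℝ) : ℂ)] : Fin 3 → ℝ → ℂ) j t * coefAt f n t =
      -∫ t in Ioo 0 h, (χ t : ℂ) * coefAt (weakDeriv (Omega h) j f) n t := by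
  set u : Fin 3 → ℝ → ℂ := ![localChar n.1, localChar n.2, fun t => (χ t : ℂ)] with hu
  have hχ : ContDiff ℝ ∞ (fun t => (χ t : ℂ)) := Complex.ofRealCLM.contDiff.comp h1
  have hχc : HasCompactSupport (fun t => (χ t : ℂ)) := h2.comp_left (g := Complex.ofReal) rfl
  have hχs : tsupport (fun t => (χ t : ℂ)) ⊆ Ioo 0 h :=
    (closure_mono (Function.support_comp_subset (g := Complex.ofReal) rfl χ)).trans h3
  have hχd : deriv (fun t => (χ t : ℂ)) = fun t => ((deriv χ t : ℝ) : ℂ) := funext fun t =>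
    ((h1.differentiable (by simp)) t).hasDerivAt.ofReal_comp.deriv
  have main := hf.integral_triple (u := u)
    (by intro i; fin_cases i <;> [exact contDiff_localChar _; exact contDiff_localChar _; exact hχ])
    (by intro i; fin_cases i <;>
          [exact hasCompactSupport_localChar _; exact hasCompactSupport_localChar _; exact hχc])
    (tsupport_localChar _) (tsupport_localChar _) hχs j
  obtain ⟨M, hM⟩ := hχc.exists_bound_of_continuous hχ.continuous
  have hdc : Continuous (fun t => ((deriv χ t : ℝ) : ℂ)) :=
    Complex.continuous_ofReal.comp (contDiff_infty_iff_deriv.1 h1).2.continuous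
  have hdcs : HasCompactSupport (fun t => ((deriv χ t : ℝ) : ℂ)) :=
    h2.deriv.comp_left (g := Complex.ofReal) rfl
  obtain ⟨M', hM'⟩ := hdcs.exists_bound_of_continuous hdc
  have echar : ∀ x : E3, character n (x 0, x 1) =
      Complex.exp (-(Complex.I * ((n.1 : ℂ) * (x 0 : ℂ)))) *
        Complex.exp (-(Complex.I * ((n.2 : ℂ) * (x 1 : ℂ)))) := fun x => by
    rw [character, ← Complex.exp_add]
    congr 1
    ring
  rw [integral_mul_character (hf.integrableOn_weakDeriv j) n hχ.continuous hM]
  have hr : ∫ x in Omega h, triple (foldTriple u) x * weakDeriv (Omega h) j f x =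
      ∫ x in Omega h, (χ (x 2) : ℂ) * (weakDeriv (Omega h) j f x * character n (x 0, x 1)) := by
    refine setIntegral_congr_fun (isOpen_Omega h).measurableSet fun x hx => ?_
    simp only [triple, foldTriple, hu, Matrix.cons_val_zero, Matrix.cons_val_one, Matrix.cons_val,
      fold_localChar _ hx.1, fold_localChar _ hx.2.1, echar]
    ring
  rw [hr, eq_comm, neg_eq_iff_eq_neg] at main
  fin_cases j
  · simp only [Fin.zero_eta, Matrix.cons_val_zero] at main ⊢
    rw [integral_mul_character hf.integrableOn n (M := ‖Complex.I * n.1‖ * M)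
      (χ := fun t => -(Complex.I * n.1) * (χ t : ℂ)) (continuous_const.mul hχ.continuous)
      (fun t => by rw [norm_mul, norm_neg]; gcongr; exact hM t), main, mul_neg, neg_neg]
    congr 1
    refine setIntegral_congr_fun (isOpen_Omega h).measurableSet fun x hx => ?_
    simp [triple, foldTriple, hu, fold_deriv_localChar _ hx.1, fold_localChar _ hx.2.1, echar,
      Function.update]
    ring
  · simp only [Fin.mk_one, Matrix.cons_val_one, Matrix.cons_val_zero] at main ⊢
    rw [integral_mul_character hf.integrableOn n (M := ‖Complex.I * n.2‖ * M)
      (χ := fun t => -(Complex.I * n.2) * (χ t : ℂ)) (continuous_const.mul hχ.continuous)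
      (fun t => by rw [norm_mul, norm_neg]; gcongr; exact hM t), main, mul_neg, neg_neg]
    congr 1
    refine setIntegral_congr_fun (isOpen_Omega h).measurableSet fun x hx => ?_
    simp [triple, foldTriple, hu, fold_deriv_localChar _ hx.2.1, fold_localChar _ hx.1, echar,
      Function.update]
    ring
  · simp only [Fin.reduceFinMk, Matrix.cons_val] at main ⊢
    rw [integral_mul_character hf.integrableOn n hdc hM', main, mul_neg, neg_neg]
    congr 1
    refine setIntegral_congr_fun (isOpen_Omega h).measurableSet fun x hx => ?_
    simp [triple, foldTriple, hu, fold_localChar _ hx.1, fold_localChar _ hx.2.1, echar,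
      Function.update, hχd]
    ring

lemma ae_eq_of_integral_testFunction {a b : ℝ → ℂ} (ha : IntegrableOn a (Ioo 0 h))
    (hb : IntegrableOn b (Ioo 0 h))
    (H : ∀ χ : ℝ → ℝ, ContDiff ℝ ∞ χ → HasCompactSupport χ → tsupport χ ⊆ Ioo 0 h →
      ∫ t in Ioo 0 h, (χ t : ℂ) * a t = ∫ t in Ioo 0 h, (χ t : ℂ) * b t) :
    ∀ᵐ t ∂volume.restrict (Ioo 0 h), a t = b t := by
  have := isOpen_Ioo.ae_eq_zero_of_integral_contDiff_smul_eq_zero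
    (μ := volume.restrict (Ioo 0 h)) (U := Ioo 0 h) (f := fun t => a t - b t)
    ((ha.sub hb).integrableOn.locallyIntegrableOn) (by
      intro χ h1 h2 h3
      obtain ⟨M, hM⟩ := h2.exists_bound_of_continuous h1.continuous
      have ia : IntegrableOn (fun t => χ t • a t) (Ioo 0 h) :=
        ha.bdd_smul M h1.continuous.aestronglyMeasurable (Filter.Eventually.of_forall hM)
      have ib : IntegrableOn (fun t => χ t • b t) (Ioo 0 h) :=
        hb.bdd_smul M h1.continuous.aestronglyMeasurable (Filter.Eventually.of_forall hM)
      simp only [smul_sub]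
      rw [integral_sub ia ib]
      simpa [sub_eq_zero] using H χ h1 h2 h3)
  filter_upwards [this, ae_restrict_mem measurableSet_Ioo] with t h1 h2
  exact sub_eq_zero.1 (h1 h2)

lemma MemH1p.coefAt_weakDeriv_zero (hf : MemH1p h f) (n : ℤ × ℤ) :
    ∀ᵐ t ∂volume.restrict (Ioo 0 h),
      coefAt (weakDeriv (Omega h) 0 f) n t = Complex.I * n.1 * coefAt f n t := by
  refine ae_eq_of_integral_testFunction (integrableOn_coefAt (hf.integrableOn_weakDeriv 0) n)
    ((integrableOn_coefAt hf.integrableOn n).const_mul _) fun χ h1 h2 h3 => ?_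
  have := hf.integral_mul_coefAt n 0 h1 h2 h3
  rw [← neg_eq_iff_eq_neg] at this
  rw [← this, ← integral_neg]
  refine integral_congr_ae (Filter.Eventually.of_forall fun t => ?_)
  simp
  ring

lemma MemH1p.coefAt_weakDeriv_one (hf : MemH1p h f) (n : ℤ × ℤ) :
    ∀ᵐ t ∂volume.restrict (Ioo 0 h),
      coefAt (weakDeriv (Omega h) 1 f) n t = Complex.I * n.2 * coefAt f n t := by
  refine ae_eq_of_integral_testFunction (integrableOn_coefAt (hf.integrableOn_weakDeriv 1) n)
    ((integrableOn_coefAt hf.integrableOn n).const_mul _) fun χ h1 h2 h3 => ?_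
  have := hf.integral_mul_coefAt n 1 h1 h2 h3
  rw [← neg_eq_iff_eq_neg] at this
  rw [← this, ← integral_neg]
  refine integral_congr_ae (Filter.Eventually.of_forall fun t => ?_)
  simp
  ring

/-- The representative `b` gives each coefficient well-defined values at the heights 0 and `h`,
which `coefAt`, meaningful only almost everywhere, does not have. -/
lemma MemH1p.exists_isPrimitiveOn_coefAt (hf : MemH1p h f) (hh : 0 < h) (n : ℤ × ℤ) :
    ∃ b, IsPrimitiveOn h (coefAt (weakDeriv (Omega h) 2 f) n) b ∧
      ∀ᵐ t ∂volume.restrict (Ioo 0 h), coefAt f n t = b t := by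
  refine exists_isPrimitiveOn_of_weakDeriv hh (integrableOn_coefAt hf.integrableOn n)
    (integrableOn_coefAt (hf.integrableOn_weakDeriv 2) n) fun χ h1 h2 h3 => ?_
  simpa using hf.integral_mul_coefAt n 2 h1 h2 h3

end CoefDeriv

/-! ### Integration over vertical lines -/

/-- The integral of `q` over the vertical line through `y`. -/
def verticalIntegral (h : ℝ) (q : E3 → ℂ) (y : ℝ × ℝ) : ℂ := ∫ t in Ioo 0 h, q (atHeight t y)

section VerticalIntegral

variable {h : ℝ} {q : E3 → ℂ}

lemma integral_mul_verticalIntegral (hq : IntegrableOn q (Omega h)) {ψ : ℝ × ℝ → ℂ}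
    (hψ : Continuous ψ) {M : ℝ} (hM : ∀ y, ‖ψ y‖ ≤ M) :
    ∫ y in cell, ψ y * verticalIntegral h q y = ∫ x in Omega h, ψ (x 0, x 1) * q x := by
  rw [integral_Omega_eq]
  have h1 : Integrable (fun p : ℝ × ℝ × ℝ => ψ p.2 * q (atHeight p.1 p.2))
      ((volume.restrict (Ioo 0 h)).prod cellMeasure) :=
    (integrable_slab_iff.2 hq).bdd_mul (c := M)
      (hψ.comp continuous_snd).aestronglyMeasurable (Filter.Eventually.of_forall fun p => hM _)
  rw [integral_prod_symm _ (by simpa [atHeight] using h1)]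
  refine integral_congr_ae (Filter.Eventually.of_forall fun y => ?_)
  simp only [verticalIntegral]
  rw [← integral_const_mul]
  simp [atHeight]

lemma fourierCoef_verticalIntegral (hq : IntegrableOn q (Omega h)) (n : ℤ × ℤ) :
    fourierCoef (verticalIntegral h q) n = ∫ t in Ioo 0 h, coefAt q n t := by
  have h1 := integral_mul_character hq n (χ := fun _ => 1) continuous_const (M := 1) (by simp)
  have h2 := integral_mul_verticalIntegral hq (continuous_character n) (fun y => (norm_character n y).le)
  simp only [one_mul] at h1
  rw [h1, fourierCoef_eq]
  congr 1
  simp only [mul_comm (q _)]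
  rw [← h2]
  simp only [mul_comm]

/-- Cauchy–Schwarz on each vertical line costs a factor `h`; Tonelli then integrates over the cell.
-/
lemma memLp_verticalIntegral (hq : MemLp q 2 (volume.restrict (Omega h))) :
    MemLp (verticalIntegral h q) 2 cellMeasure := by
  have hsl := aestronglyMeasurable_slab hq.1
  have hm : AEStronglyMeasurable (verticalIntegral h q) cellMeasure :=
    hsl.prod_swap.integral_prod_right'
  have hfin := lintegral_enorm_sq_lt_top hq
  rw [lintegral_Omega_eq (hq.1.enorm.pow_const 2), lintegral_lintegral_swap
    (f := fun t y => ‖q (atHeight t y)‖ₑ ^ 2) (hsl.enorm.pow_const 2)] at hfin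
  refine memLp_two_of_lintegral hm (lt_of_le_of_lt (lintegral_mono_ae (g := fun y =>
    ENNReal.ofReal h * ∫⁻ t in Ioo 0 h, ‖q (atHeight t y)‖ₑ ^ 2) ?_) ?_)
  · filter_upwards [hsl.prod_swap.prodMk_left] with y hy
    have hy' : AEStronglyMeasurable (fun t => q (atHeight t y)) (volume.restrict (Ioo 0 h)) := hy
    have h1 : ‖verticalIntegral h q y‖ₑ ≤ ∫⁻ t in Ioo 0 h, ‖q (atHeight t y)‖ₑ :=
      enorm_integral_le_lintegral_enorm _
    have h2 := eLpNorm_le_eLpNorm_mul_rpow_measure_univ (p := 1) (q := 2) (by norm_num) hy'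
    rw [eLpNorm_one_eq_lintegral_enorm, eLpNorm_eq_lintegral_rpow_enorm_toReal (by norm_num) (by norm_num),
      Measure.restrict_apply_univ, Real.volume_Ioo, sub_zero] at h2
    refine (pow_le_pow_left' (h1.trans h2) 2).trans (le_of_eq ?_)
    rw [mul_pow, ← ENNReal.rpow_natCast, ← ENNReal.rpow_natCast, ← ENNReal.rpow_mul,
      ← ENNReal.rpow_mul, mul_comm]
    norm_num
  · rw [lintegral_const_mul' _ _ ENNReal.ofReal_ne_top]
    exact ENNReal.mul_lt_top ENNReal.ofReal_lt_top hfin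

end VerticalIntegral

/-! ### Traces -/

/-- The vertical derivative of `θ(x₃) f(x)`. -/
def cutDeriv (h : ℝ) (θ : ℝ → ℝ) (f : E3 → ℂ) (x : E3) : ℂ :=
  ((deriv θ (x 2) : ℝ) : ℂ) * f x + (θ (x 2) : ℂ) * weakDeriv (Omega h) 2 f x

section CutDeriv

variable {h : ℝ} {f : E3 → ℂ} {θ : ℝ → ℝ}

lemma continuous_coord (i : Fin 3) : Continuous fun x : E3 => x i := (contDiff_coord i).continuous

lemma memLp_bdd_mul {μ : Measure E3} {a : E3 → ℂ} {g : E3 → ℂ} (hg : MemLp g 2 μ)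
    (ha : Continuous a) {M : ℝ} (hM : ∀ x, ‖a x‖ ≤ M) : MemLp (fun x => a x * g x) 2 μ :=
  hg.mul' (memLp_top_of_bound ha.aestronglyMeasurable M (Filter.Eventually.of_forall hM))

lemma memLp_cutDeriv (hf : MemH1 (Omega h) f) (h1 : ContDiff ℝ ∞ θ) (h2 : HasCompactSupport θ) :
    MemLp (cutDeriv h θ f) 2 (volume.restrict (Omega h)) := by
  obtain ⟨M, hM⟩ := h2.exists_bound_of_continuous h1.continuous
  have h1' : Continuous (deriv θ) := (contDiff_infty_iff_deriv.1 h1).2.continuous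
  obtain ⟨M', hM'⟩ := h2.deriv.exists_bound_of_continuous h1'
  refine MemLp.add (memLp_bdd_mul (M := M') hf.1
    (Complex.continuous_ofReal.comp (h1'.comp (continuous_coord 2))) fun x => ?_)
    (memLp_bdd_mul (M := M) (hf.memLp_weakDeriv (isOpen_Omega h) 2)
    (Complex.continuous_ofReal.comp (h1.continuous.comp (continuous_coord 2))) fun x => ?_)
  · simpa using hM' (x 2)
  · simpa using hM (x 2)

/-- The Fourier coefficients of the vertical integral of `∂(θ f)/∂x₃`. -/
lemma MemH1p.fourierCoef_verticalIntegral_cutDeriv (hf : MemH1p h f) (hh : 0 < h)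
    (h1 : ContDiff ℝ ∞ θ) (h2 : HasCompactSupport θ) {n : ℤ × ℤ} {b : ℝ → ℂ}
    (hb : IsPrimitiveOn h (coefAt (weakDeriv (Omega h) 2 f) n) b)
    (hfb : ∀ᵐ t ∂volume.restrict (Ioo 0 h), coefAt f n t = b t) :
    fourierCoef (verticalIntegral h (cutDeriv h θ f)) n = θ h * b h - θ 0 * b 0 := by
  obtain ⟨M, hM⟩ := h2.exists_bound_of_continuous h1.continuous
  have h1' : Continuous (deriv θ) := (contDiff_infty_iff_deriv.1 h1).2.continuous
  obtain ⟨M', hM'⟩ := h2.deriv.exists_bound_of_continuous h1'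
  have hθ : IsPrimitiveOn h (fun t => ((deriv θ t : ℝ) : ℂ)) (fun t => (θ t : ℂ)) :=
    .of_hasDerivAt (fun t => ((h1.differentiable (by simp)) t).hasDerivAt.ofReal_comp)
      (Complex.continuous_ofReal.comp h1')
  rw [fourierCoef_verticalIntegral ((memLp_cutDeriv hf.1 h1 h2).integrable (by norm_num)),
    ← hθ.integral_mul hb hh.le]
  have i1 : IntegrableOn (fun x : E3 => ((deriv θ (x 2) : ℝ) : ℂ) * f x) (Omega h) :=
    Integrable.bdd_mul (c := M') hf.integrableOn
      (Complex.continuous_ofReal.comp (h1'.comp (continuous_coord 2))).aestronglyMeasurable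
      (Filter.Eventually.of_forall fun x => by simpa using hM' (x 2))
  have i2 : IntegrableOn (fun x : E3 => (θ (x 2) : ℂ) * weakDeriv (Omega h) 2 f x) (Omega h) :=
    Integrable.bdd_mul (c := M) (hf.integrableOn_weakDeriv 2)
      (Complex.continuous_ofReal.comp
        (h1.continuous.comp (continuous_coord 2))).aestronglyMeasurable
      (Filter.Eventually.of_forall fun x => by simpa using hM (x 2))
  have vert : ∀ (c : ℝ → ℂ) (g : E3 → ℂ) (t : ℝ),
      coefAt (fun x => c (x 2) * g x) n t = c t * coefAt g n t := by
    intro c g t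
    rw [← coefAt_const_mul]
    simp [coefAt, atHeight]
  refine integral_congr_ae ?_
  filter_upwards [coefAt_add_ae i1 i2 n, hfb] with t ht hbt
  change coefAt (fun x => _ + _) n t = _
  rw [ht, vert (fun t => ((deriv θ t : ℝ) : ℂ)), vert (fun t => (θ t : ℂ)), hbt]

lemma fderiv_unitVec_of_hasDerivAt {u : E3 → ℝ} (hu : ContDiff ℝ ∞ u) {j : Fin 3} {x : E3} {v : ℝ}
    (hv : HasDerivAt (fun s : ℝ => u (x + s • unitVec j)) v 0) :
    fderiv ℝ u x (unitVec j) = v :=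
  ((hu.differentiable (by simp) x).hasFDerivAt.hasLineDerivAt (unitVec j)).unique hv

lemma contDiff_horizontal : ContDiff ℝ ∞ (fun x : E3 => (x 0, x 1)) :=
  (contDiff_coord 0).prodMk (contDiff_coord 1)

lemma fderiv_horizontal_mul {ψ : ℝ × ℝ → ℝ} (hψ : ContDiff ℝ ∞ ψ) (h1 : ContDiff ℝ ∞ θ) (x : E3) :
    fderiv ℝ (fun x : E3 => ψ (x 0, x 1) * θ (x 2)) x (unitVec 2) =
      ψ (x 0, x 1) * deriv θ (x 2) := by
  have hd : HasDerivAt (fun s : ℝ => θ (x 2 + s)) (deriv θ (x 2)) 0 :=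
    HasDerivAt.comp_const_add (x 2) 0
      (by simpa using (h1.differentiable (by simp) (x 2 + 0)).hasDerivAt)
  refine fderiv_unitVec_of_hasDerivAt
    ((hψ.comp contDiff_horizontal).mul (h1.comp (contDiff_coord 2)))
    ((hd.const_mul (ψ (x 0, x 1))).congr_of_eventuallyEq
      (Filter.Eventually.of_forall fun s => ?_))
  simp [unitVec_apply]

/-- For a product test function the volume side of Green's formula is already a pairing of `ψ` with
a function on the cell. That function is the candidate for the trace when `θ` is one on the face
considered and vanishes near the opposite one. -/
lemma integral_smul_verticalIntegral_cutDeriv (hf : MemH1 (Omega h) f) (h1 : ContDiff ℝ ∞ θ)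
    (h2 : HasCompactSupport θ) {ψ : ℝ × ℝ → ℝ} (hψ : ContDiff ℝ ∞ ψ) (hc : HasCompactSupport ψ) :
    ∫ x in Omega h, (fderiv ℝ (fun x : E3 => ψ (x 0, x 1) * θ (x 2)) x (unitVec 2) • f x +
      (ψ (x 0, x 1) * θ (x 2)) • weakDeriv (Omega h) 2 f x) =
      ∫ y in cell, ψ y • verticalIntegral h (cutDeriv h θ f) y := by
  obtain ⟨M, hM⟩ := hc.exists_bound_of_continuous hψ.continuous
  have := integral_mul_verticalIntegral ((memLp_cutDeriv hf h1 h2).integrable (by norm_num))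
    (ψ := fun y => (ψ y : ℂ)) (Complex.continuous_ofReal.comp hψ.continuous) (M := M)
    (fun y => by simpa using hM y)
  simp only [Complex.real_smul]
  rw [this]
  refine integral_congr_ae (Filter.Eventually.of_forall fun x => ?_)
  simp only [fderiv_horizontal_mul hψ h1, cutDeriv]
  push_cast
  ring

lemma isBounded_box {I J K : Set ℝ} (hI : Bornology.IsBounded I) (hJ : Bornology.IsBounded J)
    (hK : Bornology.IsBounded K) : Bornology.IsBounded (box I J K) := by
  obtain ⟨a, ha⟩ := hI.exists_norm_le
  obtain ⟨b, hb⟩ := hJ.exists_norm_le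
  obtain ⟨c, hc⟩ := hK.exists_norm_le
  refine isBounded_iff_forall_norm_le.2 ⟨a + b + c, fun x hx => (norm_le_sum_coord x).trans ?_⟩
  have h0 := ha _ hx.1
  have h1 := hb _ hx.2.1
  have h2 := hc _ hx.2.2
  rw [Real.norm_eq_abs] at h0 h1 h2
  linarith

lemma tsupport_horizontal_mul_subset (ψ : ℝ × ℝ → ℝ) (θ : ℝ → ℝ) :
    tsupport (fun x : E3 => ψ (x 0, x 1) * θ (x 2)) ⊆
      {x | (x 0, x 1) ∈ tsupport ψ ∧ x 2 ∈ tsupport θ} := by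
  refine closure_minimal (fun x hx => ?_)
    (((isClosed_tsupport ψ).preimage contDiff_horizontal.continuous).inter
      ((isClosed_tsupport θ).preimage (continuous_coord 2)))
  rw [Function.mem_support, mul_ne_zero_iff] at hx
  exact ⟨subset_tsupport _ hx.1, subset_tsupport _ hx.2⟩

lemma hasCompactSupport_horizontal_mul {ψ : ℝ × ℝ → ℝ} (hψ : tsupport ψ ⊆ cell)
    (h2 : HasCompactSupport θ) : HasCompactSupport (fun x : E3 => ψ (x 0, x 1) * θ (x 2)) := by
  refine Metric.isCompact_of_isClosed_isBounded (isClosed_tsupport _)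
    ((isBounded_box (Metric.isBounded_Ioo 0 (2 * Real.pi)) (Metric.isBounded_Ioo 0 (2 * Real.pi))
      (IsCompact.isBounded h2)).subset ((tsupport_horizontal_mul_subset ψ θ).trans fun x hx => ?_))
  exact ⟨(hψ hx.1).1, (hψ hx.1).2, hx.2⟩

lemma isOpen_cell : IsOpen cell := isOpen_Ioo.prod isOpen_Ioo

lemma ae_eq_of_integral_smul_cell {g g' : ℝ × ℝ → ℂ} (hg : MemLp g 2 cellMeasure)
    (hg' : MemLp g' 2 cellMeasure)
    (H : ∀ ψ : ℝ × ℝ → ℝ, ContDiff ℝ ∞ ψ → HasCompactSupport ψ → tsupport ψ ⊆ cell →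
      ∫ y in cell, ψ y • g y = ∫ y in cell, ψ y • g' y) :
    ∀ᵐ y ∂cellMeasure, g y = g' y := by
  have ig : Integrable g cellMeasure := hg.integrable (by norm_num)
  have ig' : Integrable g' cellMeasure := hg'.integrable (by norm_num)
  have := isOpen_cell.ae_eq_zero_of_integral_contDiff_smul_eq_zero
    (μ := cellMeasure) (f := fun t => g t - g' t)
    ((ig.sub ig').integrableOn.locallyIntegrableOn) (by
      intro χ h1 h2 h3
      obtain ⟨M, hM⟩ := h2.exists_bound_of_continuous h1.continuous
      have ia : Integrable (fun t => χ t • g t) cellMeasure :=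
        ig.bdd_smul M h1.continuous.aestronglyMeasurable (Filter.Eventually.of_forall hM)
      have ib : Integrable (fun t => χ t • g' t) cellMeasure :=
        ig'.bdd_smul M h1.continuous.aestronglyMeasurable (Filter.Eventually.of_forall hM)
      simp only [smul_sub]
      rw [integral_sub ia ib, H χ h1 h2 h3, sub_self])
  filter_upwards [this, ae_restrict_mem isOpen_cell.measurableSet] with t h1 h2
  exact sub_eq_zero.1 (h1 h2)

/-- Product test functions alone determine the trace, so every trace, including the chosen one,
equals this explicit vertical integral. -/
lemma IsTraceTop.ae_eq {g : ℝ × ℝ → ℂ} (hg : IsTraceTop h f g) (hf : MemH1 (Omega h) f)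
    (h1 : ContDiff ℝ ∞ θ) (h2 : HasCompactSupport θ) (h3 : tsupport θ ⊆ Ioi 0) (h4 : θ h = 1) :
    ∀ᵐ y ∂cellMeasure, g y = verticalIntegral h (cutDeriv h θ f) y := by
  refine ae_eq_of_integral_smul_cell hg.1 (memLp_verticalIntegral (memLp_cutDeriv hf h1 h2))
    fun ψ p1 p2 p3 => ?_
  rw [← integral_smul_verticalIntegral_cutDeriv hf h1 h2 p1 p2]
  have := hg.2 (fun x : E3 => ψ (x 0, x 1) * θ (x 2))
    ((p1.comp contDiff_horizontal).mul (h1.comp (contDiff_coord 2)))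
    (hasCompactSupport_horizontal_mul p3 h2)
    ((tsupport_horizontal_mul_subset ψ θ).trans fun x hx => ⟨(p3 hx.1).1, (p3 hx.1).2, h3 hx.2⟩)
  rw [this]
  simp [atHeight, h4]

lemma IsTraceBottom.ae_eq_zero (hg : IsTraceBottom h f 0) (hf : MemH1 (Omega h) f)
    (h1 : ContDiff ℝ ∞ θ) (h2 : HasCompactSupport θ) (h3 : tsupport θ ⊆ Iio h) :
    ∀ᵐ y ∂cellMeasure, verticalIntegral h (cutDeriv h θ f) y = 0 := by
  refine ae_eq_of_integral_smul_cell (g' := fun _ => 0)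
    (memLp_verticalIntegral (memLp_cutDeriv hf h1 h2)) MemLp.zero' fun ψ p1 p2 p3 => ?_
  rw [← integral_smul_verticalIntegral_cutDeriv hf h1 h2 p1 p2]
  have := hg.2 (fun x : E3 => ψ (x 0, x 1) * θ (x 2))
    ((p1.comp contDiff_horizontal).mul (h1.comp (contDiff_coord 2)))
    (hasCompactSupport_horizontal_mul p3 h2)
    ((tsupport_horizontal_mul_subset ψ θ).trans fun x hx => ⟨(p3 hx.1).1, (p3 hx.1).2, h3 hx.2⟩)
  rw [this]
  simp

end CutDeriv

/-! ### Existence of the trace on `Γ_h` -/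

lemma deriv_smoothTransition_of_one_lt {s : ℝ} (hs : 1 < s) : deriv Real.smoothTransition s = 0 := by
  have : Real.smoothTransition =ᶠ[nhds s] fun _ => 1 := by
    filter_upwards [lt_mem_nhds hs] with r hr using Real.smoothTransition.one_of_one_le hr.le
  rw [this.deriv_eq, deriv_const]

lemma deriv_smoothTransition_of_neg {s : ℝ} (hs : s < 0) : deriv Real.smoothTransition s = 0 := by
  have : Real.smoothTransition =ᶠ[nhds s] fun _ => 0 := by
    filter_upwards [gt_mem_nhds hs] with r hr using Real.smoothTransition.zero_of_nonpos hr.le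
  rw [this.deriv_eq, deriv_const]

lemma exists_bound_deriv_smoothTransition : ∃ M, 0 ≤ M ∧ ∀ s, |deriv Real.smoothTransition s| ≤ M := by
  have hc : Continuous (deriv Real.smoothTransition) :=
    (contDiff_infty_iff_deriv.1 (Real.smoothTransition.contDiff (n := (⊤ : ℕ∞)))).2.continuous
  obtain ⟨M, hM⟩ := (isCompact_Icc (a := (0 : ℝ)) (b := 1)).exists_bound_of_continuousOn
    hc.continuousOn
  refine ⟨M, (norm_nonneg _).trans (hM 0 (by simp)), fun s => ?_⟩
  rcases lt_or_ge s 0 with h0 | h0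
  · rw [deriv_smoothTransition_of_neg h0, abs_zero]
    exact (norm_nonneg _).trans (hM 0 (by simp))
  rcases lt_or_ge 1 s with h1 | h1
  · rw [deriv_smoothTransition_of_one_lt h1, abs_zero]
    exact (norm_nonneg _).trans (hM 0 (by simp))
  · exact hM s ⟨h0, h1⟩

/-- A smooth cutoff that vanishes for `h - t ≤ 1 / (m + 1)` and is one for `h - t ≥ 2 / (m + 1)`. -/
def topCutoff (h : ℝ) (m : ℕ) (t : ℝ) : ℝ := Real.smoothTransition ((m + 1) * (h - t) - 1)

section TopCutoff

variable {h : ℝ} {m : ℕ} {t : ℝ}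

lemma contDiff_topCutoff (h : ℝ) (m : ℕ) : ContDiff ℝ ∞ (topCutoff h m) :=
  Real.smoothTransition.contDiff.comp (by fun_prop)

lemma deriv_topCutoff (h : ℝ) (m : ℕ) (t : ℝ) : deriv (topCutoff h m) t =
    -((m + 1) * deriv Real.smoothTransition ((m + 1) * (h - t) - 1)) := by
  have h1 : HasDerivAt (fun t : ℝ => ((m : ℝ) + 1) * (h - t) - 1) (-((m : ℝ) + 1)) t := by
    have := (((hasDerivAt_id t).const_sub h).const_mul ((m : ℝ) + 1)).sub_const 1
    simpa using this
  have h2 := ((Real.smoothTransition.contDiff (n := (⊤ : ℕ∞))).differentiable (by simp)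
    ((m + 1) * (h - t) - 1)).hasDerivAt.comp t h1
  rw [show topCutoff h m = Real.smoothTransition ∘ fun t : ℝ => ((m : ℝ) + 1) * (h - t) - 1 from rfl,
    h2.deriv]
  ring

lemma abs_topCutoff_le : |topCutoff h m t| ≤ 1 := by
  rw [topCutoff, abs_of_nonneg (Real.smoothTransition.nonneg _)]
  exact Real.smoothTransition.le_one _

/-- The derivative is of size `m + 1`, but it lives where `(m + 1) (h - t) ≤ 2`; the distance to the
top compensates the growth uniformly in `m`. -/
lemma abs_deriv_topCutoff_mul_le {M : ℝ} (hM0 : 0 ≤ M)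
    (hM : ∀ s, |deriv Real.smoothTransition s| ≤ M) (ht : t ≤ h) :
    |deriv (topCutoff h m) t| * (h - t) ≤ 2 * M := by
  rw [deriv_topCutoff, abs_neg, abs_mul, abs_of_pos (by positivity : (0 : ℝ) < m + 1)]
  rcases lt_or_ge 2 ((m + 1) * (h - t)) with h1 | h1
  · rw [deriv_smoothTransition_of_one_lt (by linarith)]
    simp [hM0]
  · have h0 : 0 ≤ (m + 1) * (h - t) := mul_nonneg (by positivity) (by linarith)
    calc _ = ((m + 1) * (h - t)) * |deriv Real.smoothTransition ((m + 1) * (h - t) - 1)| := by ring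
      _ ≤ 2 * M := mul_le_mul h1 (hM _) (abs_nonneg _) (by norm_num)

lemma eventually_two_lt (ht : t < h) : ∀ᶠ m : ℕ in Filter.atTop, 2 < ((m : ℝ) + 1) * (h - t) := by
  have h1 : Filter.Tendsto (fun m : ℕ => ((m : ℝ) + 1) * (h - t)) Filter.atTop Filter.atTop :=
    (Filter.tendsto_atTop_add_const_right _ _ tendsto_natCast_atTop_atTop).atTop_mul_const
      (by linarith)
  exact h1.eventually_gt_atTop 2

lemma eventually_topCutoff (ht : t < h) :
    ∀ᶠ m : ℕ in Filter.atTop, topCutoff h m t = 1 ∧ deriv (topCutoff h m) t = 0 := by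
  filter_upwards [eventually_two_lt ht] with m hm
  refine ⟨Real.smoothTransition.one_of_one_le (by linarith), ?_⟩
  rw [deriv_topCutoff, deriv_smoothTransition_of_one_lt (by linarith)]
  simp

end TopCutoff

section TraceTop

variable {h : ℝ} {f : E3 → ℂ} {θ : ℝ → ℝ}

lemma norm_sub_atHeight_le (x : E3) (h : ℝ) : ‖x - atHeight h (x 0, x 1)‖ ≤ |x 2 - h| := by
  refine (norm_le_sum_coord _).trans (le_of_eq ?_)
  simp [atHeight]

/-- Green's formula for test functions that vanish on `Γ_h`. -/
lemma MemH1.integral_eq_zero_of_vanishing (hf : MemH1 (Omega h) f) {χ : E3 → ℝ}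
    (h1 : ContDiff ℝ ∞ χ) (h2 : HasCompactSupport χ)
    (h3 : tsupport χ ⊆ {x | x 0 ∈ Ioo 0 (2 * Real.pi) ∧ x 1 ∈ Ioo 0 (2 * Real.pi) ∧ 0 < x 2})
    (h4 : ∀ y, χ (atHeight h y) = 0) :
    ∫ x in Omega h, (fderiv ℝ χ x (unitVec 2) • f x + χ x • weakDeriv (Omega h) 2 f x) = 0 := by
  have hΩ := (isOpen_Omega h).measurableSet
  set D := weakDeriv (Omega h) 2 f with hD
  have hfi : IntegrableOn f (Omega h) := hf.1.integrable (by norm_num)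
  have hDi : IntegrableOn D (Omega h) :=
    (hf.memLp_weakDeriv (isOpen_Omega h) 2).integrable (by norm_num)
  -- Being Lipschitz and zero at height `h`, `χ` is at most `K (h - x₃)`. This supplies the decay
  -- that dominates the derivative of the cutoff.
  obtain ⟨K, hK⟩ := h1.lipschitzWith_of_hasCompactSupport h2 (by simp)
  have hχ : ∀ x ∈ Omega h, |χ x| ≤ K * (h - x 2) := by
    intro x hx
    have := hK.norm_sub_le x (atHeight h (x 0, x 1))
    rw [h4, sub_zero, Real.norm_eq_abs] at this
    refine this.trans (mul_le_mul_of_nonneg_left ((norm_sub_atHeight_le x h).trans ?_) K.2)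
    rw [abs_sub_comm, abs_of_pos (by linarith [hx.2.2.2])]
  obtain ⟨M, hM0, hM⟩ := exists_bound_deriv_smoothTransition
  obtain ⟨C, hC⟩ := h2.exists_bound_of_continuous h1.continuous
  have hdc : Continuous (fun x => fderiv ℝ χ x (unitVec 2)) :=
    (h1.continuous_fderiv (by simp)).clm_apply continuous_const
  obtain ⟨C', hC'⟩ := (h2.fderiv_apply ℝ (unitVec 2)).exists_bound_of_continuous hdc
  -- Each `T m` is supported inside `Ω`, so the weak derivative identity makes its integral zero;
  -- dominated convergence passes this to `χ`.
  set T : ℕ → E3 → ℝ := fun m x => χ x * topCutoff h m (x 2) with hT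
  have hTs : ∀ m, ContDiff ℝ ∞ (T m) := fun m =>
    h1.mul ((contDiff_topCutoff h m).comp (contDiff_coord 2))
  have hTsub : ∀ m, tsupport (T m) ⊆ tsupport χ := fun m =>
    closure_mono fun x hx => left_ne_zero_of_mul hx
  have hTc : ∀ m, HasCompactSupport (T m) := fun m =>
    h2.mono' ((subset_tsupport _).trans (hTsub m))
  have hTΩ : ∀ m, tsupport (T m) ⊆ Omega h := by
    intro m x hx
    have hx1 := h3 (hTsub m hx)
    have hx2 : tsupport (T m) ⊆ {x : E3 | 1 ≤ ((m : ℝ) + 1) * (h - x 2)} := by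
      refine closure_minimal (fun x hx => ?_) (isClosed_le continuous_const
        (continuous_const.mul (continuous_const.sub (continuous_coord 2))))
      by_contra hcon
      refine right_ne_zero_of_mul hx (Real.smoothTransition.zero_of_nonpos ?_)
      rw [mem_ofPred_eq, not_le] at hcon
      linarith
    refine ⟨hx1.1, hx1.2.1, hx1.2.2, ?_⟩
    have h5 : 0 < ((m : ℝ) + 1) * (h - x 2) := lt_of_lt_of_le one_pos (hx2 hx)
    have := pos_of_mul_pos_right h5 (by positivity)
    linarith
  have hTd : ∀ m x, fderiv ℝ (T m) x (unitVec 2) =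
      fderiv ℝ χ x (unitVec 2) * topCutoff h m (x 2) + χ x * deriv (topCutoff h m) (x 2) := by
    intro m x
    have d1 : HasDerivAt (fun s : ℝ => χ (x + s • unitVec 2)) (fderiv ℝ χ x (unitVec 2)) 0 :=
      (h1.differentiable (by simp) x).hasFDerivAt.hasLineDerivAt (unitVec 2)
    have d2 : HasDerivAt (fun s : ℝ => topCutoff h m (x 2 + s)) (deriv (topCutoff h m) (x 2)) 0 :=
      HasDerivAt.comp_const_add (x 2) 0
        (by simpa using ((contDiff_topCutoff h m).differentiable (by simp) (x 2 + 0)).hasDerivAt)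
    refine fderiv_unitVec_of_hasDerivAt (hTs m) (((d1.mul d2).congr_of_eventuallyEq
      (Filter.Eventually.of_forall fun s => ?_)).congr_deriv ?_)
    · simp [hT, unitVec_apply]
    · simp
  have hzero : ∀ m, ∫ x in Omega h,
      (fderiv ℝ (T m) x (unitVec 2) • f x + T m x • D x) = 0 := by
    intro m
    have hw := hf.isWeakDeriv 2
    have i1 := integrable_smul_of_tsupport_subset hΩ hw.1
      (((hTs m).continuous_fderiv (by simp)).clm_apply continuous_const)
      ((hTc m).fderiv_apply ℝ (unitVec 2))
      ((tsupport_fderiv_apply_subset ℝ (unitVec 2)).trans (hTΩ m))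
    have i2 := integrable_smul_of_tsupport_subset hΩ hw.2.1 (hTs m).continuous (hTc m) (hTΩ m)
    rw [integral_add i1 i2, hw.2.2 _ (hTs m) (hTc m) (hTΩ m), neg_add_cancel]
  have hlim : Filter.Tendsto (fun m => ∫ x in Omega h,
      (fderiv ℝ (T m) x (unitVec 2) • f x + T m x • D x)) Filter.atTop
      (nhds (∫ x in Omega h, (fderiv ℝ χ x (unitVec 2) • f x + χ x • D x))) := by
    refine tendsto_integral_of_dominated_convergence
      (fun x => (C' + 2 * M * K) * ‖f x‖ + C * ‖D x‖) (fun m => ?_)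
      ((hfi.norm.const_mul _).add (hDi.norm.const_mul _)) (fun m => ?_) ?_
    · exact ((((hTs m).continuous_fderiv (by simp)).clm_apply
        continuous_const).aestronglyMeasurable.smul hfi.1).add
        ((hTs m).continuous.aestronglyMeasurable.smul hDi.1)
    · filter_upwards [ae_restrict_mem hΩ] with x hx
      refine (norm_add_le _ _).trans (add_le_add ?_ ?_)
      · rw [norm_smul]
        refine mul_le_mul_of_nonneg_right ?_ (norm_nonneg _)
        rw [hTd]
        refine (norm_add_le _ _).trans (add_le_add ?_ ?_)
        · rw [norm_mul]
          refine (mul_le_of_le_one_right (norm_nonneg _) abs_topCutoff_le).trans (hC' x)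
        · rw [norm_mul, Real.norm_eq_abs, Real.norm_eq_abs]
          calc |χ x| * |deriv (topCutoff h m) (x 2)|
              ≤ (K * (h - x 2)) * |deriv (topCutoff h m) (x 2)| :=
                mul_le_mul_of_nonneg_right (hχ x hx) (abs_nonneg _)
            _ = K * (|deriv (topCutoff h m) (x 2)| * (h - x 2)) := by ring
            _ ≤ K * (2 * M) := mul_le_mul_of_nonneg_left
                (abs_deriv_topCutoff_mul_le hM0 hM hx.2.2.2.le) K.2
            _ = 2 * M * K := by ring
      · rw [norm_smul]
        refine mul_le_mul_of_nonneg_right ?_ (norm_nonneg _)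
        rw [norm_mul]
        exact (mul_le_of_le_one_right (norm_nonneg _) abs_topCutoff_le).trans (hC x)
    · filter_upwards [ae_restrict_mem hΩ] with x hx
      refine tendsto_const_nhds.congr' ?_
      filter_upwards [eventually_topCutoff hx.2.2.2] with m hm
      simp only [hTd, hm.1, hm.2]
      simp [hT, hm.1]
  simp only [hzero] at hlim
  exact (tendsto_nhds_unique hlim tendsto_const_nhds)

lemma contDiff_atHeight (h : ℝ) : ContDiff ℝ ∞ (atHeight h) := by
  rw [contDiff_euclidean]
  intro i
  fin_cases i
  · exact contDiff_fst
  · exact contDiff_snd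
  · exact contDiff_const

/-- Existence of the trace on `Γ_h`. -/
lemma MemH1.isTraceTop (hf : MemH1 (Omega h) f) (h1 : ContDiff ℝ ∞ θ) (h2 : HasCompactSupport θ)
    (h3 : tsupport θ ⊆ Ioi 0) (h4 : θ h = 1) :
    IsTraceTop h f (verticalIntegral h (cutDeriv h θ f)) := by
  refine ⟨memLp_verticalIntegral (memLp_cutDeriv hf h1 h2), fun φ p1 p2 p3 => ?_⟩
  set ψ : ℝ × ℝ → ℝ := fun y => φ (atHeight h y) with hψ
  have hψs : ContDiff ℝ ∞ ψ := p1.comp (contDiff_atHeight h)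
  have hψt : tsupport ψ ⊆ atHeight h ⁻¹' tsupport φ :=
    closure_minimal (fun y hy => subset_tsupport _ hy)
      ((isClosed_tsupport φ).preimage (contDiff_atHeight h).continuous)
  have hψcell : tsupport ψ ⊆ cell := fun y hy =>
    ⟨(p3 (hψt hy)).1, (p3 (hψt hy)).2.1⟩
  have hψc : HasCompactSupport ψ := Metric.isCompact_of_isClosed_isBounded (isClosed_tsupport _)
    (((Metric.isBounded_Ioo _ _).prod (Metric.isBounded_Ioo _ _)).subset hψcell)
  have hps : ContDiff ℝ ∞ (fun x : E3 => ψ (x 0, x 1) * θ (x 2)) :=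
    (hψs.comp contDiff_horizontal).mul (h1.comp (contDiff_coord 2))
  have hpc : HasCompactSupport (fun x : E3 => ψ (x 0, x 1) * θ (x 2)) :=
    hasCompactSupport_horizontal_mul hψcell h2
  -- A general test function differs from the product having the same values on the top face by one
  -- that vanishes there, for which Green's formula has no boundary term.
  set χ : E3 → ℝ := fun x => φ x - ψ (x 0, x 1) * θ (x 2) with hχ
  have hχs : ContDiff ℝ ∞ χ := p1.sub hps
  have hχc : HasCompactSupport χ := p2.sub hpc
  have hχt : tsupport χ ⊆ tsupport φ ∪ tsupport (fun x : E3 => ψ (x 0, x 1) * θ (x 2)) := by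
    refine closure_minimal (fun x hx => ?_) ((isClosed_tsupport _).union (isClosed_tsupport _))
    by_contra hcon
    rw [mem_union, not_or] at hcon
    refine hx ?_
    simp only [hχ]
    rw [image_eq_zero_of_notMem_tsupport hcon.1]
    have := image_eq_zero_of_notMem_tsupport hcon.2
    simp only at this
    rw [this, sub_zero]
  have hz := hf.integral_eq_zero_of_vanishing hχs hχc (hχt.trans (union_subset p3
    ((tsupport_horizontal_mul_subset ψ θ).trans fun x hx =>
      ⟨(hψcell hx.1).1, (hψcell hx.1).2, h3 hx.2⟩))) (fun y => by
        simp [hχ, hψ, atHeight, h4])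
  have hg := integral_smul_verticalIntegral_cutDeriv hf h1 h2 hψs hψc
  have hd : ∀ x, fderiv ℝ χ x (unitVec 2) = fderiv ℝ φ x (unitVec 2) -
      fderiv ℝ (fun x : E3 => ψ (x 0, x 1) * θ (x 2)) x (unitVec 2) := fun x => by
    rw [hχ, fderiv_fun_sub (p1.differentiable (by simp) x) (hps.differentiable (by simp) x)]
    rfl
  have hfi : IntegrableOn f (Omega h) := hf.1.integrable (by norm_num)
  have hDi : IntegrableOn (weakDeriv (Omega h) 2 f) (Omega h) :=
    (hf.memLp_weakDeriv (isOpen_Omega h) 2).integrable (by norm_num)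
  have int : ∀ u : E3 → ℝ, ContDiff ℝ ∞ u → HasCompactSupport u → IntegrableOn
      (fun x => fderiv ℝ u x (unitVec 2) • f x + u x • weakDeriv (Omega h) 2 f x) (Omega h) := by
    intro u u1 u2
    have uc : Continuous (fun x => fderiv ℝ u x (unitVec 2)) :=
      (u1.continuous_fderiv (by simp)).clm_apply continuous_const
    obtain ⟨C, hC⟩ := u2.exists_bound_of_continuous u1.continuous
    obtain ⟨C', hC'⟩ := (u2.fderiv_apply ℝ (unitVec 2)).exists_bound_of_continuous uc
    exact (hfi.bdd_smul C' uc.aestronglyMeasurable (Filter.Eventually.of_forall hC')).add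
      (hDi.bdd_smul C u1.continuous.aestronglyMeasurable (Filter.Eventually.of_forall hC))
  rw [← hg, ← sub_eq_zero, ← integral_sub (int φ p1 p2) (int _ hps hpc), ← hz]
  refine integral_congr_ae (Filter.Eventually.of_forall fun x => ?_)
  simp only [hd]
  simp only [hχ, sub_smul]
  abel

/-- The Fourier coefficients of the trace on `Γ_h` are the boundary values of the Fourier
coefficients on horizontal planes. -/
lemma MemH1p.fourierCoef_traceTop (hf : MemH1p h f) (hh : 0 < h) {n : ℤ × ℤ} {b : ℝ → ℂ}
    (hb : IsPrimitiveOn h (coefAt (weakDeriv (Omega h) 2 f) n) b)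
    (hfb : ∀ᵐ t ∂volume.restrict (Ioo 0 h), coefAt f n t = b t) :
    fourierCoef (traceTop h f) n = b h := by
  let θ : ContDiffBump h := ⟨h / 4, h / 2, by positivity, by linarith⟩
  have h1 : ContDiff ℝ ∞ θ := θ.contDiff
  have h2 : HasCompactSupport θ := θ.hasCompactSupport
  have h3 : tsupport θ ⊆ Ioi 0 := by
    rw [θ.tsupport_eq, Real.closedBall_eq_Icc]
    intro t ht
    have : h - h / 2 ≤ t := ht.1
    rw [mem_Ioi]
    linarith
  have h4 : θ h = 1 := θ.one_of_mem_closedBall (Metric.mem_closedBall_self (by positivity))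
  have h5 : θ 0 = 0 := image_eq_zero_of_notMem_tsupport fun h' => lt_irrefl (0 : ℝ) (h3 h')
  -- Existence must come first, because `traceTop` defaults to zero when there is no trace.
  have hex : ∃ g, IsTraceTop h f g := ⟨_, hf.1.isTraceTop h1 h2 h3 h4⟩
  have htr : IsTraceTop h f (traceTop h f) := by
    rw [traceTop, dif_pos hex]
    exact hex.choose_spec
  have hae := htr.ae_eq hf.1 h1 h2 h3 h4
  have : fourierCoef (traceTop h f) n = fourierCoef (verticalIntegral h (cutDeriv h θ f)) n := by
    rw [fourierCoef_eq, fourierCoef_eq]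
    congr 1
    refine integral_congr_ae ?_
    filter_upwards [hae] with y hy
    rw [hy]
  rw [this, hf.fourierCoef_verticalIntegral_cutDeriv hh h1 h2 hb hfb, h4, h5]
  simp

/-- If the trace on `Γ_0` vanishes, so do the boundary values of the Fourier coefficients. -/
lemma MemH1p.eq_zero_of_isTraceBottom (hf : MemH1p h f) (hh : 0 < h)
    (hf0 : IsTraceBottom h f 0) {n : ℤ × ℤ} {b : ℝ → ℂ}
    (hb : IsPrimitiveOn h (coefAt (weakDeriv (Omega h) 2 f) n) b)
    (hfb : ∀ᵐ t ∂volume.restrict (Ioo 0 h), coefAt f n t = b t) : b 0 = 0 := by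
  let θ : ContDiffBump (0 : ℝ) := ⟨h / 4, h / 2, by positivity, by linarith⟩
  have h1 : ContDiff ℝ ∞ θ := θ.contDiff
  have h2 : HasCompactSupport θ := θ.hasCompactSupport
  have h3 : tsupport θ ⊆ Iio h := by
    rw [θ.tsupport_eq, Real.closedBall_eq_Icc]
    intro t ht
    have : t ≤ 0 + h / 2 := ht.2
    rw [mem_Iio]
    linarith
  have h4 : θ 0 = 1 := θ.one_of_mem_closedBall (Metric.mem_closedBall_self (by positivity))
  have h5 : θ h = 0 := image_eq_zero_of_notMem_tsupport fun h' => lt_irrefl h (h3 h')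
  have hae := hf0.ae_eq_zero hf.1 h1 h2 h3
  have h6 := hf.fourierCoef_verticalIntegral_cutDeriv hh h1 h2 hb hfb
  have h7 : fourierCoef (verticalIntegral h (cutDeriv h θ f)) n = 0 := by
    rw [fourierCoef_eq, integral_eq_zero_of_ae, mul_zero]
    filter_upwards [hae] with y hy
    simp [hy]
  rw [h7, h4, h5] at h6
  simpa using h6.symm

end TraceTop

/-! ### The operators `∂^α`, `curl_α` and `div_α` in Fourier space -/

section DAlpha

variable {h : ℝ} {f : E3 → ℂ} (α : E3)

lemma MemH1p.memLp (hf : MemH1p h f) : MemLp f 2 (volume.restrict (Omega h)) := hf.1.1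

lemma MemH1p.memLp_dAlpha (hf : MemH1p h f) (j : Fin 3) :
    MemLp (dAlpha (Omega h) α j f) 2 (volume.restrict (Omega h)) :=
  (hf.memLp_weakDeriv j).add (hf.memLp.const_mul _)

lemma MemH1p.integrableOn_dAlpha (hf : MemH1p h f) (j : Fin 3) :
    IntegrableOn (dAlpha (Omega h) α j f) (Omega h) :=
  (hf.memLp_dAlpha α j).integrable (by norm_num)

lemma MemH1p.coefAt_dAlpha (hf : MemH1p h f) (j : Fin 3) (n : ℤ × ℤ) :
    ∀ᵐ t ∂volume.restrict (Ioo 0 h), coefAt (dAlpha (Omega h) α j f) n t =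
      coefAt (weakDeriv (Omega h) j f) n t + Complex.I * α j * coefAt f n t := by
  filter_upwards [coefAt_add_ae (hf.integrableOn_weakDeriv j)
    (hf.integrableOn.const_mul (Complex.I * α j)) n] with t ht
  rw [← coefAt_const_mul, ← ht]
  rfl

lemma MemH1p.coefAt_dAlpha_zero (hf : MemH1p h f) (n : ℤ × ℤ) :
    ∀ᵐ t ∂volume.restrict (Ioo 0 h), coefAt (dAlpha (Omega h) α 0 f) n t =
      Complex.I * ((n.1 + α 0 : ℝ) : ℂ) * coefAt f n t := by
  filter_upwards [hf.coefAt_dAlpha α 0 n, hf.coefAt_weakDeriv_zero n] with t h1 h2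
  rw [h1, h2]
  push_cast
  ring

lemma MemH1p.coefAt_dAlpha_one (hf : MemH1p h f) (n : ℤ × ℤ) :
    ∀ᵐ t ∂volume.restrict (Ioo 0 h), coefAt (dAlpha (Omega h) α 1 f) n t =
      Complex.I * ((n.2 + α 1 : ℝ) : ℂ) * coefAt f n t := by
  filter_upwards [hf.coefAt_dAlpha α 1 n, hf.coefAt_weakDeriv_one n] with t h1 h2
  rw [h1, h2]
  push_cast
  ring

variable {α}

lemma MemH1p.coefAt_dAlpha_two (hf : MemH1p h f) (hα : α 2 = 0) (n : ℤ × ℤ) :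
    ∀ᵐ t ∂volume.restrict (Ioo 0 h), coefAt (dAlpha (Omega h) α 2 f) n t =
      coefAt (weakDeriv (Omega h) 2 f) n t := by
  filter_upwards [hf.coefAt_dAlpha α 2 n] with t h1
  rw [h1, hα]
  simp

lemma integrable_norm_sq_coefAt {q : E3 → ℂ} (hq : MemLp q 2 (volume.restrict (Omega h)))
    (n : ℤ × ℤ) : Integrable (fun t => ‖coefAt q n t‖ ^ 2) (volume.restrict (Ioo 0 h)) :=
  (memLp_coefAt hq n).integrable_norm_pow (by norm_num)

/-- The trace inequality for the Fourier coefficients. -/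
lemma MemH1p.norm_sq_fourierCoef_traceTop_le (hf : MemH1p h f) (hh : 0 < h) (hα : α 2 = 0)
    (n : ℤ × ℤ) {l : ℝ} (hl : 0 < l) :
    ‖fourierCoef (traceTop h f) n‖ ^ 2 ≤ (1 / h + l) * (∫ t in Ioo 0 h, ‖coefAt f n t‖ ^ 2)
      + (1 / l) * ∫ t in Ioo 0 h, ‖coefAt (dAlpha (Omega h) α 2 f) n t‖ ^ 2 := by
  obtain ⟨b, hb, hfb⟩ := hf.exists_isPrimitiveOn_coefAt hh n
  rw [hf.fourierCoef_traceTop hh hb hfb]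
  have := hb.norm_sq_le hh (memLp_coefAt (hf.memLp_weakDeriv 2) n) hl
  have e1 : ∫ t in Ioo 0 h, ‖b t‖ ^ 2 = ∫ t in Ioo 0 h, ‖coefAt f n t‖ ^ 2 := by
    refine integral_congr_ae ?_
    filter_upwards [hfb] with t ht
    rw [ht]
  have e2 : ∫ t in Ioo 0 h, ‖coefAt (weakDeriv (Omega h) 2 f) n t‖ ^ 2 =
      ∫ t in Ioo 0 h, ‖coefAt (dAlpha (Omega h) α 2 f) n t‖ ^ 2 := by
    refine integral_congr_ae ?_
    filter_upwards [hf.coefAt_dAlpha_two hα n] with t ht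
    rw [ht]
  rwa [e1, e2] at this

lemma normSqShift_eq (hα : α 2 = 0) (n : ℤ × ℤ) :
    normSqShift α n = (n.1 + α 0) ^ 2 + (n.2 + α 1) ^ 2 := by
  rw [normSqShift, hα]; ring

lemma normSqShift_nonneg (α : E3) (n : ℤ × ℤ) : 0 ≤ normSqShift α n := by
  unfold normSqShift; positivity

/-- Each horizontal derivative multiplies the coefficient by `i` times a component of `n + α`, so
the weight `|n + α|²` is paid for by the gradient. -/
lemma MemH1p.normSqShift_mul_integral (hf : MemH1p h f) (hα : α 2 = 0) (n : ℤ × ℤ) :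
    normSqShift α n * ∫ t in Ioo 0 h, ‖coefAt f n t‖ ^ 2 =
      (∫ t in Ioo 0 h, ‖coefAt (dAlpha (Omega h) α 0 f) n t‖ ^ 2) +
        ∫ t in Ioo 0 h, ‖coefAt (dAlpha (Omega h) α 1 f) n t‖ ^ 2 := by
  rw [normSqShift_eq hα, add_mul, ← integral_const_mul, ← integral_const_mul]
  congr 1
  · refine integral_congr_ae ?_
    filter_upwards [hf.coefAt_dAlpha_zero α n] with t ht
    rw [ht, norm_mul, norm_mul, Complex.norm_I, Complex.norm_real, mul_pow, one_mul,
      Real.norm_eq_abs, sq_abs]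
  · refine integral_congr_ae ?_
    filter_upwards [hf.coefAt_dAlpha_one α n] with t ht
    rw [ht, norm_mul, norm_mul, Complex.norm_I, Complex.norm_real, mul_pow, one_mul,
      Real.norm_eq_abs, sq_abs]

/-- The trace of a function in `H¹_p(Ω)` is in `H^{1/2}`. -/
lemma MemH1p.summable_trace (hf : MemH1p h f) (hh : 0 < h) (hα : α 2 = 0) :
    Summable (fun n => (Real.sqrt (normSqShift α n) + 1) * ‖fourierCoef (traceTop h f) n‖ ^ 2) := by
  have hp : (4 * Real.pi ^ 2) ≠ 0 := by have := Real.pi_pos; positivity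
  have s : ∀ {q : E3 → ℂ}, MemLp q 2 (volume.restrict (Omega h)) →
      Summable (fun n => ∫ t in Ioo 0 h, ‖coefAt q n t‖ ^ 2) := fun hq =>
    (summable_mul_left_iff hp).1 (hasSum_integral_norm_sq_coefAt hq).summable
  have s0 := s hf.memLp
  have s1 := ((s (hf.memLp_dAlpha α 0)).add (s (hf.memLp_dAlpha α 1))).congr
    (fun n => (hf.normSqShift_mul_integral hα n).symm)
  have s2 := s (hf.memLp_dAlpha α 2)
  refine Summable.of_nonneg_of_le (fun n => by positivity) (fun n => ?_)
    (((s0.add s1).mul_left (2 + 2 / h)).add s2)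
  set r := Real.sqrt (normSqShift α n) with hr
  have hr0 : 0 ≤ r := Real.sqrt_nonneg _
  have hr2 : normSqShift α n = r ^ 2 := (Real.sq_sqrt (normSqShift_nonneg α n)).symm
  -- After multiplication by `r + 1`, this choice gives the vertical derivative the weight one and
  -- `A` a weight of order `1 + r²`, both summable.
  have := hf.norm_sq_fourierCoef_traceTop_le hh hα n (l := r + 1) (by positivity)
  set A := ∫ t in Ioo 0 h, ‖coefAt f n t‖ ^ 2
  set P := ∫ t in Ioo 0 h, ‖coefAt (dAlpha (Omega h) α 2 f) n t‖ ^ 2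
  have hA : 0 ≤ A := integral_nonneg fun _ => by positivity
  calc (r + 1) * ‖fourierCoef (traceTop h f) n‖ ^ 2
      ≤ (r + 1) * ((1 / h + (r + 1)) * A + (1 / (r + 1)) * P) := by gcongr
    _ = ((r + 1) * (1 / h) + (r + 1) ^ 2) * A + P := by field_simp
    _ ≤ ((2 * (1 + r ^ 2)) * (1 / h) + 2 * (1 + r ^ 2)) * A + P := by
        gcongr
        · nlinarith [sq_nonneg (r - 1), sq_nonneg r]
        · nlinarith [sq_nonneg (r - 1)]
    _ = _ := by rw [hr2]; ring

end DAlpha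

/-! ### The curl–divergence identity for a single Fourier mode -/

section Modes

variable {h : ℝ} {H : E3 → Fin 3 → ℂ} {α : E3}

lemma MemH1pT.memLp_curlAlpha (hH : MemH1pT h H) (α : E3) (i : Fin 3) :
    MemLp (fun x => curlAlpha (Omega h) α H x i) 2 (volume.restrict (Omega h)) := by
  have d := fun i j => (hH.1 i).memLp_dAlpha α j
  fin_cases i
  · exact (d 2 1).sub (d 1 2)
  · exact (d 0 2).sub (d 2 0)
  · exact (d 1 0).sub (d 0 1)

lemma MemH1pT.memLp_divAlpha (hH : MemH1pT h H) (α : E3) :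
    MemLp (divAlpha (Omega h) α H) 2 (volume.restrict (Omega h)) := by
  have d := fun i j => (hH.1 i).memLp_dAlpha α j
  have : divAlpha (Omega h) α H = fun x => dAlpha (Omega h) α 0 (fun z => H z 0) x +
      dAlpha (Omega h) α 1 (fun z => H z 1) x + dAlpha (Omega h) α 2 (fun z => H z 2) x := by
    ext x
    rw [divAlpha, Fin.sum_univ_three]
  rw [this]
  exact ((d 0 0).add (d 1 1)).add (d 2 2)

/-- The pointwise identity between `|curl|² + |div|²` and `|∇|²` for a single Fourier mode. -/
lemma normSq_curl_add_normSq_div (x y : ℝ) (a₀ a₁ a₂ p₀ p₁ p₂ : ℂ) :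
    ‖Complex.I * y * a₂ - p₁‖ ^ 2 + ‖p₀ - Complex.I * x * a₂‖ ^ 2 +
        ‖Complex.I * x * a₁ - Complex.I * y * a₀‖ ^ 2 +
        ‖Complex.I * x * a₀ + Complex.I * y * a₁ + p₂‖ ^ 2 =
      (‖Complex.I * x * a₀‖ ^ 2 + ‖Complex.I * y * a₀‖ ^ 2 + ‖p₀‖ ^ 2) +
      (‖Complex.I * x * a₁‖ ^ 2 + ‖Complex.I * y * a₁‖ ^ 2 + ‖p₁‖ ^ 2) +
      (‖Complex.I * x * a₂‖ ^ 2 + ‖Complex.I * y * a₂‖ ^ 2 + ‖p₂‖ ^ 2) +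
      2 * (Complex.I * (x * (p₀ * star a₂ + a₀ * star p₂) +
        y * (p₁ * star a₂ + a₁ * star p₂))).re := by
  simp only [Complex.sq_norm, Complex.normSq_apply, Complex.add_re, Complex.add_im, Complex.sub_re,
    Complex.sub_im, Complex.mul_re, Complex.mul_im, Complex.I_re, Complex.I_im, Complex.ofReal_re,
    Complex.ofReal_im, Complex.star_def, Complex.conj_re, Complex.conj_im]
  ring

lemma integral_add_three {X : Type*} [MeasurableSpace X] {μ : Measure X} {f g k : X → ℝ}
    (hf : Integrable f μ) (hg : Integrable g μ) (hk : Integrable k μ) :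
    (∫ x, f x ∂μ) + (∫ x, g x ∂μ) + ∫ x, k x ∂μ = ∫ x, (f x + g x + k x) ∂μ := by
  rw [← integral_add hf hg]
  exact (integral_add (hf.add hg) hk).symm

/-- Integration by parts for a single Fourier mode. -/
lemma MemH1pT.integral_curl_add_div (hH : MemH1pT h H) (hh : 0 < h) (hα : α 2 = 0) (n : ℤ × ℤ) :
    (∑ i, ∫ t in Ioo 0 h, ‖coefAt (fun x => curlAlpha (Omega h) α H x i) n t‖ ^ 2) +
        ∫ t in Ioo 0 h, ‖coefAt (divAlpha (Omega h) α H) n t‖ ^ 2 =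
      (∑ i, ∑ j, ∫ t in Ioo 0 h, ‖coefAt (dAlpha (Omega h) α j (fun z => H z i)) n t‖ ^ 2) +
        2 * (Complex.I * (((n.1 + α 0 : ℝ) : ℂ) * traceCoef h H n 0 +
          ((n.2 + α 1 : ℝ) : ℂ) * traceCoef h H n 1) * star (traceCoef h H n 2)).re := by
  choose a ha hfa using fun i => (hH.1 i).exists_isPrimitiveOn_coefAt hh n
  have htr : ∀ i, traceCoef h H n i = a i h := fun i =>
    (hH.1 i).fourierCoef_traceTop hh (ha i) (hfa i)
  -- Every cross term contains `a 2`, so this removes all contributions from the bottom face in the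
  -- integration by parts.
  have h0 : a 2 0 = 0 := (hH.1 2).eq_zero_of_isTraceBottom hh hH.2 (ha 2) (hfa 2)
  set x : ℝ := n.1 + α 0 with hx
  set y : ℝ := n.2 + α 1 with hy
  set p : Fin 3 → ℝ → ℂ := fun i => coefAt (weakDeriv (Omega h) 2 (fun z => H z i)) n with hp
  set μ := volume.restrict (Ioo 0 h) with hμ
  have D0 : ∀ i, ∀ᵐ t ∂μ, coefAt (dAlpha (Omega h) α 0 (fun z => H z i)) n t =
      Complex.I * x * a i t := fun i => by
    filter_upwards [(hH.1 i).coefAt_dAlpha_zero α n, hfa i] with t h1 h2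
    rw [h1, h2]
  have D1 : ∀ i, ∀ᵐ t ∂μ, coefAt (dAlpha (Omega h) α 1 (fun z => H z i)) n t =
      Complex.I * y * a i t := fun i => by
    filter_upwards [(hH.1 i).coefAt_dAlpha_one α n, hfa i] with t h1 h2
    rw [h1, h2]
  have D2 : ∀ i, ∀ᵐ t ∂μ, coefAt (dAlpha (Omega h) α 2 (fun z => H z i)) n t = p i t := fun i =>
    (hH.1 i).coefAt_dAlpha_two hα n
  have d := fun i j => (hH.1 i).integrableOn_dAlpha α j
  have C0 : ∀ᵐ t ∂μ, coefAt (fun x => curlAlpha (Omega h) α H x 0) n t =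
      Complex.I * y * a 2 t - p 1 t := by
    filter_upwards [coefAt_sub_ae (d 2 1) (d 1 2) n, D1 2, D2 1] with t h1 h2 h3
    rw [← h2, ← h3, ← h1]
    rfl
  have C1 : ∀ᵐ t ∂μ, coefAt (fun x => curlAlpha (Omega h) α H x 1) n t =
      p 0 t - Complex.I * x * a 2 t := by
    filter_upwards [coefAt_sub_ae (d 0 2) (d 2 0) n, D2 0, D0 2] with t h1 h2 h3
    rw [← h2, ← h3, ← h1]
    rfl
  have C2 : ∀ᵐ t ∂μ, coefAt (fun x => curlAlpha (Omega h) α H x 2) n t =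
      Complex.I * x * a 1 t - Complex.I * y * a 0 t := by
    filter_upwards [coefAt_sub_ae (d 1 0) (d 0 1) n, D0 1, D1 0] with t h1 h2 h3
    rw [← h2, ← h3, ← h1]
    rfl
  have CD : ∀ᵐ t ∂μ, coefAt (divAlpha (Omega h) α H) n t =
      Complex.I * x * a 0 t + Complex.I * y * a 1 t + p 2 t := by
    filter_upwards [coefAt_add_ae (d 0 0) (d 1 1) n, coefAt_add_ae ((d 0 0).add (d 1 1)) (d 2 2) n,
      D0 0, D1 1, D2 2] with t h1 h2 h3 h4 h5
    rw [← h3, ← h4, ← h5, ← h1]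
    refine Eq.trans ?_ h2
    congr 1
    ext x
    rw [divAlpha, Fin.sum_univ_three]
    rfl
  have ibp : ∀ i, ∫ t, (p i t * star (a 2 t) + a i t * star (p 2 t)) ∂μ =
      a i h * star (a 2 h) := fun i => by
    have := (ha i).integral_mul (ha 2).conj hh.le
    rw [h0, star_zero, mul_zero, sub_zero] at this
    exact this
  have iint : ∀ i, Integrable (fun t => p i t * star (a 2 t) + a i t * star (p 2 t)) μ := fun i =>
    (intervalIntegrable_iff_integrableOn_Ioo_of_le hh.le).1
      ((ha i).mul (ha 2).conj hh.le).intervalIntegrable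
  have ic := fun i => integrable_norm_sq_coefAt (hH.memLp_curlAlpha α i) n
  have idv := integrable_norm_sq_coefAt (hH.memLp_divAlpha α) n
  have ig := fun i j => integrable_norm_sq_coefAt ((hH.1 i).memLp_dAlpha α j) n
  have ibd : Integrable (fun t => Complex.I * (x * (p 0 t * star (a 2 t) + a 0 t * star (p 2 t)) +
        y * (p 1 t * star (a 2 t) + a 1 t * star (p 2 t)))) μ :=
    (((iint 0).const_mul (x : ℂ)).add ((iint 1).const_mul (y : ℂ))).const_mul Complex.I
  have ebd : (Complex.I * (x * traceCoef h H n 0 + y * traceCoef h H n 1) *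
      star (traceCoef h H n 2)).re = ∫ t, (Complex.I * (x * (p 0 t * star (a 2 t) +
        a 0 t * star (p 2 t)) + y * (p 1 t * star (a 2 t) + a 1 t * star (p 2 t)))).re ∂μ := by
    have h1 := Complex.reCLM.integral_comp_comm ibd
    simp only [Complex.reCLM_apply] at h1
    rw [h1, integral_const_mul, integral_add ((iint 0).const_mul (x : ℂ))
      ((iint 1).const_mul (y : ℂ)), integral_const_mul, integral_const_mul, ibp, ibp, htr, htr, htr]
    congr 1
    ring
  have ibr : Integrable (fun t => (Complex.I * (x * (p 0 t * star (a 2 t) + a 0 t * star (p 2 t)) +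
        y * (p 1 t * star (a 2 t) + a 1 t * star (p 2 t)))).re) μ := ibd.re
  simp only [Fin.sum_univ_three]
  have igs : ∀ i, Integrable (fun t =>
      ‖coefAt (dAlpha (Omega h) α 0 (fun z => H z i)) n t‖ ^ 2 +
        ‖coefAt (dAlpha (Omega h) α 1 (fun z => H z i)) n t‖ ^ 2 +
        ‖coefAt (dAlpha (Omega h) α 2 (fun z => H z i)) n t‖ ^ 2) μ := fun i => ((ig i 0).add (ig i 1)).add (ig i 2)
  rw [ebd, ← integral_const_mul, integral_add_three (ic 0) (ic 1) (ic 2),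
    integral_add_three (ig 0 0) (ig 0 1) (ig 0 2), integral_add_three (ig 1 0) (ig 1 1) (ig 1 2),
    integral_add_three (ig 2 0) (ig 2 1) (ig 2 2), integral_add_three (igs 0) (igs 1) (igs 2)]
  refine (integral_add (((ic 0).add (ic 1)).add (ic 2)) idv).symm.trans (Eq.trans ?_
    (integral_add (((igs 0).add (igs 1)).add (igs 2)) (ibr.const_mul 2)))
  refine integral_congr_ae ?_
  filter_upwards [C0, C1, C2, CD, D0 0, D0 1, D0 2, D1 0, D1 1, D1 2, D2 0, D2 1, D2 2]
    with t c0 c1 c2 cd d00 d01 d02 d10 d11 d12 d20 d21 d22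
  simp only [Pi.add_apply, c0, c1, c2, cd, d00, d01, d02, d10, d11, d12, d20, d21, d22]
  exact normSq_curl_add_normSq_div x y _ _ _ _ _ _

end Modes

/-! ### The boundary terms in Fourier space -/

section Boundary

variable {h k : ℝ} {H F : E3 → Fin 3 → ℂ} {α : E3}

lemma norm_beta_le (hk : 0 ≤ k) (α : E3) (n : ℤ × ℤ) :
    ‖beta k α n‖ ≤ Real.sqrt (normSqShift α n) + k := by
  have h0 := normSqShift_nonneg α n
  have h1 := Real.sqrt_nonneg (normSqShift α n)
  rw [beta]
  split_ifs with hc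
  · rw [Complex.norm_real, Real.norm_of_nonneg (Real.sqrt_nonneg _)]
    have : Real.sqrt (k ^ 2 - normSqShift α n) ≤ k := by
      rw [Real.sqrt_le_left hk]; linarith
    linarith
  · rw [norm_mul, Complex.norm_I, one_mul, Complex.norm_real,
      Real.norm_of_nonneg (Real.sqrt_nonneg _)]
    have : Real.sqrt (normSqShift α n - k ^ 2) ≤ Real.sqrt (normSqShift α n) :=
      Real.sqrt_le_sqrt (by nlinarith)
    linarith

/-- For a propagating mode `r ≤ k` and the imaginary part is zero; for an evanescent one, `(r - k)²
≤ r² - k²` because `r ≥ k`. -/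
lemma sub_le_im_beta (hk : 0 ≤ k) (α : E3) (n : ℤ × ℤ) :
    Real.sqrt (normSqShift α n) - k ≤ (beta k α n).im := by
  rw [beta]
  split_ifs with hc
  · rw [Complex.ofReal_im, sub_nonpos, Real.sqrt_le_left hk]
    exact hc
  · simp only [Complex.mul_im, Complex.I_re, Complex.I_im, Complex.ofReal_re, zero_mul, one_mul,
      zero_add]
    push Not at hc
    have h1 : k ≤ Real.sqrt (normSqShift α n) := Real.le_sqrt_of_sq_le hc.le
    have h2 := Real.sq_sqrt (normSqShift_nonneg α n)
    refine Real.le_sqrt_of_sq_le ?_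
    nlinarith

lemma crossR_dotProduct (h k : ℝ) (α : E3) (H : E3 → Fin 3 → ℂ) (n : ℤ × ℤ) (v : Fin 3 → ℂ) :
    crossR h k α H n ⬝ᵥ star v =
      (Complex.I * ((n.1 + α 0 : ℝ) : ℂ) * traceCoef h H n 2
          - Complex.I * beta k α n * traceCoef h H n 0) * star (v 0) +
        (Complex.I * ((n.2 + α 1 : ℝ) : ℂ) * traceCoef h H n 2
          - Complex.I * beta k α n * traceCoef h H n 1) * star (v 1) := by
  simp [crossR, cross_apply, e3, symbolR, dotProduct, Fin.sum_univ_three]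

lemma dotR_mul (h k : ℝ) (α : E3) (H : E3 → Fin 3 → ℂ) (n : ℤ × ℤ) (v : Fin 3 → ℂ) :
    dotR h k α H n * star (e3 ⬝ᵥ v) =
      (Complex.I * ((n.1 + α 0 : ℝ) : ℂ) * traceCoef h H n 0 +
        Complex.I * ((n.2 + α 1 : ℝ) : ℂ) * traceCoef h H n 1 +
        Complex.I * beta k α n * traceCoef h H n 2) * star (v 2) := by
  simp [dotR, e3, symbolR, dotProduct, Fin.sum_univ_three]

/-- The tangential terms of the two pairings are conjugate up to sign and add up to the negative of
the boundary term in `MemH1pT.integral_curl_add_div`. The diagonal terms `-i β_n |a_i|²` have real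
part `(Im β_n) |a_i|²`. -/
lemma re_boundary (h k : ℝ) (α : E3) (H : E3 → Fin 3 → ℂ) (n : ℤ × ℤ) :
    (crossR h k α H n ⬝ᵥ star (traceCoef h H n)).re
        - (dotR h k α H n * star (e3 ⬝ᵥ traceCoef h H n)).re =
      -(2 * (Complex.I * (((n.1 + α 0 : ℝ) : ℂ) * traceCoef h H n 0 +
          ((n.2 + α 1 : ℝ) : ℂ) * traceCoef h H n 1) * star (traceCoef h H n 2)).re) +
        (beta k α n).im * ∑ i, ‖traceCoef h H n i‖ ^ 2 := by
  rw [crossR_dotProduct, dotR_mul, Fin.sum_univ_three]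
  simp only [Complex.sq_norm, Complex.normSq_apply, Complex.add_re, Complex.add_im, Complex.sub_re,
    Complex.sub_im, Complex.mul_re, Complex.mul_im, Complex.I_re, Complex.I_im, Complex.ofReal_re,
    Complex.ofReal_im, Complex.star_def, Complex.conj_re, Complex.conj_im]
  ring

lemma abs_fst_le_sqrt_normSqShift (α : E3) (n : ℤ × ℤ) :
    |(n.1 : ℝ) + α 0| ≤ Real.sqrt (normSqShift α n) :=
  Real.abs_le_sqrt (by unfold normSqShift; nlinarith [sq_nonneg ((n.2 : ℝ) + α 1), sq_nonneg (α 2)])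

lemma abs_snd_le_sqrt_normSqShift (α : E3) (n : ℤ × ℤ) :
    |(n.2 : ℝ) + α 1| ≤ Real.sqrt (normSqShift α n) :=
  Real.abs_le_sqrt (by unfold normSqShift; nlinarith [sq_nonneg ((n.1 : ℝ) + α 0), sq_nonneg (α 2)])

/-- Young's inequality for the mixed boundary term. -/
lemma abs_mixed_le {x y r : ℝ} (hr : 0 ≤ r) (hxy : x ^ 2 + y ^ 2 ≤ r ^ 2) (a b c : ℂ) :
    |2 * (Complex.I * (x * a + y * b) * star c).re| ≤ r * (‖a‖ ^ 2 + ‖b‖ ^ 2 + ‖c‖ ^ 2) := by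
  set s := Real.sqrt (‖a‖ ^ 2 + ‖b‖ ^ 2) with hs
  have hs2 : s ^ 2 = ‖a‖ ^ 2 + ‖b‖ ^ 2 := Real.sq_sqrt (by positivity)
  have hs0 : 0 ≤ s := Real.sqrt_nonneg _
  have h1 : ‖(x : ℂ) * a + y * b‖ ≤ r * s := by
    have h2 : ‖(x : ℂ) * a + y * b‖ ≤ |x| * ‖a‖ + |y| * ‖b‖ := by
      refine (norm_add_le _ _).trans (le_of_eq ?_)
      simp
    refine h2.trans (abs_le_of_sq_le_sq' ?_ (by positivity)).2
    calc (|x| * ‖a‖ + |y| * ‖b‖) ^ 2 ≤ (|x| ^ 2 + |y| ^ 2) * (‖a‖ ^ 2 + ‖b‖ ^ 2) := by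
          nlinarith [sq_nonneg (|x| * ‖b‖ - |y| * ‖a‖)]
      _ ≤ r ^ 2 * (‖a‖ ^ 2 + ‖b‖ ^ 2) := by
          rw [sq_abs, sq_abs]
          exact mul_le_mul_of_nonneg_right hxy (by positivity)
      _ = (r * s) ^ 2 := by rw [mul_pow, hs2]
  have h3 : |(Complex.I * (x * a + y * b) * star c).re| ≤ r * s * ‖c‖ := by
    refine (Complex.abs_re_le_norm _).trans ?_
    rw [norm_mul, norm_mul, Complex.norm_I, one_mul, norm_star]
    gcongr
  rw [abs_mul, abs_two]
  calc 2 * |(Complex.I * (x * a + y * b) * star c).re| ≤ 2 * (r * s * ‖c‖) := by gcongr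
    _ = r * (2 * s * ‖c‖) := by ring
    _ ≤ r * (s ^ 2 + ‖c‖ ^ 2) := by
        gcongr
        exact two_mul_le_add_sq s ‖c‖
    _ = _ := by rw [hs2]

lemma MemH1pT.summable_traceCoef (hH : MemH1pT h H) (hh : 0 < h) (hα : α 2 = 0) :
    Summable (fun n => (Real.sqrt (normSqShift α n) + 1) * ∑ i, ‖traceCoef h H n i‖ ^ 2) := by
  simp only [Finset.mul_sum]
  exact summable_sum fun i _ => (hH.1 i).summable_trace hh hα

lemma norm_mul_mul_star_le {c a b : ℂ} {N S T : ℝ} (hN : 0 ≤ N) (hc : ‖c‖ ≤ N) (ha : ‖a‖ ^ 2 ≤ S)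
    (hb : ‖b‖ ^ 2 ≤ T) : ‖Complex.I * c * a * star b‖ ≤ N * (S + T) := by
  rw [norm_mul, norm_mul, norm_mul, Complex.norm_I, one_mul, norm_star, mul_assoc]
  refine mul_le_mul hc ?_ (by positivity) hN
  nlinarith [sq_nonneg (‖a‖ - ‖b‖), norm_nonneg a, norm_nonneg b]

lemma symbol_norm_le (hk : 0 ≤ k) (α : E3) (n : ℤ × ℤ) :
    ‖((n.1 + α 0 : ℝ) : ℂ)‖ ≤ Real.sqrt (normSqShift α n) + k ∧
      ‖((n.2 + α 1 : ℝ) : ℂ)‖ ≤ Real.sqrt (normSqShift α n) + k := by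
  rw [Complex.norm_real, Complex.norm_real]
  exact ⟨(abs_fst_le_sqrt_normSqShift α n).trans (by linarith),
    (abs_snd_le_sqrt_normSqShift α n).trans (by linarith)⟩

lemma sq_le_sum_sq (v : Fin 3 → ℂ) (i : Fin 3) : ‖v i‖ ^ 2 ≤ ∑ j, ‖v j‖ ^ 2 :=
  Finset.single_le_sum (f := fun j => ‖v j‖ ^ 2) (fun _ _ => by positivity) (Finset.mem_univ i)

lemma add_le_mul_add_one {r : ℝ} (hr : 0 ≤ r) (hk : 0 ≤ k) : r + k ≤ (1 + k) * (r + 1) := by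
  nlinarith [mul_nonneg hr hk]

lemma MemH1pT.summable_majorant (hH : MemH1pT h H) (hF : MemH1pT h F) (hh : 0 < h) (hα : α 2 = 0) (C : ℝ) :
    Summable (fun n => C * ((Real.sqrt (normSqShift α n) + 1) *
      (∑ i, ‖traceCoef h H n i‖ ^ 2 + ∑ i, ‖traceCoef h F n i‖ ^ 2))) := by
  simp only [mul_add (Real.sqrt _ + 1)]
  exact ((hH.summable_traceCoef hh hα).add (hF.summable_traceCoef hh hα)).mul_left C

/-- The symbol has order one in `|n + α|`, so the terms are dominated by the `H^{1/2}` densities of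
the two traces. The 4 in the majorant counts the products in `crossR_dotProduct`. -/
lemma MemH1pT.summable_crossR (hH : MemH1pT h H) (hF : MemH1pT h F) (hh : 0 < h) (hk : 0 ≤ k) (hα : α 2 = 0) :
    Summable (fun n => crossR h k α H n ⬝ᵥ star (traceCoef h F n)) := by
  refine Summable.of_norm_bounded (hH.summable_majorant hF hh hα (4 * (1 + k))) fun n => ?_
  have hr := Real.sqrt_nonneg (normSqShift α n)
  have hβ := norm_beta_le hk α n
  obtain ⟨h0, h1⟩ := symbol_norm_le hk α n
  have hrk := add_le_mul_add_one hr hk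
  set N := Real.sqrt (normSqShift α n) + k with hN
  have hN0 : 0 ≤ N := by positivity
  have sH := sq_le_sum_sq (traceCoef h H n)
  have sF := sq_le_sum_sq (traceCoef h F n)
  rw [crossR_dotProduct, sub_mul, sub_mul]
  set S := ∑ i, ‖traceCoef h H n i‖ ^ 2
  set T := ∑ i, ‖traceCoef h F n i‖ ^ 2
  have hS : 0 ≤ S := (sq_nonneg _).trans (sH 0)
  have hT : 0 ≤ T := (sq_nonneg _).trans (sF 0)
  have b1 := norm_mul_mul_star_le hN0 h0 (sH 2) (sF 0)
  have b2 := norm_mul_mul_star_le hN0 hβ (sH 0) (sF 0)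
  have b3 := norm_mul_mul_star_le hN0 h1 (sH 2) (sF 1)
  have b4 := norm_mul_mul_star_le hN0 hβ (sH 1) (sF 1)
  refine (norm_add_le _ _).trans ((add_le_add (norm_sub_le _ _) (norm_sub_le _ _)).trans ?_)
  calc _ ≤ N * (S + T) + N * (S + T) + (N * (S + T) + N * (S + T)) :=
        add_le_add (add_le_add b1 b2) (add_le_add b3 b4)
    _ = 4 * (N * (S + T)) := by ring
    _ ≤ 4 * ((1 + k) * (Real.sqrt (normSqShift α n) + 1) * (S + T)) := by gcongr
    _ = _ := by ring

lemma MemH1pT.summable_dotR (hH : MemH1pT h H) (hF : MemH1pT h F) (hh : 0 < h) (hk : 0 ≤ k) (hα : α 2 = 0) :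
    Summable (fun n => dotR h k α H n * star (e3 ⬝ᵥ traceCoef h F n)) := by
  refine Summable.of_norm_bounded (hH.summable_majorant hF hh hα (3 * (1 + k))) fun n => ?_
  have hr := Real.sqrt_nonneg (normSqShift α n)
  have hβ := norm_beta_le hk α n
  obtain ⟨h0, h1⟩ := symbol_norm_le hk α n
  have hrk := add_le_mul_add_one hr hk
  set N := Real.sqrt (normSqShift α n) + k with hN
  have hN0 : 0 ≤ N := by positivity
  have sH := sq_le_sum_sq (traceCoef h H n)
  have sF := sq_le_sum_sq (traceCoef h F n)
  rw [dotR_mul, add_mul, add_mul]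
  set S := ∑ i, ‖traceCoef h H n i‖ ^ 2
  set T := ∑ i, ‖traceCoef h F n i‖ ^ 2
  have hS : 0 ≤ S := (sq_nonneg _).trans (sH 0)
  have hT : 0 ≤ T := (sq_nonneg _).trans (sF 0)
  have b1 := norm_mul_mul_star_le hN0 h0 (sH 0) (sF 2)
  have b2 := norm_mul_mul_star_le hN0 h1 (sH 1) (sF 2)
  have b3 := norm_mul_mul_star_le hN0 hβ (sH 2) (sF 2)
  refine (norm_add₃_le).trans ?_
  calc _ ≤ N * (S + T) + N * (S + T) + N * (S + T) :=
        add_le_add (add_le_add b1 b2) b3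
    _ = 3 * (N * (S + T)) := by ring
    _ ≤ 3 * ((1 + k) * (Real.sqrt (normSqShift α n) + 1) * (S + T)) := by gcongr
    _ = _ := by ring

/-- The Gårding inequality for a single Fourier mode. -/
lemma MemH1pT.mode_garding (hH : MemH1pT h H) (hh : 0 < h) (hk : 0 < k) (hα : α 2 = 0) {c : ℝ}
    (hc0 : 0 < c) (hc1 : c ≤ 1) (n : ℤ × ℤ) :
    c / 2 * (∑ i, ∑ j, ∫ t in Ioo 0 h, ‖coefAt (dAlpha (Omega h) α j (fun z => H z i)) n t‖ ^ 2)
        - k * (1 / h + 2 * k / c) * ∑ i, ∫ t in Ioo 0 h, ‖coefAt (fun z => H z i) n t‖ ^ 2 ≤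
      c * ((∑ i, ∫ t in Ioo 0 h, ‖coefAt (fun x => curlAlpha (Omega h) α H x i) n t‖ ^ 2) +
        ∫ t in Ioo 0 h, ‖coefAt (divAlpha (Omega h) α H) n t‖ ^ 2) +
      ((crossR h k α H n ⬝ᵥ star (traceCoef h H n)).re
        - (dotR h k α H n * star (e3 ⬝ᵥ traceCoef h H n)).re) := by
  rw [hH.integral_curl_add_div hh hα, re_boundary]
  have hr := Real.sqrt_nonneg (normSqShift α n)
  have hr2 : ((n.1 : ℝ) + α 0) ^ 2 + ((n.2 : ℝ) + α 1) ^ 2 ≤ Real.sqrt (normSqShift α n) ^ 2 := by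
    rw [Real.sq_sqrt (normSqShift_nonneg α n), normSqShift_eq hα]
  have hmix := abs_mixed_le hr hr2 (traceCoef h H n 0) (traceCoef h H n 1) (traceCoef h H n 2)
  have hβ := sub_le_im_beta hk.le α n
  have htr : ∑ i, ‖traceCoef h H n i‖ ^ 2 ≤
      ∑ i, ((1 / h + 2 * k / c) * (∫ t in Ioo 0 h, ‖coefAt (fun z => H z i) n t‖ ^ 2)
      + (1 / (2 * k / c)) *
        ∫ t in Ioo 0 h, ‖coefAt (dAlpha (Omega h) α 2 (fun z => H z i)) n t‖ ^ 2) :=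
    Finset.sum_le_sum fun i _ =>
      -- The parameter is chosen so that `k / l = c / 2`: the remainder `k S` then uses up only half
      -- of the gradient term.
      (hH.1 i).norm_sq_fourierCoef_traceTop_le hh hα n (l := 2 * k / c) (by positivity)
  rw [Finset.sum_add_distrib, ← Finset.mul_sum, ← Finset.mul_sum] at htr
  have hP : ∑ i, ∫ t in Ioo 0 h, ‖coefAt (dAlpha (Omega h) α 2 (fun z => H z i)) n t‖ ^ 2 ≤
      ∑ i, ∑ j, ∫ t in Ioo 0 h, ‖coefAt (dAlpha (Omega h) α j (fun z => H z i)) n t‖ ^ 2 :=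
    Finset.sum_le_sum fun i _ => Finset.single_le_sum
      (f := fun j => ∫ t in Ioo 0 h, ‖coefAt (dAlpha (Omega h) α j (fun z => H z i)) n t‖ ^ 2)
      (fun j _ => integral_nonneg fun _ => by positivity) (Finset.mem_univ 2)
  rw [← Fin.sum_univ_three (fun i => ‖traceCoef h H n i‖ ^ 2)] at hmix
  have hS : 0 ≤ ∑ i, ‖traceCoef h H n i‖ ^ 2 := Finset.sum_nonneg fun _ _ => by positivity
  set S := ∑ i, ‖traceCoef h H n i‖ ^ 2
  set G := ∑ i, ∑ j, ∫ t in Ioo 0 h, ‖coefAt (dAlpha (Omega h) α j (fun z => H z i)) n t‖ ^ 2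
  set P := ∑ i, ∫ t in Ioo 0 h, ‖coefAt (dAlpha (Omega h) α 2 (fun z => H z i)) n t‖ ^ 2
  set A := ∑ i, ∫ t in Ioo 0 h, ‖coefAt (fun z => H z i) n t‖ ^ 2
  set r := Real.sqrt (normSqShift α n)
  set m := 2 * (Complex.I * (((n.1 + α 0 : ℝ) : ℂ) * traceCoef h H n 0 +
          ((n.2 + α 1 : ℝ) : ℂ) * traceCoef h H n 1) * star (traceCoef h H n 2)).re
  have e1 : k * (1 / (2 * k / c)) = c / 2 := by field_simp
  have k1 : k * S ≤ k * (1 / h + 2 * k / c) * A + c / 2 * P := by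
    calc k * S ≤ k * ((1 / h + 2 * k / c) * A + 1 / (2 * k / c) * P) := by gcongr
      _ = _ := by rw [mul_add, ← mul_assoc, ← mul_assoc, e1]
  have k2 : (r - k) * S ≤ (beta k α n).im * S := by gcongr
  -- This is where `0 < c ≤ 1` enters: the uncancelled fraction of the mixed term is no larger than
  -- the growing part `r S` supplied by `Im β_n`.
  have k3 : (1 - c) * m ≤ r * S := by
    calc (1 - c) * m ≤ |(1 - c) * m| := le_abs_self _
      _ = (1 - c) * |m| := by rw [abs_mul, abs_of_nonneg (by linarith)]
      _ ≤ 1 * (r * S) := mul_le_mul (by linarith) hmix (abs_nonneg _) zero_le_one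
      _ = r * S := one_mul _
  have k4 : c / 2 * P ≤ c / 2 * G := by gcongr
  nlinarith

end Boundary

/-! ### The volume terms -/

lemma dotProduct_star_self (v : Fin 3 → ℂ) : v ⬝ᵥ star v = ((∑ i, ‖v i‖ ^ 2 : ℝ) : ℂ) := by
  simp only [dotProduct, Pi.star_apply, Complex.star_def, Complex.mul_conj,
    Complex.normSq_eq_norm_sq]
  push_cast
  rfl

section Coefficient

variable {h : ℝ} {ε : E3 → ℝ}

/-- The part of `Ω` above `h₀` is open and nonempty, hence of positive measure, and the coefficient
equals one there; no almost-everywhere lower bound can exceed one. This also gives the coboundedness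
needed for a real-valued `essInf`. -/
lemma essInf_inv_facts (hh : 0 < h)
    (hε_pos : ∃ c : ℝ, 0 < c ∧ ∀ᵐ x ∂volume.restrict (Omega h), c ≤ (ε x)⁻¹)
    (hε_one : ∃ h₀ : ℝ, h₀ < h ∧ ∀ᵐ x ∂volume.restrict (Omega h), h₀ < x 2 → ε x = 1) :
    0 < essInf (fun x => (ε x)⁻¹) (volume.restrict (Omega h)) ∧
      essInf (fun x => (ε x)⁻¹) (volume.restrict (Omega h)) ≤ 1 ∧
      ∀ᵐ x ∂volume.restrict (Omega h),
        essInf (fun x => (ε x)⁻¹) (volume.restrict (Omega h)) ≤ (ε x)⁻¹ := by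
  obtain ⟨c, hc, hcε⟩ := hε_pos
  obtain ⟨h₀, hh₀, hone⟩ := hε_one
  set U : Set E3 := Omega h ∩ {x | h₀ < x 2} with hU
  have hUo : IsOpen U := (isOpen_Omega h).inter (isOpen_lt continuous_const (continuous_coord 2))
  have hUn : U.Nonempty := by
    have hm : max h₀ 0 < h := max_lt hh₀ hh
    have h1 := le_max_left h₀ 0
    have h2 := le_max_right h₀ 0
    have hp := Real.pi_pos
    refine ⟨atHeight ((max h₀ 0 + h) / 2) (Real.pi, Real.pi), ⟨?_, ?_, ?_⟩, ?_⟩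
    · simp [atHeight]; constructor <;> linarith
    · simp [atHeight]; constructor <;> linarith
    · simp only [atHeight, Matrix.cons_val, mem_Ioo]; constructor <;> linarith
    · simp only [atHeight, Matrix.cons_val, mem_ofPred_eq]; linarith
  have hne : (ae (volume.restrict U)).NeBot := by
    rw [ae_neBot, Ne, Measure.restrict_eq_zero]
    exact (hUo.measure_pos volume hUn).ne'
  have hsub : ae (volume.restrict U) ≤ ae (volume.restrict (Omega h)) :=
    ae_mono (Measure.restrict_mono inter_subset_left le_rfl)
  have hone' : ∀ᵐ x ∂volume.restrict U, (ε x)⁻¹ = 1 := by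
    filter_upwards [hsub hone, ae_restrict_mem hUo.measurableSet] with x h1 h2
    rw [h1 h2.2, inv_one]
  have hbdd : Filter.IsBoundedUnder (· ≥ ·) (ae (volume.restrict (Omega h))) fun x => (ε x)⁻¹ :=
    ⟨c, Filter.eventually_map.2 hcε⟩
  have hcobdd : Filter.IsCoboundedUnder (· ≥ ·) (ae (volume.restrict (Omega h)))
      fun x => (ε x)⁻¹ := by
    refine ⟨1, fun a ha => ?_⟩
    have ha' : ∀ᵐ x ∂volume.restrict U, a ≤ (ε x)⁻¹ := hsub (Filter.eventually_map.1 ha)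
    obtain ⟨x, hx1, hx2⟩ := (Filter.Eventually.and ha' hone').exists
    exact hx2 ▸ hx1
  have hle := ae_essInf_le hbdd
  refine ⟨hc.trans_le (le_essInf_of_ae_le c hcε hcobdd), ?_, hle⟩
  have hle' : ∀ᵐ x ∂volume.restrict U,
      essInf (fun x => (ε x)⁻¹) (volume.restrict (Omega h)) ≤ (ε x)⁻¹ := hsub hle
  obtain ⟨x, hx1, hx2⟩ := (Filter.Eventually.and hle' hone').exists
  exact hx2 ▸ hx1

variable {H : E3 → Fin 3 → ℂ} {k : ℝ} {α : E3}

lemma integrable_norm_sq {q : E3 → ℂ} (hq : MemLp q 2 (volume.restrict (Omega h))) :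
    Integrable (fun x => ‖q x‖ ^ 2) (volume.restrict (Omega h)) :=
  hq.integrable_norm_pow (by norm_num)

lemma MemH1pT.integrable_sum_norm_sq (hH : MemH1pT h H) :
    Integrable (fun x => ∑ i, ‖H x i‖ ^ 2) (volume.restrict (Omega h)) :=
  integrable_finsetSum _ fun i _ => integrable_norm_sq (hH.1 i).memLp

lemma MemH1pT.integrable_sum_norm_sq_curl (hH : MemH1pT h H) (α : E3) :
    Integrable (fun x => ∑ i, ‖curlAlpha (Omega h) α H x i‖ ^ 2) (volume.restrict (Omega h)) :=
  integrable_finsetSum _ fun i _ => integrable_norm_sq (hH.memLp_curlAlpha α i)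

lemma MemH1pT.le_re_integral_curl (hH : MemH1pT h H)
    (hε : MemLp (fun x => (ε x)⁻¹) ⊤ (volume.restrict (Omega h))) {c : ℝ}
    (hc : ∀ᵐ x ∂volume.restrict (Omega h), c ≤ (ε x)⁻¹) :
    c * (∑ i, ∫ x in Omega h, ‖curlAlpha (Omega h) α H x i‖ ^ 2)
        - k ^ 2 * ∫ x in Omega h, ∑ i, ‖H x i‖ ^ 2 ≤
      (∫ x in Omega h, ((((ε x)⁻¹ : ℝ) : ℂ) *
          (curlAlpha (Omega h) α H x ⬝ᵥ star (curlAlpha (Omega h) α H x))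
        - (k : ℂ) ^ 2 * (H x ⬝ᵥ star (H x)))).re := by
  have hcu := hH.integrable_sum_norm_sq_curl α
  have hu := hH.integrable_sum_norm_sq
  have hecu : Integrable (fun x => (ε x)⁻¹ * ∑ i, ‖curlAlpha (Omega h) α H x i‖ ^ 2)
      (volume.restrict (Omega h)) := hcu.mul_of_top_right hε
  have e : ∀ x, (((ε x)⁻¹ : ℝ) : ℂ) *
        (curlAlpha (Omega h) α H x ⬝ᵥ star (curlAlpha (Omega h) α H x))
        - (k : ℂ) ^ 2 * (H x ⬝ᵥ star (H x)) =
      (((ε x)⁻¹ * (∑ i, ‖curlAlpha (Omega h) α H x i‖ ^ 2) - k ^ 2 * ∑ i, ‖H x i‖ ^ 2 : ℝ) : ℂ) := by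
    intro x
    rw [dotProduct_star_self, dotProduct_star_self, Complex.ofReal_sub, Complex.ofReal_mul,
      Complex.ofReal_mul, Complex.ofReal_pow]
  simp only [e]
  rw [integral_complex_ofReal, Complex.ofReal_re,
    integral_sub hecu (hu.const_mul _), integral_const_mul,
    ← integral_finsetSum _ fun i _ => integrable_norm_sq (hH.memLp_curlAlpha α i),
    ← integral_const_mul]
  refine sub_le_sub_right (integral_mono_ae (hcu.const_mul _) hecu ?_) _
  filter_upwards [hc] with x hx
  exact mul_le_mul_of_nonneg_right hx (Finset.sum_nonneg fun _ _ => by positivity)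

lemma integral_mul_star_self (q : E3 → ℂ) :
    ∫ x in Omega h, q x * star (q x) = ((∫ x in Omega h, ‖q x‖ ^ 2 : ℝ) : ℂ) := by
  rw [← integral_complex_ofReal]
  refine integral_congr_ae (Filter.Eventually.of_forall fun x => ?_)
  simp only [Complex.star_def, Complex.mul_conj, Complex.normSq_eq_norm_sq]

lemma MemH1pT.integral_gradAlphaSq (hH : MemH1pT h H) (α : E3) :
    ∫ x in Omega h, gradAlphaSq (Omega h) α H x =
      ∑ i, ∑ j, ∫ x in Omega h, ‖dAlpha (Omega h) α j (fun z => H z i) x‖ ^ 2 := by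
  have h1 := fun i j => integrable_norm_sq ((hH.1 i).memLp_dAlpha α j)
  simp only [gradAlphaSq]
  rw [integral_finsetSum _ fun i _ => integrable_finsetSum _ fun j _ => h1 i j]
  exact Finset.sum_congr rfl fun i _ => integral_finsetSum _ fun j _ => h1 i j

lemma MemH1pT.hasSum_re_pairing (hH : MemH1pT h H) (hh : 0 < h) (hk : 0 ≤ k) (hα : α 2 = 0) :
    HasSum (fun n => 4 * Real.pi ^ 2 * ((crossR h k α H n ⬝ᵥ star (traceCoef h H n)).re
        - (dotR h k α H n * star (e3 ⬝ᵥ traceCoef h H n)).re))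
      ((pairing (crossR h k α H) (traceCoef h H)).re -
        (pairing (d := 1) (fun n => ![dotR h k α H n]) (fun n => ![e3 ⬝ᵥ traceCoef h H n])).re) := by
  have hp : (4 * (Real.pi : ℂ) ^ 2) = ((4 * Real.pi ^ 2 : ℝ) : ℂ) := by push_cast; rfl
  have s1 := (hH.summable_crossR hH hh hk hα).hasSum.mul_left (4 * (Real.pi : ℂ) ^ 2)
  have s2 := (hH.summable_dotR hH hh hk hα).hasSum.mul_left (4 * (Real.pi : ℂ) ^ 2)
  have e2 : pairing (d := 1) (fun n => ![dotR h k α H n]) (fun n => ![e3 ⬝ᵥ traceCoef h H n]) =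
      4 * (Real.pi : ℂ) ^ 2 * ∑' n, dotR h k α H n * star (e3 ⬝ᵥ traceCoef h H n) := by
    rw [pairing]
    congr 1
    refine tsum_congr fun n => ?_
    simp [dotProduct]
  rw [e2, pairing]
  have hre : ∀ n, 4 * Real.pi ^ 2 * ((crossR h k α H n ⬝ᵥ star (traceCoef h H n)).re
        - (dotR h k α H n * star (e3 ⬝ᵥ traceCoef h H n)).re) =
      (4 * (Real.pi : ℂ) ^ 2 * crossR h k α H n ⬝ᵥ star (traceCoef h H n)).re -
        (4 * (Real.pi : ℂ) ^ 2 * (dotR h k α H n * star (e3 ⬝ᵥ traceCoef h H n))).re := by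
    intro n
    rw [hp, Complex.re_ofReal_mul, Complex.re_ofReal_mul]
    ring
  simp only [hre]
  exact (Complex.hasSum_re s1).sub (Complex.hasSum_re s2)

end Coefficient

/-! ### Summation over the modes and the full sesquilinear form -/

section Garding

variable {h k : ℝ} {α : E3} {ε : E3 → ℝ} {H : E3 → Fin 3 → ℂ}

/-- The Gårding inequality for the boundary form and the squared norms of `curl_α H` and
`div_α H`, summed over all Fourier modes. -/
lemma MemH1pT.le_integral_curl_add_div_add_pairing (hH : MemH1pT h H) (hh : 0 < h) (hk : 0 < k)
    (hα : α 2 = 0) {c : ℝ} (hc0 : 0 < c) (hc1 : c ≤ 1) :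
    c / 2 * (∑ i, ∑ j, ∫ x in Omega h, ‖dAlpha (Omega h) α j (fun z => H z i) x‖ ^ 2)
        - k * (1 / h + 2 * k / c) * ∑ i, ∫ x in Omega h, ‖H x i‖ ^ 2 ≤
      c * ((∑ i, ∫ x in Omega h, ‖curlAlpha (Omega h) α H x i‖ ^ 2) +
        ∫ x in Omega h, ‖divAlpha (Omega h) α H x‖ ^ 2) +
      ((pairing (crossR h k α H) (traceCoef h H)).re -
        (pairing (d := 1) (fun n => ![dotR h k α H n])
          (fun n => ![e3 ⬝ᵥ traceCoef h H n])).re) := by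
  have sG := hasSum_sum (s := Finset.univ) fun (i : Fin 3) _ =>
    hasSum_sum (s := Finset.univ) fun (j : Fin 3) _ =>
      hasSum_integral_norm_sq_coefAt ((hH.1 i).memLp_dAlpha α j)
  have sA := hasSum_sum (s := Finset.univ) fun (i : Fin 3) _ =>
    hasSum_integral_norm_sq_coefAt (hH.1 i).memLp
  have sC := hasSum_sum (s := Finset.univ) fun (i : Fin 3) _ =>
    hasSum_integral_norm_sq_coefAt (hH.memLp_curlAlpha α i)
  have sD := hasSum_integral_norm_sq_coefAt (hH.memLp_divAlpha α)
  refine hasSum_le (fun n => ?_)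
    ((sG.mul_left (c / 2)).sub (sA.mul_left (k * (1 / h + 2 * k / c))))
    (((sC.add sD).mul_left c).add (hH.hasSum_re_pairing hh hk.le hα))
  have hn := mul_le_mul_of_nonneg_left (hH.mode_garding hh hk hα hc0 hc1 n)
    (by positivity : 0 ≤ 4 * Real.pi ^ 2)
  simp only [← Finset.mul_sum]
  linarith

/-- The penalty integral is real and nonnegative for equal arguments, so its real contribution
carries the factor `Re ρ`. That is also the lower bound used for the curl term, so curl and
divergence enter with the same constant, as the mode-wise identity requires. -/
lemma MemH1pT.garding (hH : MemH1pT h H) (hh : 0 < h) (hk : 0 < k) (hα : α 2 = 0)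
    (hε : MemLp (fun x => (ε x)⁻¹) ⊤ (volume.restrict (Omega h))) {ρ : ℂ}
    (hc0 : 0 < ρ.re) (hc1 : ρ.re ≤ 1) (hc : ∀ᵐ x ∂volume.restrict (Omega h), ρ.re ≤ (ε x)⁻¹) :
    ρ.re / 2 * (∫ x in Omega h, gradAlphaSq (Omega h) α H x)
        - (k ^ 2 + k * (1 / h + 2 * k / ρ.re)) * (∫ x in Omega h, ∑ i, ‖H x i‖ ^ 2)
      ≤ (formB h k α ε ρ H H).re := by
  have hmain := hH.le_integral_curl_add_div_add_pairing hh hk hα hc0 hc1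
  have hcurl := hH.le_re_integral_curl (k := k) (α := α) hε hc
  have hsum : ∫ x in Omega h, ∑ i, ‖H x i‖ ^ 2 = ∑ i, ∫ x in Omega h, ‖H x i‖ ^ 2 :=
    integral_finsetSum _ fun i _ => integrable_norm_sq (hH.1 i).memLp
  rw [formB, integral_mul_star_self, Complex.sub_re, Complex.add_re, Complex.add_re,
    Complex.re_mul_ofReal, hH.integral_gradAlphaSq α, hsum]
  rw [hsum] at hcurl
  linarith

end Garding

end Biperiodic

end

theorem theorem3p1 (h k : ℝ) (hh : 0 < h) (hk : 0 < k) (α : E3) (hα : α 2 = 0)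
    (ε : E3 → ℝ)
    (hε_bdd : MemLp (fun x => (ε x)⁻¹) ⊤ (volume.restrict (Omega h)))
    (hε_pos : ∃ c : ℝ, 0 < c ∧ ∀ᵐ x ∂volume.restrict (Omega h), c ≤ (ε x)⁻¹)
    (hε_one : ∃ h₀ : ℝ, h₀ < h ∧ ∀ᵐ x ∂volume.restrict (Omega h), h₀ < x 2 → ε x = 1)
    (ρ : ℂ) (hρ_re : ρ.re = essInf (fun x => (ε x)⁻¹) (volume.restrict (Omega h)))
    (hρ_im : ρ.im < 0) :
    (∀ H F : E3 → Fin 3 → ℂ, MemH1pT h H → MemH1pT h F →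
      Summable (fun n => crossR h k α H n ⬝ᵥ star (traceCoef h F n)) ∧
      Summable (fun n => dotR h k α H n * star (e3 ⬝ᵥ traceCoef h F n))) ∧
    ∃ c₁ c₂ : ℝ, 0 < c₁ ∧ 0 < c₂ ∧ ∀ H : E3 → Fin 3 → ℂ, MemH1pT h H →
      c₁ * (∫ x in Omega h, gradAlphaSq (Omega h) α H x)
          - c₂ * (∫ x in Omega h, ∑ i, ‖H x i‖ ^ 2)
        ≤ (formB h k α ε ρ H H).re := by
  obtain ⟨hc0, hc1, hcε⟩ := essInf_inv_facts hh hε_pos hε_one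
  rw [← hρ_re] at hc0 hc1 hcε
  refine ⟨fun H F hH hF => ⟨hH.summable_crossR hF hh hk.le hα, hH.summable_dotR hF hh hk.le hα⟩,
    ρ.re / 2, k ^ 2 + k * (1 / h + 2 * k / ρ.re), by positivity, by positivity, fun H hH => ?_⟩
  exact hH.garding hh hk hα hε_bdd hc0 hc1 hcε
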